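/- Let $N\ge 2$, $\hbar>0$, $\alpha\in\mathbb R$, and let $\lambda,\eta$ be nonzero reals. For an open set $\Omega\subset\mathbb R^N$ let $\hat q_i$ be multiplication by $q_i$ and $\hat p_i=-\mathrm i\hbar\,\partial_{q_i}$ on $C_c^\infty(\Omega,\mathbb C)$, so that $[\hat q_i,\hat p_j]=\mathrm i\hbar\delta_{ij}$, and write $\hat{\mathbf p}^2=\sum_k\hat p_k^2$. The Schrödinger quantization of $\mathcal H(\mathbf q,\mathbf p)=K(\mathbf q)\,\mathbf p^2+V(\mathbf q)$ is $\hat{\mathcal H}=K(\hat{\mathbf q})\,\hat{\mathbf p}^2+V(\hat{\mathbf q})$. An observable is an operator which is symmetric on $C_c^\infty(\Omega,\mathbb C)$ for the inner product $\int \bar f g\,w\,d\mathbf q$, with the weight $w$ given below. Operators are called algebraically independent if no nonzero complex polynomial, each monomial of which is evaluated at them as a symmetrized product (the mean over all orderings of the factors), vanishes at them. For $m=2,\dots,N$ put $$\hat S^{(m)}=\sum_{1\le i<j\le m}(\hat q_i\hat p_j-\hat q_j\hat p_i)^2,\qquad \hat S_{(m)}=\sum_{N-m<i<j\le N}(\hat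 q_i\hat p_j-\hat q_j\hat p_i)^2,$$ so that $\hat S^{(N)}=\hat S_{(N)}=\hat{\mathbf L}^2$ is the square of the total angular momentum, and put $$\hat A_i=\tfrac12\sum_{k=1}^N\hat p_k(\hat q_k\hat p_i-\hat q_i\hat p_k)+\tfrac12\sum_{k=1}^N(\hat q_k\hat p_i-\hat q_i\hat p_k)\hat p_k .$$ Consider the four classical Hamiltonians $$\mathcal H_{\rm KC}=\frac{\mathbf p^2}{2\mathbf q^2}+\frac{\alpha}{\mathbf q^2},\qquad \mathcal H_\lambda=\frac{\mathbf p^2}{2(1+\lambda\mathbf q^2)}-\frac{\lambda\alpha\,\mathbf q^2}{1+\lambda\mathbf q^2},\qquad \mathcal H_{\rm O}=\tfrac12|\mathbf q|\,\mathbf p^2+\alpha|\mathbf q|,\qquad \mathcal H_\eta=\frac{|\mathbf q|\,\mathbf p^2}{2(\eta+|\mathbf q|)}+\frac{\alpha|\mathbf q|}{\eta+|\mathbf q|}$$ on $\Omega=\{\mathbf q\ne0\}$, $\{1+\lambda\mathbf q^2>0\}$, $\{\mathbf q\neq 0\}$, $\{\mathbf q\ne0,\ \eta+|\mathbf q|>0\}$,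 with weights $w=\mathbf q^2$, $1+\lambda\mathbf q^2$, $|\mathbf q|^{-1}$, $(\eta+|\mathbf q|)/|\mathbf q|$ (the conformal factors of their metrics), respectively. (i) Their Schrödinger quantizations are $$\hat{\mathcal H}_{\rm KC}=\frac1{2\hat{\mathbf q}^2}\hat{\mathbf p}^2+\frac{\alpha}{\hat{\mathbf q}^2},\quad \hat{\mathcal H}_\lambda=\frac{1}{2(1+\lambda\hat{\mathbf q}^2)}\hat{\mathbf p}^2-\frac{\lambda\alpha\,\hat{\mathbf q}^2}{1+\lambda\hat{\mathbf q}^2},\quad \hat{\mathcal H}_{\rm O}=\tfrac12|\hat{\mathbf q}|\,\hat{\mathbf p}^2+\alpha|\hat{\mathbf q}|,\quad \hat{\mathcal H}_\eta=\frac{|\hat{\mathbf q}|}{2(\eta+|\hat{\mathbf q}|)}\hat{\mathbf p}^2+\frac{\alpha|\hat{\mathbf q}|}{\eta+|\hat{\mathbf q}|}.$$ (ii) Let $\hat{\mathcal H}$ be any of these four operators. It commutes with all $\hat S^{(m)}$ and $\hat S_{(m)}$, which are $2N-3$ distinct operators. Each of the sets $\{\hat{\mathcal H},\hat S^{(m)}: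 2\le m\le N\}$ and $\{\hat{\mathcal H},\hat S_{(m)}: 2\le m\le N\}$ consists of $N$ algebraically independent, mutually commuting observables. (iii) The operators $\hat S_{ij}=\hat p_i\hat p_j-2\hat q_i\hat q_j\hat{\mathcal H}_{\rm KC}$ are observables that commute with $\hat{\mathcal H}_{\rm KC}$, and $\sum_i\hat S_{ii}=-2\alpha$. The operators $\hat S_{ij}=\hat p_i\hat p_j-2\lambda\hat q_i\hat q_j(\hat{\mathcal H}_\lambda+\alpha)$ are observables that commute with $\hat{\mathcal H}_\lambda$, and $\sum_i\hat S_{ii}=2\hat{\mathcal H}_\lambda$. For these two systems and each fixed $i\in\{1,\dots,N\}$, the set $\{\hat{\mathcal H},\hat S^{(m)},\hat S_{(m)},\hat S_{ii}: 2\le m\le N\}$ consists of $2N-1$ algebraically independent observables, each commuting with $\hat{\mathcal H}$. (iv) The operators $\hat S_i=\hat A_i+\frac{\hat q_i}{|\hat{\mathbf q}|}\hat{\mathcal H}_{\rm O}$ are observables that commute with $\hat{\mathcal H}_{\rm O}$, and $$\sum_i\hat S_i^2=\hat{\mathcal H}_{\rm O}^2-2\alpha\hat{\mathbf L}^2-\tfrac12(N-1)^2\hbar^2\alpha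 .$$ The operators $\hat S_i=\hat A_i+\eta\frac{\hat q_i}{|\hat{\mathbf q}|}\hat{\mathcal H}_\eta$ are observables that commute with $\hat{\mathcal H}_\eta$, and $$\sum_i\hat S_i^2=2\hat{\mathbf L}^2(\hat{\mathcal H}_\eta-\alpha)+\eta^2\hat{\mathcal H}_\eta^2+\tfrac12(N-1)^2\hbar^2(\hat{\mathcal H}_\eta-\alpha).$$ For these two systems and each fixed $i\in\{1,\dots,N\}$, the set $\{\hat{\mathcal H},\hat S^{(m)},\hat S_{(m)},\hat S_i: 2\le m\le N\}$ consists of $2N-1$ algebraically independent observables, each commuting with $\hat{\mathcal H}$. -/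

import Mathlib

open TopologicalSpace
open scoped ContDiff Distributions

noncomputable section

namespace CurvedQuantum

/-- The Euclidean configuration (or momentum) space `ℝ^N`. -/
abbrev E (N : ℕ) : Type := EuclideanSpace ℝ (Fin N)

/-- Linear operators on `C_c^∞(Ω, ℂ)`, the common invariant domain of all the differential operators
below; the product is the composition of operators. -/
abbrev Op {N : ℕ} (Ω : Opens (E N)) : Type := Module.End ℂ 𝓓(Ω, ℂ)

section Basic

variable {N : ℕ} (Ω : Opens (E N))

/-- Multiplication by a function which is smooth on `Ω`: the operator `φ(q̂)`. -/
def mulOp (φ : E N → ℝ) (hφ : ContDiffOn ℝ ∞ φ Ω) : Op Ω where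
  toFun f :=
    { toFun := fun x => (φ x : ℂ) * f x
      contDiff' := by
        refine contDiff_iff_contDiffAt.2 fun x => ?_
        by_cases hx : x ∈ tsupport f
        · have h1 : ContDiffAt ℝ ∞ φ x :=
            hφ.contDiffAt (Ω.isOpen.mem_nhds (f.tsupport_subset hx))
          exact (Complex.ofRealCLM.contDiff.contDiffAt.comp x h1).mul f.contDiff.contDiffAt
        · have h1 : f =ᶠ[nhds x] (0 : E N → ℂ) := notMem_tsupport_iff_eventuallyEq.1 hx
          have h2 : (fun y => (φ y : ℂ) * f y) =ᶠ[nhds x] fun _ => (0 : ℂ) :=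
            h1.mono fun y hy => by simp [hy]
          exact contDiffAt_const.congr_of_eventuallyEq h2
      hasCompactSupport' := f.hasCompactSupport.mul_left
      tsupport_subset' := tsupport_mul_subset_right.trans f.tsupport_subset }
  map_add' f g := by
    ext x
    exact mul_add (φ x : ℂ) (f x) (g x)
  map_smul' c f := by
    ext x
    exact mul_left_comm (φ x : ℂ) c (f x)

/-- The position operator `q̂_i`. -/
def posOp (i : Fin N) : Op Ω :=
  mulOp Ω (fun x => x i) (EuclideanSpace.proj (𝕜 := ℝ) i).contDiff.contDiffOn

/-- The momentum operator `p̂_i = -i ħ ∂/∂q_i`. -/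
def momOp (hbar : ℝ) (i : Fin N) : Op Ω where
  toFun f :=
    { toFun := fun x =>
        (-Complex.I * (hbar : ℂ)) * fderiv ℝ f x (EuclideanSpace.single i (1 : ℝ))
      contDiff' := contDiff_const.mul
        ((f.contDiff.fderiv_right (m := ∞) le_rfl).clm_apply contDiff_const)
      hasCompactSupport' := (f.hasCompactSupport.fderiv_apply ℝ _).mul_left
      tsupport_subset' := tsupport_mul_subset_right.trans
        ((tsupport_fderiv_apply_subset ℝ _).trans f.tsupport_subset) }
  map_add' f g := by
    ext x
    have hf : DifferentiableAt ℝ f x := (f.contDiff.differentiable (by simp)).differentiableAt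
    have hg : DifferentiableAt ℝ g x := (g.contDiff.differentiable (by simp)).differentiableAt
    have h : fderiv ℝ (f + g : 𝓓(Ω, ℂ)) x = fderiv ℝ f x + fderiv ℝ g x := fderiv_add hf hg
    change (-Complex.I * (hbar : ℂ)) * fderiv ℝ (f + g : 𝓓(Ω, ℂ)) x _ =
      (-Complex.I * (hbar : ℂ)) * fderiv ℝ f x _ + (-Complex.I * (hbar : ℂ)) * fderiv ℝ g x _
    rw [h, add_apply, mul_add]
  map_smul' c f := by
    ext x
    have hf : DifferentiableAt ℝ f x := (f.contDiff.differentiable (by simp)).differentiableAt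
    have h : fderiv ℝ (c • f : 𝓓(Ω, ℂ)) x = c • fderiv ℝ f x := fderiv_const_smul hf c
    change (-Complex.I * (hbar : ℂ)) * fderiv ℝ (c • f : 𝓓(Ω, ℂ)) x _ =
      c * ((-Complex.I * (hbar : ℂ)) * fderiv ℝ f x _)
    rw [h, smul_apply, smul_eq_mul, mul_left_comm]

/-- `p̂² = ∑ p̂_k²`. -/
def momSq (hbar : ℝ) : Op Ω := ∑ k, momOp Ω hbar k ^ 2

/-- `q̂_i p̂_j - q̂_j p̂_i`. -/
def angMom (hbar : ℝ) (i j : Fin N) : Op Ω :=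
  posOp Ω i * momOp Ω hbar j - posOp Ω j * momOp Ω hbar i

/-- `Ŝ^{(m)}`: the sum over the pairs `i < j` of the first `m` coordinates
(`Fin N` counts from `0`, so the `i`-th coordinate has value `i - 1`). -/
def leftCasimir (hbar : ℝ) (m : ℕ) : Op Ω :=
  ∑ ij : Fin N × Fin N with ij.1 < ij.2 ∧ (ij.2 : ℕ) + 1 ≤ m, angMom Ω hbar ij.1 ij.2 ^ 2

/-- `Ŝ_{(m)}`: the sum over the pairs `i < j` of the last `m` coordinates,
`N - m < i < j ≤ N` when counting from `1`. -/
def rightCasimir (hbar : ℝ) (m : ℕ) : Op Ω :=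
  ∑ ij : Fin N × Fin N with ij.1 < ij.2 ∧ N < ((ij.1 : ℕ) + 1) + m, angMom Ω hbar ij.1 ij.2 ^ 2

/-- The square `L̂²` of the total angular momentum. -/
def totalAngMomSq (hbar : ℝ) : Op Ω :=
  ∑ ij : Fin N × Fin N with ij.1 < ij.2, angMom Ω hbar ij.1 ij.2 ^ 2

/-- The set `{Ŝ^{(m)} : m = 2, …, N}`. -/
def leftCasimirs (hbar : ℝ) : Set (Op Ω) := leftCasimir Ω hbar '' Set.Icc 2 N

/-- The set `{Ŝ_{(m)} : m = 2, …, N}`. -/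
def rightCasimirs (hbar : ℝ) : Set (Op Ω) := rightCasimir Ω hbar '' Set.Icc 2 N

/-- The symmetrized quantum Laplace-Runge-Lenz seed
`½ ∑ p̂_k (q̂_k p̂_i - q̂_i p̂_k) + ½ ∑ (q̂_k p̂_i - q̂_i p̂_k) p̂_k`. -/
def lrlSeed (hbar : ℝ) (i : Fin N) : Op Ω :=
  (1 / 2 : ℂ) • (∑ k, momOp Ω hbar k * angMom Ω hbar k i) +
    (1 / 2 : ℂ) • (∑ k, angMom Ω hbar k i * momOp Ω hbar k)

end Basic

section Predicates

variable {N : ℕ} {Ω : Opens (E N)}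

/-- `Ĥ` is the Schrödinger quantization of the classical Hamiltonian `H(q, p)` on `Ω × ℝ^N`:
`H(q, p) = K(q) p² + V(q)` there, and `Ĥ = K(q̂) p̂² + V(q̂)`. -/
def IsSchrodingerQuantization (hbar : ℝ) (Hc : E N → E N → ℝ) (H : Op Ω) : Prop :=
  ∃ (K V : E N → ℝ) (hK : ContDiffOn ℝ ∞ K Ω) (hV : ContDiffOn ℝ ∞ V Ω),
    (∀ q ∈ Ω, ∀ p, Hc q p = K q * ‖p‖ ^ 2 + V q) ∧
      H = mulOp Ω K hK * momSq Ω hbar + mulOp Ω V hV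

/-- `A` is symmetric (formally self-adjoint) on `C_c^∞(Ω)` for the `L²` inner product of the measure
`w(q) dq`. -/
def IsObservable (w : E N → ℝ) (A : Op Ω) : Prop :=
  ∀ f g : 𝓓(Ω, ℂ),
    ∫ x, starRingEnd ℂ (A f x) * g x * (w x : ℂ) = ∫ x, starRingEnd ℂ (f x) * A g x * (w x : ℂ)

/-- The symmetrized product of the operators `A i` for `i` in the multiset of the monomial `m`:
the mean of the products over all orderings of the factors. -/
def symmMonomial {ι : Type*} (A : ι → Op Ω) (m : ι →₀ ℕ) : Op Ω :=
  ((m.toMultiset.toList.length.factorial : ℂ)⁻¹) •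
    (m.toMultiset.toList.permutations.map fun l => (l.map A).prod).sum

/-- The value of a polynomial at a family of operators, all monomials being symmetrized. -/
def symmEval {ι : Type*} (A : ι → Op Ω) (P : MvPolynomial ι ℂ) : Op Ω :=
  ∑ m ∈ P.support, P.coeff m • symmMonomial A m

/-- The operators of `s` are algebraically independent: no nonzero polynomial, evaluated through
symmetrized products, vanishes at them. -/
def AlgIndepOps (s : Set (Op Ω)) : Prop :=
  ∀ P : MvPolynomial s ℂ, symmEval (fun A : s => (A : Op Ω)) P = 0 → P = 0

/-- `s` consists of exactly `n` algebraically independent observables. -/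
structure IsIndepObservables (w : E N → ℝ) (s : Set (Op Ω)) (n : ℕ) : Prop where
  finite : s.Finite
  card : s.ncard = n
  observable : ∀ A ∈ s, IsObservable w A
  algIndep : AlgIndepOps s

/-- The `2N - 3` angular momentum symmetries of `H`, which give, in two ways, `N` algebraically
independent observables that commute with each other. -/
structure HasAngularMomentumSymmetries (hbar : ℝ) (w : E N → ℝ) (H : Op Ω) : Prop where
  left_top : leftCasimir Ω hbar N = totalAngMomSq Ω hbar
  right_top : rightCasimir Ω hbar N = totalAngMomSq Ω hbar
  card : (leftCasimirs Ω hbar ∪ rightCasimirs Ω hbar).ncard = 2 * N - 3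
  commute : ∀ A ∈ leftCasimirs Ω hbar ∪ rightCasimirs Ω hbar, Commute H A
  left_indep : IsIndepObservables w (insert H (leftCasimirs Ω hbar)) N
  left_commute : ∀ A ∈ insert H (leftCasimirs Ω hbar), ∀ B ∈ insert H (leftCasimirs Ω hbar),
    Commute A B
  right_indep : IsIndepObservables w (insert H (rightCasimirs Ω hbar)) N
  right_commute : ∀ A ∈ insert H (rightCasimirs Ω hbar), ∀ B ∈ insert H (rightCasimirs Ω hbar),
    Commute A B

/-- `H`, the angular momentum operators and `S` are `2N - 1` algebraically independent observables,
each of which commutes with `H`. -/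
def IsMaximallySuperintegrableWith (hbar : ℝ) (w : E N → ℝ) (H S : Op Ω) : Prop :=
  IsIndepObservables w (insert H (insert S (leftCasimirs Ω hbar ∪ rightCasimirs Ω hbar)))
      (2 * N - 1) ∧
    ∀ A ∈ insert H (insert S (leftCasimirs Ω hbar ∪ rightCasimirs Ω hbar)), Commute H A

end Predicates

section Systems

variable (N : ℕ)

/-- `{q : q ≠ 0}`. -/
def punctured : Opens (E N) := ⟨{x | x ≠ 0}, isOpen_ne⟩

/-- `{q : 1 + λ q² > 0}`. -/
def darbouxDomain (lam : ℝ) : Opens (E N) :=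
  ⟨{x | 0 < 1 + lam * ‖x‖ ^ 2}, isOpen_lt continuous_const (by fun_prop)⟩

/-- `{q : q ≠ 0, η + |q| > 0}`. -/
def taubNUTDomain (eta : ℝ) : Opens (E N) :=
  ⟨{x | x ≠ 0 ∧ 0 < eta + ‖x‖}, isOpen_ne.inter (isOpen_lt continuous_const (continuous_const.add continuous_norm))⟩

variable {N}

theorem contDiffOn_norm_of_ne {Ω : Opens (E N)} (h : ∀ x ∈ Ω, x ≠ 0) :
    ContDiffOn ℝ ∞ (fun x : E N => ‖x‖) Ω :=
  fun x hx => (contDiffAt_norm ℝ (h x hx)).contDiffWithinAt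

theorem contDiffOn_normSq (Ω : Opens (E N)) : ContDiffOn ℝ ∞ (fun x : E N => ‖x‖ ^ 2) Ω :=
  (contDiff_norm_sq ℝ).contDiffOn

theorem punctured_ne (x : E N) (hx : x ∈ punctured N) : x ≠ 0 := hx

theorem taubNUT_ne (eta : ℝ) (x : E N) (hx : x ∈ taubNUTDomain N eta) : x ≠ 0 := by
  exact And.left hx

theorem taubNUT_pos (eta : ℝ) (x : E N) (hx : x ∈ taubNUTDomain N eta) : 0 < eta + ‖x‖ := by
  exact And.right hx

/-- Multiplication by `q_i / |q|`. -/
def unitOp (Ω : Opens (E N)) (h : ∀ x ∈ Ω, x ≠ 0) (i : Fin N) : Op Ω :=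
  mulOp Ω (fun x => x i / ‖x‖)
    ((EuclideanSpace.proj (𝕜 := ℝ) i).contDiff.contDiffOn.div (contDiffOn_norm_of_ne h)
      fun x hx => norm_ne_zero_iff.2 (h x hx))

/-! The curved Kepler-Coulomb system. -/

def classicalKC (α : ℝ) (q p : E N) : ℝ := ‖p‖ ^ 2 / (2 * ‖q‖ ^ 2) + α / ‖q‖ ^ 2

def quantumKC (hbar α : ℝ) : Op (punctured N) :=
  mulOp _ (fun x => 1 / (2 * ‖x‖ ^ 2))
      (contDiffOn_const.div (contDiffOn_const.mul (contDiffOn_normSq _))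
        fun _ hx => mul_ne_zero two_ne_zero (pow_ne_zero 2 (norm_ne_zero_iff.2 hx))) *
      momSq _ hbar +
    mulOp _ (fun x => α / ‖x‖ ^ 2)
      (contDiffOn_const.div (contDiffOn_normSq _)
        fun _ hx => pow_ne_zero 2 (norm_ne_zero_iff.2 hx))

def fradkinKC (hbar α : ℝ) (i j : Fin N) : Op (punctured N) :=
  momOp _ hbar i * momOp _ hbar j - (2 : ℂ) • (posOp _ i * posOp _ j * quantumKC hbar α)

/-- Conformal factor of the metric `q² dq²`. -/
def weightKC (x : E N) : ℝ := ‖x‖ ^ 2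

/-! The Darboux III oscillator. -/

def classicalDarboux (lam α : ℝ) (q p : E N) : ℝ :=
  ‖p‖ ^ 2 / (2 * (1 + lam * ‖q‖ ^ 2)) - lam * α * ‖q‖ ^ 2 / (1 + lam * ‖q‖ ^ 2)

def quantumDarboux (hbar lam α : ℝ) : Op (darbouxDomain N lam) :=
  mulOp _ (fun x => 1 / (2 * (1 + lam * ‖x‖ ^ 2)))
      (contDiffOn_const.div
        (contDiffOn_const.mul (contDiffOn_const.add (contDiffOn_const.mul (contDiffOn_normSq _))))
        fun _ hx => mul_ne_zero two_ne_zero (ne_of_gt hx)) *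
      momSq _ hbar -
    mulOp _ (fun x => lam * α * ‖x‖ ^ 2 / (1 + lam * ‖x‖ ^ 2))
      ((contDiffOn_const.mul (contDiffOn_normSq _)).div
        (contDiffOn_const.add (contDiffOn_const.mul (contDiffOn_normSq _)))
        fun _ hx => ne_of_gt hx)

def fradkinDarboux (hbar lam α : ℝ) (i j : Fin N) : Op (darbouxDomain N lam) :=
  momOp _ hbar i * momOp _ hbar j -
    (2 * lam : ℂ) • (posOp _ i * posOp _ j * (quantumDarboux hbar lam α + (α : ℂ) • 1))

/-- Conformal factor of the metric `(1 + λ q²) dq²`. -/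
def weightDarboux (lam : ℝ) (x : E N) : ℝ := 1 + lam * ‖x‖ ^ 2

/-! The curved spherical oscillator. -/

def classicalO (α : ℝ) (q p : E N) : ℝ := 1 / 2 * ‖q‖ * ‖p‖ ^ 2 + α * ‖q‖

def quantumO (hbar α : ℝ) : Op (punctured N) :=
  mulOp _ (fun x => 1 / 2 * ‖x‖) (contDiffOn_const.mul (contDiffOn_norm_of_ne punctured_ne)) *
      momSq _ hbar +
    mulOp _ (fun x => α * ‖x‖) (contDiffOn_const.mul (contDiffOn_norm_of_ne punctured_ne))

def lrlO (hbar α : ℝ) (i : Fin N) : Op (punctured N) :=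
  lrlSeed _ hbar i + unitOp _ punctured_ne i * quantumO hbar α

/-- Conformal factor of the metric `|q|⁻¹ dq²`. -/
def weightO (x : E N) : ℝ := 1 / ‖x‖

/-! The Taub-NUT oscillator. -/

def classicalTaubNUT (eta α : ℝ) (q p : E N) : ℝ :=
  ‖q‖ * ‖p‖ ^ 2 / (2 * (eta + ‖q‖)) + α * ‖q‖ / (eta + ‖q‖)

def quantumTaubNUT (hbar eta α : ℝ) : Op (taubNUTDomain N eta) :=
  mulOp _ (fun x => ‖x‖ / (2 * (eta + ‖x‖)))
      ((contDiffOn_norm_of_ne (taubNUT_ne eta)).div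
        (contDiffOn_const.mul (contDiffOn_const.add (contDiffOn_norm_of_ne (taubNUT_ne eta))))
        fun x hx => mul_ne_zero two_ne_zero (taubNUT_pos eta x hx).ne') *
      momSq _ hbar +
    mulOp _ (fun x => α * ‖x‖ / (eta + ‖x‖))
      ((contDiffOn_const.mul (contDiffOn_norm_of_ne (taubNUT_ne eta))).div
        (contDiffOn_const.add (contDiffOn_norm_of_ne (taubNUT_ne eta)))
        fun x hx => (taubNUT_pos eta x hx).ne')

def lrlTaubNUT (hbar eta α : ℝ) (i : Fin N) : Op (taubNUTDomain N eta) :=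
  lrlSeed _ hbar i + (eta : ℂ) • (unitOp _ (taubNUT_ne eta) i * quantumTaubNUT hbar eta α)

/-- Conformal factor of the metric `((η + |q|) / |q|) dq²`. -/
def weightTaubNUT (eta : ℝ) (x : E N) : ℝ := (eta + ‖x‖) / ‖x‖

end Systems

end CurvedQuantum

end

open CurvedQuantum

/-! All four Hamiltonians have the form `H = W⁻¹ K - β` with `K = ½ p̂² + α` and `W` the conformal
factor: `W = c + k q²` for Kepler-Coulomb (`c = 0`, `k = 1`) and Darboux III (`c = 1`, `k = λ`, `β =
α`), and `W = c + k / |q|` for the spherical oscillator (`c = 0`, `k = 1`) and Taub-NUT (`c = 1`, `k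
= η`). Everything radial commutes with the angular momenta, which gives the Casimir symmetries.

For the extra symmetries, take `β = 0`, so that `W H = K`. If `B` commutes with `K`, `u` commutes
with `W`, and `κ [K, u] = [W, B]`, then `B + κ u H` commutes with `H` (`commute_of_conformal`) and,
for symmetric `B` and `u`, is symmetric for the weight `W` (`intertwine_of_conformal`,
`IsFormalAdjoint.isObservable`). For `W = c + k q²` one takes `B = p_i p_j`, `u = q_i q_j`, `κ =
-2k`, because `[p_i p_j, q²] = [p², q_i q_j]`. For `W = c + k / |q|` one takes `B = A_i`, `u = q_i /
|q|`, `κ = k`, because `[1/|q|, A_i] = ½ [p², q_i / |q|]`. The sums of squares follow from `∑ A_i² =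
p² Λ` and `∑ (A_i u_i + u_i A_i) = -2 |q|⁻¹ Λ`, where `Λ = L² + ¼ (N - 1)² ħ²`.

Algebraic independence is read off principal symbols. Let `M` be multiplication by `ξ · q`. The
commutator with `M`, iterated `2d` times, kills every product of fewer than `d` second order
operators and sends a product of `d` of them to a nonzero constant times the product of their
symbols at `(x, ξ)`, in whatever order the factors stand. So the top homogeneous part of a
polynomial relation vanishes at the values of the symbols, and it is enough that these values are
Zariski dense (`eq_zero_of_symmEval_eq_zero`).

Density is proved in two layers. The Casimir symbols are sums of squares of the areas `x_i ξ_j - x_j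
ξ_i`; their values are dense by a triangular choice of parameters in a degenerate limit
(`zariskiDense_casimirSymbol`). The areas are invariant under `SL₂` acting on the pair `(x, ξ)`, so
with the Casimirs fixed one can still move along an `SL₂` orbit, on which the symbols of `H` and of
the extra observable take a dense set of values (`zariskiDense_fullSymbol_fradkin`,
`zariskiDense_fullSymbol_lrl`). -/

namespace CurvedQuantum

/-! ### Commutators in a ring -/

section Ad

variable {R : Type*} [Ring R]

/-- The commutator `a * b - b * a`. -/
def ad (a b : R) : R := a * b - b * a

theorem ad_mul (a b d : R) : ad a (b * d) = ad a b * d + b * ad a d := by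
  simp only [ad]; noncomm_ring

theorem mul_ad (a b d : R) : ad (a * b) d = a * ad b d + ad a d * b := by
  simp only [ad]; noncomm_ring

theorem ad_add (a b d : R) : ad a (b + d) = ad a b + ad a d := by
  simp only [ad]; noncomm_ring

theorem add_ad (a b d : R) : ad (a + b) d = ad a d + ad b d := by
  simp only [ad]; noncomm_ring

theorem ad_sub (a b d : R) : ad a (b - d) = ad a b - ad a d := by
  simp only [ad]; noncomm_ring

theorem sub_ad (a b d : R) : ad (a - b) d = ad a d - ad b d := by
  simp only [ad]; noncomm_ring

theorem ad_skew (a b : R) : -ad b a = ad a b := by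
  simp only [ad]; abel

theorem ad_eq_zero_iff {a b : R} : ad a b = 0 ↔ Commute a b := by
  rw [ad, sub_eq_zero]; rfl

theorem ad_sum {κ : Type*} (s : Finset κ) (a : R) (f : κ → R) :
    ad a (∑ k ∈ s, f k) = ∑ k ∈ s, ad a (f k) := by
  simp only [ad, Finset.mul_sum, Finset.sum_mul, Finset.sum_sub_distrib]

theorem sum_ad {κ : Type*} (s : Finset κ) (a : R) (f : κ → R) :
    ad (∑ k ∈ s, f k) a = ∑ k ∈ s, ad (f k) a := by
  simp only [ad, Finset.mul_sum, Finset.sum_mul, Finset.sum_sub_distrib]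

theorem ad_smul [Algebra ℂ R] (z : ℂ) (a b : R) : ad a (z • b) = z • ad a b := by
  simp [ad, smul_sub]

theorem smul_ad [Algebra ℂ R] (z : ℂ) (a b : R) : ad (z • a) b = z • ad a b := by
  simp [ad, smul_sub]

theorem mul_eq_mul_add_ad (a b : R) : a * b = b * a + ad a b := by
  simp only [ad]; abel

end Ad

section Ang

variable {R : Type*} [Ring R] {ι : Type*}

/-- `q i * p j - q j * p i`. -/
def ang (q p : ι → R) (i j : ι) : R := q i * p j - q j * p i

theorem ang_antisymm (q p : ι → R) (i j : ι) : ang q p i j = -ang q p j i := by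
  simp [ang]

theorem ang_self (q p : ι → R) (i : ι) : ang q p i i = 0 := by simp [ang]

end Ang

/-! ### Consequences of the canonical commutation relations -/

section Canonical

variable {R : Type*} [Ring R] [Algebra ℂ R] {ι : Type*}

/-- The canonical commutation relations `[q i, p j] = c δ i j`. -/
structure IsCanonical [DecidableEq ι] (c : ℂ) (q p : ι → R) : Prop where
  q_comm : ∀ i j, Commute (q i) (q j)
  p_comm : ∀ i j, Commute (p i) (p j)
  ad_q_p : ∀ i j, ad (q i) (p j) = if i = j then c • (1 : R) else 0

namespace IsCanonical

variable [DecidableEq ι] {c : ℂ} {q p : ι → R} (h : IsCanonical c q p)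
include h

theorem ad_p_q (i j : ι) : ad (p i) (q j) = if i = j then -(c • (1 : R)) else 0 := by
  rw [← ad_skew, h.ad_q_p]
  by_cases hij : i = j
  · simp [hij]
  · simp [hij, Ne.symm hij]

/-- The operators `ang q p a b` generate rotations: they act on positions, and likewise on momenta,
as on the components of a vector, and hence on each other as on a tensor. -/
theorem ad_ang_q (a b i : ι) :
    ad (ang q p a b) (q i) = (if a = i then c • q b else 0) - (if b = i then c • q a else 0) := by
  have hq : ∀ i j, ad (q i) (q j) = 0 := fun i j => ad_eq_zero_iff.2 (h.q_comm i j)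
  rw [ang, sub_ad, mul_ad, mul_ad, h.ad_p_q, h.ad_p_q, hq, hq]
  split_ifs <;> (simp; try abel)

theorem ad_ang_p (a b i : ι) :
    ad (ang q p a b) (p i) = (if a = i then c • p b else 0) - (if b = i then c • p a else 0) := by
  have hp : ∀ i j, ad (p i) (p j) = 0 := fun i j => ad_eq_zero_iff.2 (h.p_comm i j)
  rw [ang, sub_ad, mul_ad, mul_ad, h.ad_q_p, h.ad_q_p, hp, hp]
  split_ifs <;> simp

theorem ad_ang_ang (a b i j : ι) :
    ad (ang q p a b) (ang q p i j) =
      (if a = i then c • ang q p b j else 0) - (if b = i then c • ang q p a j else 0) +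
      ((if a = j then c • ang q p i b else 0) - (if b = j then c • ang q p i a else 0)) := by
  conv_lhs => rw [ang.eq_1 q p i j, ad_sub, ad_mul, ad_mul]
  rw [h.ad_ang_q, h.ad_ang_q, h.ad_ang_p, h.ad_ang_p]
  simp only [ang]
  split_ifs <;> simp [smul_sub, sub_mul, mul_sub] <;> abel

/-- `L_ki = p_i q_k - p_k q_i`. -/
theorem ang_eq_p_mul_q (k i : ι) : ang q p k i = p i * q k - p k * q i := by
  rw [ang, mul_eq_mul_add_ad (q k) (p i), mul_eq_mul_add_ad (q i) (p k), h.ad_q_p, h.ad_q_p]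
  by_cases hik : i = k
  · subst hik; simp
  · simp [hik, Ne.symm hik]

/-- The cyclic sum antisymmetrizes `q p p` in all three indices, and the momenta commute. -/
theorem ang_plucker (a b d : ι) :
    ang q p a b * p d + ang q p b d * p a + ang q p d a * p b = 0 := by
  simp only [ang, sub_mul, mul_assoc]
  rw [(h.p_comm b d).eq, (h.p_comm a d).eq, (h.p_comm a b).eq]
  abel

theorem ang_comm_sum_p_sq [Fintype ι] (a b : ι) : Commute (ang q p a b) (∑ k, p k ^ 2) := by
  rw [← ad_eq_zero_iff, ad_sum]
  have : ∀ k, ad (ang q p a b) (p k ^ 2) = ((if a = k then c • (p b * p k + p k * p b) else 0) -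
      (if b = k then c • (p a * p k + p k * p a) else 0)) := by
    intro k
    rw [pow_two, ad_mul, h.ad_ang_p]
    split_ifs <;> simp [sub_mul, mul_sub] <;> abel
  simp only [this, Finset.sum_sub_distrib, Finset.sum_ite_eq, Finset.mem_univ, if_true]
  rw [(h.p_comm a b).eq]; abel

theorem ang_comm_sum_q_sq [Fintype ι] (a b : ι) : Commute (ang q p a b) (∑ k, q k ^ 2) := by
  rw [← ad_eq_zero_iff, ad_sum]
  have : ∀ k, ad (ang q p a b) (q k ^ 2) = ((if a = k then c • (q b * q k + q k * q b) else 0) -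
      (if b = k then c • (q a * q k + q k * q a) else 0)) := by
    intro k
    rw [pow_two, ad_mul, h.ad_ang_q]
    split_ifs <;> simp [sub_mul, mul_sub] <;> abel
  simp only [this, Finset.sum_sub_distrib, Finset.sum_ite_eq, Finset.mem_univ, if_true]
  rw [(h.q_comm a b).eq]; abel

/-- Since `a` and `b` lie in `s`, each delta symbol collapses one of the two sums. The terms left
over from `a` and from `b` are the same anticommutators with opposite signs. -/
theorem ang_comm_casimir (s : Finset ι) {a b : ι} (ha : a ∈ s) (hb : b ∈ s) :
    Commute (ang q p a b) (∑ i ∈ s, ∑ j ∈ s, ang q p i j ^ 2) := by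
  rw [← ad_eq_zero_iff, ad_sum]
  have : ∀ i j, ad (ang q p a b) (ang q p i j ^ 2) =
      ((if a = i then c • (ang q p b j * ang q p i j + ang q p i j * ang q p b j) else 0) -
      (if b = i then c • (ang q p a j * ang q p i j + ang q p i j * ang q p a j) else 0)) +
      ((if a = j then c • (ang q p i b * ang q p i j + ang q p i j * ang q p i b) else 0) -
      (if b = j then c • (ang q p i a * ang q p i j + ang q p i j * ang q p i a) else 0)) := by
    intro i j
    rw [pow_two, ad_mul, h.ad_ang_ang]
    split_ifs <;> simp [sub_mul, mul_sub, add_mul, mul_add] <;> abel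
  simp only [ad_sum, this, Finset.sum_add_distrib, Finset.sum_sub_distrib]
  have e1 : ∀ (f : ι → ι → R) (a : ι), a ∈ s →
      ∑ i ∈ s, ∑ j ∈ s, (if a = i then f i j else 0) = ∑ j ∈ s, f a j := by
    intro f a ha
    rw [Finset.sum_comm]
    exact Finset.sum_congr rfl fun j _ => by simp [ha]
  have e2 : ∀ (f : ι → ι → R) (a : ι), a ∈ s →
      ∑ i ∈ s, ∑ j ∈ s, (if a = j then f i j else 0) = ∑ i ∈ s, f i a := by
    intro f a ha
    exact Finset.sum_congr rfl fun j _ => by simp [ha]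
  rw [e1 _ a ha, e1 _ b hb, e2 _ a ha, e2 _ b hb, ← Finset.sum_sub_distrib,
    ← Finset.sum_sub_distrib, ← Finset.sum_add_distrib]
  refine Finset.sum_eq_zero fun j _ => ?_
  simp only [smul_add]
  abel

/-- Both sides equal `-2c (p i * q j + q i * p j)`. This identity is what makes the Fradkin tensor
work. -/
theorem ad_p_mul_p_sum_q_sq [Fintype ι] (i j : ι) :
    ad (p i * p j) (∑ k, q k ^ 2) = ad (∑ k, p k ^ 2) (q i * q j) := by
  have h1 : ∀ k, ad (p k) (∑ l, q l ^ 2) = -((2 * c) • q k) := by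
    intro k
    rw [ad_sum]
    have : ∀ l, ad (p k) (q l ^ 2) = if k = l then -((2 * c) • q l) else 0 := by
      intro l
      rw [pow_two, ad_mul, h.ad_p_q]
      split_ifs <;> simp [two_mul, add_smul]
    simp [this]
  have h2 : ∀ i, ad (∑ k, p k ^ 2) (q i) = -((2 * c) • p i) := by
    intro i
    rw [sum_ad]
    have : ∀ k, ad (p k ^ 2) (q i) = if i = k then -((2 * c) • p k) else 0 := by
      intro k
      rw [pow_two, mul_ad, h.ad_p_q]
      by_cases hk : i = k
      · subst hk; simp [two_mul, add_smul]
      · simp [hk, Ne.symm hk]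
    simp [this]
  rw [mul_ad, h1, h1, ad_mul, h2, h2]
  simp only [mul_neg, neg_mul, mul_smul_comm, smul_mul_assoc]

end IsCanonical

end Canonical


/-! ### Symmetries of a conformally rescaled Hamiltonian -/

section Conserved

variable {R : Type*} [Ring R] [Algebra ℂ R]

/-- If `W H = K` with `W` left cancellable, then `B + k u H` commutes with `H` as soon as
`[K, B] = 0`, `[u, W] = 0` and `k [K, u] = [W, B]`. -/
theorem commute_of_conformal {W Wi H K B u : R} {k : ℂ} (hi : Wi * W = 1) (hH : W * H = K)
    (hB : Commute K B) (hu : Commute u W) (hk : k • ad K u = ad W B) :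
    Commute H (B + k • (u * H)) := by
  rw [← ad_eq_zero_iff]
  -- Multiplying by `W` turns `H` into `K`: with `S = B + k u H` one has `W [H, S] = [K, S] - [W, S]
  -- H`, and `[K, H] = [W H, H] = [W, H] H`. The terms with `u [W, H] H` cancel and the rest is the
  -- hypothesis `hk`.
  have key : W * ad H (B + k • (u * H)) = 0 := by
    have e : W * ad H (B + k • (u * H)) =
        ad K (B + k • (u * H)) - ad W (B + k • (u * H)) * H := by
      rw [← hH, mul_ad]; abel
    rw [e, ad_add, ad_add, ad_smul, ad_smul, ad_mul, ad_mul, ad_eq_zero_iff.2 hB,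
      ad_eq_zero_iff.2 hu.symm, ← hk]
    have e2 : ad K H = ad W H * H := by
      rw [← hH]; simp only [ad]; noncomm_ring
    rw [e2]
    simp only [smul_add, smul_mul_assoc, add_mul, mul_assoc, zero_mul, zero_add]
    abel
  calc ad H (B + k • (u * H)) = Wi * W * ad H (B + k • (u * H)) := by rw [hi, one_mul]
    _ = 0 := by rw [mul_assoc, key, mul_zero]

/-- The weighted symmetry of `B + k u H`, for `Hd` the formal adjoint of `H`. -/
theorem intertwine_of_conformal {W H Hd K B u : R} {k : ℂ} (hH : W * H = K) (hHd : Hd * W = K)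
    (hu : Commute u W) (hk : k • ad K u = ad W B) :
    (B + k • (Hd * u)) * W = W * (B + k • (u * H)) := by
  rw [add_mul, mul_add, smul_mul_assoc, mul_smul_comm, mul_assoc, hu.eq, ← mul_assoc, hHd,
    ← mul_assoc, ← hu.eq, mul_assoc, hH, mul_eq_mul_add_ad W B, mul_eq_mul_add_ad K u, smul_add,
    hk]
  abel

end Conserved

/-! ### The Laplace-Runge-Lenz vector -/

section LRL

variable {R : Type*} [Ring R] [Algebra ℂ R] {ι : Type*} [Fintype ι]

set_option linter.unusedSectionVars false

/-- `½ ∑ p_k L_ki + ½ ∑ L_ki p_k`. -/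
noncomputable def lrl (q p : ι → R) (i : ι) : R :=
  (1 / 2 : ℂ) • (∑ k, p k * ang q p k i) + (1 / 2 : ℂ) • (∑ k, ang q p k i * p k)

/-- Exchanging the summation indices flips the sign of `L`, so only the antisymmetric part of `M`
contributes. -/
theorem sum_antisymm_mul (L : ι → ι → R) (hL : ∀ i j, L i j = -L j i) (M : ι → ι → R)
    : (2 : ℂ) • ∑ i, ∑ k, L k i * M k i = ∑ i, ∑ k, L k i * (M k i - M i k) := by
  have : ∑ i, ∑ k, L k i * M i k = - ∑ i, ∑ k, L k i * M k i := by
    rw [Finset.sum_comm, ← Finset.sum_neg_distrib]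
    refine Finset.sum_congr rfl fun i _ => ?_
    rw [← Finset.sum_neg_distrib]
    refine Finset.sum_congr rfl fun k _ => ?_
    rw [hL, neg_mul]
  simp only [mul_sub, Finset.sum_sub_distrib, this, two_smul]
  abel

theorem sum_mul_antisymm (L : ι → ι → R) (hL : ∀ i j, L i j = -L j i) (M : ι → ι → R)
    : (2 : ℂ) • ∑ i, ∑ k, M k i * L k i = ∑ i, ∑ k, (M k i - M i k) * L k i := by
  have : ∑ i, ∑ k, M i k * L k i = - ∑ i, ∑ k, M k i * L k i := by
    rw [Finset.sum_comm, ← Finset.sum_neg_distrib]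
    refine Finset.sum_congr rfl fun i _ => ?_
    rw [← Finset.sum_neg_distrib]
    refine Finset.sum_congr rfl fun k _ => ?_
    rw [hL, mul_neg]
  simp only [sub_mul, Finset.sum_sub_distrib, this, two_smul]
  abel

namespace IsCanonical

variable [DecidableEq ι] {c : ℂ} {q p : ι → R} (h : IsCanonical c q p)
include h

/-- Each `k ≠ i` contributes `[L_ki, p_k] = c p_i` and `k = i` contributes nothing, whence the
factor `N - 1`. -/
theorem sum_ang_mul_p (i : ι) :
    ∑ k, ang q p k i * p k =
      ∑ k, p k * ang q p k i + (c * (Fintype.card ι - 1)) • p i := by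
  have : ∀ k, ang q p k i * p k = p k * ang q p k i + (c • p i - if i = k then c • p k else 0) := by
    intro k
    rw [mul_eq_mul_add_ad (ang q p k i) (p k), h.ad_ang_p, if_pos rfl]
  simp only [this, Finset.sum_add_distrib, Finset.sum_sub_distrib, Finset.sum_ite_eq,
    Finset.mem_univ, if_true, Finset.sum_const, Finset.card_univ]
  rw [← Nat.cast_smul_eq_nsmul ℂ, smul_smul, ← sub_smul]
  congr 3
  ring

theorem lrl_eq_left (i : ι) :
    lrl q p i = ∑ k, p k * ang q p k i + (c * (Fintype.card ι - 1) / 2) • p i := by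
  rw [lrl, h.sum_ang_mul_p]
  module

theorem lrl_eq_right (i : ι) :
    lrl q p i = ∑ k, ang q p k i * p k - (c * (Fintype.card ι - 1) / 2) • p i := by
  rw [h.lrl_eq_left, h.sum_ang_mul_p]
  module

theorem sum_p_sq_comm_lrl (i : ι) : Commute (∑ k, p k ^ 2) (lrl q p i) := by
  have h1 : ∀ k, Commute (∑ k, p k ^ 2) (p k) := fun k =>
    Commute.sum_left _ _ _ fun l _ => (h.p_comm l k).pow_left 2
  have h2 : ∀ k i, Commute (∑ k, p k ^ 2) (ang q p k i) := fun k i =>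
    (h.ang_comm_sum_p_sq k i).symm
  rw [h.lrl_eq_left]
  exact (Commute.sum_right _ _ _ fun k _ => (h1 k).mul_right (h2 k i)).add_right
    ((h1 i).smul_right _)

/-- The Plücker relation rewrites `L_ki p_l` as `L_li p_k - L_lk p_i`. The first term sums to `p²`
times the full sum of squares, and the second sums back to the left side after renaming indices, so
twice the left side is known. -/
theorem sum_ang_p_p_ang :
    ∑ i, (∑ k, ang q p k i * p k) * (∑ l, p l * ang q p l i) =
      (∑ k, p k ^ 2) * ((1 / 2 : ℂ) • ∑ i, ∑ k, ang q p k i ^ 2) := by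
  set Y := ∑ i, (∑ k, ang q p k i * p k) * (∑ l, p l * ang q p l i) with hY
  have e0 : Y = ∑ i, ∑ k, ∑ l, ang q p k i * p k * (p l * ang q p l i) := by
    simp only [hY, Finset.sum_mul_sum]
  have e1 : ∀ i k l, ang q p k i * p k * (p l * ang q p l i) =
      ang q p l i * p k ^ 2 * ang q p l i - ang q p l k * p i * p k * ang q p l i := by
    intro i k l
    have h1 : ang q p k i * p l = ang q p l i * p k - ang q p l k * p i := by
      have := h.ang_plucker k i l
      rw [ang_antisymm q p l i]
      rw [← sub_eq_zero, ← this]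
      noncomm_ring
    calc ang q p k i * p k * (p l * ang q p l i)
        = ang q p k i * (p k * p l) * ang q p l i := by noncomm_ring
      _ = (ang q p k i * p l) * p k * ang q p l i := by rw [(h.p_comm k l).eq]; noncomm_ring
      _ = _ := by rw [h1]; noncomm_ring
  -- The renaming exchanges `i` and `l`; the two sign changes of the angular momenta cancel.
  have e2 : ∑ i, ∑ k, ∑ l, ang q p l k * p i * p k * ang q p l i = Y := by
    have hs : ∀ F : ι → ι → ι → R, ∑ i, ∑ k, ∑ l, F i k l = ∑ i, ∑ k, ∑ l, F l k i := by
      intro F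
      rw [Finset.sum_comm]
      conv_rhs => rw [Finset.sum_comm]
      exact Finset.sum_congr rfl fun k _ => Finset.sum_comm
    rw [e0, hs]
    refine Finset.sum_congr rfl fun i _ => Finset.sum_congr rfl fun k _ =>
      Finset.sum_congr rfl fun l _ => ?_
    rw [ang_antisymm q p i k, ang_antisymm q p i l, mul_assoc (-ang q p k i), (h.p_comm l k).eq]
    noncomm_ring
  have e3 : ∑ i, ∑ k, ∑ l, ang q p l i * p k ^ 2 * ang q p l i =
      (∑ k, p k ^ 2) * (∑ i, ∑ k, ang q p k i ^ 2) := by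
    rw [Finset.mul_sum]
    refine Finset.sum_congr rfl fun i _ => ?_
    rw [Finset.mul_sum, Finset.sum_comm]
    refine Finset.sum_congr rfl fun l _ => ?_
    rw [← Finset.sum_mul, ← Finset.mul_sum, (h.ang_comm_sum_p_sq l i).eq, mul_assoc, pow_two (ang q p l i)]
  have e4 : Y = (∑ k, p k ^ 2) * (∑ i, ∑ k, ang q p k i ^ 2) - Y := by
    conv_lhs => rw [e0]
    simp only [e1, Finset.sum_sub_distrib, e2, e3]
  have e5 : (2 : ℂ) • Y = (∑ k, p k ^ 2) * (∑ i, ∑ k, ang q p k i ^ 2) := by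
    rw [two_smul]; nth_rewrite 1 [e4]; abel
  rw [mul_smul_comm, ← e5, smul_smul]; norm_num

/-- In each square the left factor is written with the momenta right of `L`, the right factor with
the momenta left of `L`. The terms linear in `ν` contract the antisymmetric `L_ki` with the
symmetric `p_k p_i` and vanish. -/
theorem sum_lrl_sq :
    ∑ i, lrl q p i ^ 2 = (∑ k, p k ^ 2) *
      ((1 / 2 : ℂ) • ∑ i, ∑ k, ang q p k i ^ 2 -
        ((c * (Fintype.card ι - 1) / 2) ^ 2) • (1 : R)) := by
  set ν := c * (Fintype.card ι - 1) / 2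
  have e1 : ∀ i, lrl q p i ^ 2 = (∑ k, ang q p k i * p k) * (∑ l, p l * ang q p l i) +
      ν • (∑ k, ang q p k i * (p k * p i)) - ν • (∑ k, (p i * p k) * ang q p k i)
      - ν ^ 2 • p i ^ 2 := by
    intro i
    have ha : ∑ k, ang q p k i * (p k * p i) = (∑ k, ang q p k i * p k) * p i := by
      simp only [Finset.sum_mul, mul_assoc]
    have hb : ∑ k, (p i * p k) * ang q p k i = p i * ∑ k, p k * ang q p k i := by
      simp only [Finset.mul_sum, mul_assoc]
    rw [ha, hb, pow_two]
    nth_rewrite 1 [h.lrl_eq_right]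
    rw [h.lrl_eq_left, sub_mul, mul_add, mul_add, smul_mul_assoc, smul_mul_assoc, mul_smul_comm,
      mul_smul_comm, smul_smul, ← pow_two, ← pow_two]
    abel
  have e2 : ∑ i, ∑ k, ang q p k i * (p k * p i) = 0 := by
    have := sum_antisymm_mul (ang q p) (ang_antisymm q p) (fun k i => p k * p i)
    simp only [fun k i => (h.p_comm k i).eq, sub_self] at this
    have h0 : (2 : ℂ) • ∑ i, ∑ k, ang q p k i * (p i * p k) = 0 := by simpa using this
    simpa [fun k i => (h.p_comm k i).eq] using h0
  have e3 : ∑ i, ∑ k, (p i * p k) * ang q p k i = 0 := by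
    have := sum_mul_antisymm (ang q p) (ang_antisymm q p) (fun k i => p i * p k)
    simpa [fun k i => (h.p_comm k i).eq] using this
  simp only [e1, Finset.sum_sub_distrib, Finset.sum_add_distrib, ← Finset.smul_sum, e2, e3,
    h.sum_ang_p_p_ang, mul_sub, mul_smul_comm, mul_one]
  simp


/-! ### The inverse radius, modelled by an element `s` with the derivative and the normalization of
`1 / |q|` -/

section Inverse

variable {s : R} (hs : ∀ k, Commute s (q k)) (hsp : ∀ k, ad s (p k) = -(c • (q k * s ^ 3)))
  (hsq : ∑ k, q k ^ 2 * s ^ 2 = 1)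
include hs hsp

theorem ad_p_unit (k i : ι) :
    ad (p k) (q i * s) = c • (q i * q k * s ^ 3) - if k = i then c • s else 0 := by
  rw [ad_mul, h.ad_p_q, ← ad_skew (p k) s, hsp]
  split_ifs <;> (simp [mul_assoc]; try abel)

theorem inv_comm_ang (a b : ι) : Commute s (ang q p a b) := by
  rw [← ad_eq_zero_iff, ang, ad_sub, ad_mul, ad_mul, hsp, hsp, ad_eq_zero_iff.2 (hs a),
    ad_eq_zero_iff.2 (hs b)]
  simp only [zero_mul, zero_add, mul_neg, mul_smul_comm, ← mul_assoc, (h.q_comm a b).eq]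
  abel

include hsq

/-- The commutator with `s` passes through the angular momenta and hits only the momenta. After
using `q² s² = 1`, the terms `[s, p_k] L_ki` sum to `∑ [p_k, u_i] p_k` and the terms `L_ki [s, p_k]`
to `∑ p_k [p_k, u_i]`, where `u_i = q_i s`; these are the two halves of `[p², u_i]`. -/
theorem ad_inv_lrl (i : ι) :
    ad s (lrl q p i) = (1 / 2 : ℂ) • ad (∑ k, p k ^ 2) (q i * s) := by
  have hs3 : ∀ k, Commute (q k) (s ^ 3) := fun k => ((hs k).pow_left 3).symm
  have hL : ∀ k i, ad s (ang q p k i) = 0 := fun k i =>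
    ad_eq_zero_iff.2 (h.inv_comm_ang hs hsp k i)
  have hq3 : ∑ k, q k * q k * s ^ 3 = s := by
    have : ∑ k, q k * q k * s ^ 3 = (∑ k, q k ^ 2 * s ^ 2) * s := by
      rw [Finset.sum_mul]
      exact Finset.sum_congr rfl fun k _ => by noncomm_ring
    rw [this, hsq, one_mul]
  -- both halves are `∑ k, p k * [p k, u i]` and `∑ k, [p k, u i] * p k`
  have h1 : ∑ k, ad s (p k) * ang q p k i = ∑ k, ad (p k) (q i * s) * p k := by
    have e1 : ∀ k, ad s (p k) * ang q p k i =
        c • (q i * q k * s ^ 3 * p k) - c • (q k * q k * s ^ 3 * p i) := by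
      intro k
      have h3 : s ^ 3 * ang q p k i = q k * (s ^ 3 * p i) - q i * (s ^ 3 * p k) := by
        rw [ang, mul_sub, ← mul_assoc, ← mul_assoc, ← (hs3 k).eq, ← (hs3 i).eq, mul_assoc,
          mul_assoc]
      rw [hsp, neg_mul, smul_mul_assoc, mul_assoc, h3, (h.q_comm i k).eq]
      simp only [mul_sub, smul_sub, mul_assoc]
      abel
    have e2 : ∀ k, ad (p k) (q i * s) * p k =
        c • (q i * q k * s ^ 3 * p k) - if k = i then c • (s * p k) else 0 := by
      intro k
      rw [h.ad_p_unit hs hsp]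
      split_ifs <;> simp [sub_mul]
    simp only [e1, e2, Finset.sum_sub_distrib, ← Finset.smul_sum, ← Finset.sum_mul, hq3]
    simp
  have h2 : ∑ k, ang q p k i * ad s (p k) = ∑ k, p k * ad (p k) (q i * s) := by
    have e1 : ∀ k, ang q p k i * ad s (p k) =
        c • (p k * (q i * q k * s ^ 3)) - c • (p i * (q k * q k * s ^ 3)) := by
      intro k
      rw [hsp, h.ang_eq_p_mul_q]
      simp only [sub_mul, mul_neg, mul_smul_comm, smul_sub, mul_assoc]
      abel
    have e2 : ∀ k, p k * ad (p k) (q i * s) =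
        c • (p k * (q i * q k * s ^ 3)) - if k = i then c • (p k * s) else 0 := by
      intro k
      rw [h.ad_p_unit hs hsp]
      split_ifs <;> simp [mul_sub]
    simp only [e1, e2, Finset.sum_sub_distrib, ← Finset.smul_sum, ← Finset.mul_sum, hq3]
    simp
  rw [lrl, ad_add, ad_smul, ad_smul, ad_sum, ad_sum, sum_ad]
  generalize q i * s = u at h1 h2 ⊢
  have e3 : ∀ k, ad s (p k * ang q p k i) = ad s (p k) * ang q p k i := fun k => by
    rw [ad_mul, hL, mul_zero, add_zero]
  have e4 : ∀ k, ad s (ang q p k i * p k) = ang q p k i * ad s (p k) := fun k => by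
    rw [ad_mul, hL, zero_mul, zero_add]
  have e5 : ∀ k, ad (p k ^ 2) u = p k * ad (p k) u + ad (p k) u * p k := fun k => by
    rw [pow_two, mul_ad]
  simp only [e3, e4, e5, h1, h2, Finset.sum_add_distrib, smul_add]
  abel

/-- Antisymmetrizing `p_k u_i`, with `u_i = q_i s`, produces `-L_ki s`, so each half gives `-s L²`.
The ordering correction is `ν` times the divergence of `q / |q|`, that is `(N - 1) / |q|` up to a
factor `-c`, and supplies the constant in `Λ`. -/
theorem sum_lrl_unit :
    ∑ i, (lrl q p i * (q i * s) + (q i * s) * lrl q p i) =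
      -(2 : ℂ) • (s * ((1 / 2 : ℂ) • ∑ i, ∑ k, ang q p k i ^ 2 -
        ((c * (Fintype.card ι - 1) / 2) ^ 2) • (1 : R))) := by
  set ν := c * (Fintype.card ι - 1) / 2
  have hsL := h.inv_comm_ang hs hsp
  have e1 : ∀ i, lrl q p i * (q i * s) + (q i * s) * lrl q p i =
      ∑ k, ang q p k i * (p k * (q i * s)) + ∑ k, (q i * s * p k) * ang q p k i
        - ν • ad (p i) (q i * s) := by
    intro i
    have ha : ∑ k, ang q p k i * (p k * (q i * s)) = (∑ k, ang q p k i * p k) * (q i * s) := by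
      simp only [Finset.sum_mul, mul_assoc]
    have hb : ∑ k, (q i * s * p k) * ang q p k i = (q i * s) * ∑ k, p k * ang q p k i := by
      simp only [Finset.mul_sum, mul_assoc]
    rw [ha, hb]
    nth_rewrite 1 [h.lrl_eq_right]
    rw [h.lrl_eq_left, ad, smul_sub, sub_mul, mul_add, smul_mul_assoc, mul_smul_comm]
    abel
  have e2 : (2 : ℂ) • ∑ i, ∑ k, ang q p k i * (p k * (q i * s)) =
      -(s * ∑ i, ∑ k, ang q p k i ^ 2) := by
    rw [sum_antisymm_mul _ (ang_antisymm q p), Finset.mul_sum, ← Finset.sum_neg_distrib]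
    refine Finset.sum_congr rfl fun i _ => ?_
    rw [Finset.mul_sum, ← Finset.sum_neg_distrib]
    refine Finset.sum_congr rfl fun k _ => ?_
    have : p k * (q i * s) - p i * (q k * s) = -(ang q p k i * s) := by
      rw [h.ang_eq_p_mul_q]; noncomm_ring
    rw [this, mul_neg, ← mul_assoc, ← pow_two, ((hsL k i).pow_right 2).eq]
  have e3 : (2 : ℂ) • ∑ i, ∑ k, (q i * s * p k) * ang q p k i =
      -(s * ∑ i, ∑ k, ang q p k i ^ 2) := by
    rw [sum_mul_antisymm _ (ang_antisymm q p), Finset.mul_sum, ← Finset.sum_neg_distrib]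
    refine Finset.sum_congr rfl fun i _ => ?_
    rw [Finset.mul_sum, ← Finset.sum_neg_distrib]
    refine Finset.sum_congr rfl fun k _ => ?_
    have : q i * s * p k - q k * s * p i = -(s * ang q p k i) := by
      rw [ang, ← (hs i).eq, ← (hs k).eq]; noncomm_ring
    rw [this, neg_mul, mul_assoc, ← pow_two]
  have e4 : ∑ i, ad (p i) (q i * s) = -((c * (Fintype.card ι - 1)) • s) := by
    have hq3 : ∑ k, q k * q k * s ^ 3 = s := by
      have : ∑ k, q k * q k * s ^ 3 = (∑ k, q k ^ 2 * s ^ 2) * s := by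
        rw [Finset.sum_mul]
        exact Finset.sum_congr rfl fun k _ => by noncomm_ring
      rw [this, hsq, one_mul]
    simp only [h.ad_p_unit hs hsp, if_true, Finset.sum_sub_distrib, ← Finset.smul_sum, hq3,
      Finset.sum_const, Finset.card_univ]
    rw [← Nat.cast_smul_eq_nsmul ℂ]
    module
  simp only [e1, Finset.sum_sub_distrib, Finset.sum_add_distrib, ← Finset.smul_sum, e4]
  have e2' : ∑ i, ∑ k, ang q p k i * (p k * (q i * s)) =
      -((1 / 2 : ℂ) • (s * ∑ i, ∑ k, ang q p k i ^ 2)) := by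
    rw [← smul_neg, ← e2, smul_smul]; norm_num
  have e3' : ∑ i, ∑ k, (q i * s * p k) * ang q p k i =
      -((1 / 2 : ℂ) • (s * ∑ i, ∑ k, ang q p k i ^ 2)) := by
    rw [← smul_neg, ← e3, smul_smul]; norm_num
  have hν : c * (Fintype.card ι - 1) = 2 * ν := by ring
  rw [e2', e3', hν, mul_sub s, mul_smul_comm, mul_smul_comm, mul_one]
  module

end Inverse

end IsCanonical

end LRL


/-! ### Position and momentum as operators on test functions -/

section Operators

variable {N : ℕ} {Ω : Opens (E N)}

theorem testFunction_eq_zero (f : 𝓓(Ω, ℂ)) {x : E N} (hx : x ∉ Ω) : f x = 0 :=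
  image_eq_zero_of_notMem_tsupport fun h => hx (f.tsupport_subset h)

theorem testFunction_differentiableAt (f : 𝓓(Ω, ℂ)) (x : E N) : DifferentiableAt ℝ f x :=
  (f.contDiff.differentiable (by simp)).differentiableAt

/-- A bump function detects the value at `x` of a multiplication operator; symbols are recovered
from operators in this way. -/
theorem exists_testFunction_ne_zero {x : E N} (hx : x ∈ Ω) : ∃ f : 𝓓(Ω, ℂ), f x ≠ 0 := by
  obtain ⟨φ, h1, h2, h3, -, h5⟩ := exists_contDiff_tsupport_subset (n := ⊤) (Ω.isOpen.mem_nhds hx)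
  refine ⟨⟨fun y => (φ y : ℂ), Complex.ofRealCLM.contDiff.comp h3, ?_, ?_⟩, ?_⟩
  · exact h2.comp_left (g := fun r : ℝ => (r : ℂ)) Complex.ofReal_zero
  · refine (closure_mono ?_).trans h1
    intro y hy
    simpa using hy
  · change ((φ x : ℝ) : ℂ) ≠ 0
    rw [h5]; simp

theorem mulOp_apply (φ : E N → ℝ) (hφ : ContDiffOn ℝ ∞ φ Ω) (f : 𝓓(Ω, ℂ)) (x : E N) :
    mulOp Ω φ hφ f x = (φ x : ℂ) * f x := rfl

theorem posOp_apply (i : Fin N) (f : 𝓓(Ω, ℂ)) (x : E N) :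
    posOp Ω i f x = (x i : ℂ) * f x := rfl

theorem momOp_apply (hbar : ℝ) (i : Fin N) (f : 𝓓(Ω, ℂ)) (x : E N) :
    momOp Ω hbar i f x =
      (-Complex.I * (hbar : ℂ)) * fderiv ℝ f x (EuclideanSpace.single i (1 : ℝ)) := rfl

theorem op_mul_apply (A B : Op Ω) (f : 𝓓(Ω, ℂ)) : (A * B) f = A (B f) := rfl

theorem op_sub_apply (A B : Op Ω) (f : 𝓓(Ω, ℂ)) (x : E N) : (A - B) f x = A f x - B f x := rfl

theorem op_add_apply (A B : Op Ω) (f : 𝓓(Ω, ℂ)) (x : E N) : (A + B) f x = A f x + B f x := rfl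

theorem op_smul_apply (z : ℂ) (A : Op Ω) (f : 𝓓(Ω, ℂ)) (x : E N) :
    (z • A) f x = z * A f x := rfl

theorem op_sum_apply {κ : Type*} (s : Finset κ) (A : κ → Op Ω) (f : 𝓓(Ω, ℂ)) (x : E N) :
    (∑ k ∈ s, A k) f x = ∑ k ∈ s, A k f x := by
  classical
  induction s using Finset.induction_on with
  | empty => simp
  | insert a s ha ih => rw [Finset.sum_insert ha, Finset.sum_insert ha, op_add_apply, ih]

theorem op_ext {A B : Op Ω} (h : ∀ f : 𝓓(Ω, ℂ), ∀ x ∈ Ω, A f x = B f x) : A = B := by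
  ext f x
  by_cases hx : x ∈ Ω
  · exact h f x hx
  · rw [testFunction_eq_zero _ hx, testFunction_eq_zero _ hx]

theorem mulOp_mul_eq_one (φ ψ : E N → ℝ) (hφ : ContDiffOn ℝ ∞ φ Ω) (hψ : ContDiffOn ℝ ∞ ψ Ω)
    (h : ∀ x ∈ Ω, φ x * ψ x = 1) : mulOp Ω φ hφ * mulOp Ω ψ hψ = 1 := by
  refine op_ext fun f x hx => ?_
  rw [op_mul_apply, mulOp_apply, mulOp_apply, ← mul_assoc, ← Complex.ofReal_mul, h x hx]
  simp

theorem mulOp_comm (φ ψ : E N → ℝ) (hφ : ContDiffOn ℝ ∞ φ Ω) (hψ : ContDiffOn ℝ ∞ ψ Ω) :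
    Commute (mulOp Ω φ hφ) (mulOp Ω ψ hψ) :=
  op_ext fun _ _ _ => mul_left_comm _ _ _

theorem ad_mulOp_momOp (hbar : ℝ) (k : Fin N) (φ ψ : E N → ℝ) (hφ : ContDiffOn ℝ ∞ φ Ω)
    (hψ : ContDiffOn ℝ ∞ ψ Ω)
    (h : ∀ x ∈ Ω, fderiv ℝ φ x (EuclideanSpace.single k (1 : ℝ)) = ψ x) :
    ad (mulOp Ω φ hφ) (momOp Ω hbar k) = (Complex.I * hbar) • mulOp Ω ψ hψ := by
  refine op_ext fun f x hx => ?_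
  have h1 : DifferentiableAt ℝ φ x :=
    (hφ.contDiffAt (Ω.isOpen.mem_nhds hx)).differentiableAt (by simp)
  have h2 : DifferentiableAt ℝ (fun y => (φ y : ℂ)) x :=
    Complex.ofRealCLM.differentiableAt.comp x h1
  have h3 : fderiv ℝ (mulOp Ω φ hφ f) x = fderiv ℝ (fun y => (φ y : ℂ) * f y) x := rfl
  have h4 : fderiv ℝ (fun y => (φ y : ℂ)) x = Complex.ofRealCLM.comp (fderiv ℝ φ x) :=
    (Complex.ofRealCLM.hasFDerivAt.comp x h1.hasFDerivAt).fderiv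
  rw [ad, op_sub_apply, op_mul_apply, op_mul_apply, mulOp_apply, momOp_apply, momOp_apply,
    op_smul_apply, mulOp_apply, h3, fderiv_fun_mul h2 (testFunction_differentiableAt f x), h4,
    ← h x hx]
  simp
  ring

theorem momOp_comm (hbar : ℝ) (i j : Fin N) : Commute (momOp Ω hbar i) (momOp Ω hbar j) := by
  refine op_ext fun f x _ => ?_
  have key : ∀ i j : Fin N, (momOp Ω hbar i * momOp Ω hbar j) f x =
      (-Complex.I * hbar) * ((-Complex.I * hbar) *
        fderiv ℝ (fderiv ℝ f) x (EuclideanSpace.single i 1) (EuclideanSpace.single j 1)) := by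
    intro i j
    have h0 : DifferentiableAt ℝ (fderiv ℝ f) x :=
      ((f.contDiff.fderiv_right (m := ∞) le_rfl).differentiable (by simp)).differentiableAt
    have h1 : fderiv ℝ (momOp Ω hbar j f) x = fderiv ℝ (fun y =>
      (-Complex.I * (hbar : ℂ)) * fderiv ℝ f y (EuclideanSpace.single j (1 : ℝ))) x := rfl
    rw [op_mul_apply, momOp_apply, h1, fderiv_const_mul (h0.clm_apply (differentiableAt_const _)),
      fderiv_clm_apply h0 (differentiableAt_const _)]
    simp
  have hs : IsSymmSndFDerivAt ℝ f x :=
    (f.contDiff.contDiffAt (x := x)).isSymmSndFDerivAt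
      (by simpa using WithTop.coe_le_coe.2 (le_top : (2 : ℕ∞) ≤ ⊤))
  rw [key, key, hs.eq]

theorem isCanonical_op (hbar : ℝ) :
    IsCanonical (Complex.I * hbar) (posOp Ω) (momOp Ω hbar) where
  q_comm _ _ := mulOp_comm _ _ _ _
  p_comm := momOp_comm hbar
  ad_q_p i j := by
    refine (ad_mulOp_momOp hbar j _ (fun _ => if i = j then 1 else 0) _ contDiffOn_const ?_).trans ?_
    · intro x _
      have : fderiv ℝ (fun x : E N => x i) x = EuclideanSpace.proj (𝕜 := ℝ) i :=
        (EuclideanSpace.proj (𝕜 := ℝ) i).fderiv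
      rw [this]
      simp
    · split_ifs with h
      · congr 1
        exact op_ext fun f x _ => by rw [mulOp_apply]; simp
      · refine op_ext fun f x _ => ?_
        rw [op_smul_apply, mulOp_apply]; simp

theorem angMom_eq_ang (hbar : ℝ) (i j : Fin N) :
    angMom Ω hbar i j = ang (posOp Ω) (momOp Ω hbar) i j := rfl

theorem lrlSeed_eq_lrl (hbar : ℝ) (i : Fin N) :
    lrlSeed Ω hbar i = lrl (posOp Ω) (momOp Ω hbar) i := rfl

end Operators

/-! ### Formal adjoints and observables -/

section Adjoint

variable {N : ℕ} {Ω : Opens (E N)}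

/-- `B` is a formal adjoint of `A` for the Lebesgue measure. -/
def IsFormalAdjoint (A B : Op Ω) : Prop :=
  ∀ f g : 𝓓(Ω, ℂ), ∫ x, starRingEnd ℂ (A f x) * g x = ∫ x, starRingEnd ℂ (f x) * B g x

theorem integrable_conj_mul (f g : 𝓓(Ω, ℂ)) :
    MeasureTheory.Integrable fun x => starRingEnd ℂ (f x) * g x :=
  ((Complex.continuous_conj.comp f.continuous).mul g.continuous).integrable_of_hasCompactSupport
    g.hasCompactSupport.mul_left

namespace IsFormalAdjoint

theorem mul {A A' B B' : Op Ω} (h : IsFormalAdjoint A A') (h' : IsFormalAdjoint B B') :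
    IsFormalAdjoint (A * B) (B' * A') := fun f g => (h (B f) g).trans (h' f (A' g))

theorem add {A A' B B' : Op Ω} (h : IsFormalAdjoint A A') (h' : IsFormalAdjoint B B') :
    IsFormalAdjoint (A + B) (A' + B') := by
  intro f g
  simp only [op_add_apply, map_add, add_mul, mul_add]
  rw [MeasureTheory.integral_add (integrable_conj_mul _ _) (integrable_conj_mul _ _),
    MeasureTheory.integral_add (integrable_conj_mul _ _) (integrable_conj_mul _ _), h, h']

theorem smul {A A' : Op Ω} (z : ℂ) (h : IsFormalAdjoint A A') :
    IsFormalAdjoint (z • A) (starRingEnd ℂ z • A') := by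
  intro f g
  simp only [op_smul_apply, map_mul]
  simp only [mul_assoc, mul_left_comm _ (starRingEnd ℂ z)]
  rw [MeasureTheory.integral_const_mul, MeasureTheory.integral_const_mul, h]

theorem ofReal_smul {A A' : Op Ω} (r : ℝ) (h : IsFormalAdjoint A A') :
    IsFormalAdjoint ((r : ℂ) • A) ((r : ℂ) • A') := by
  simpa using h.smul (r : ℂ)

theorem sub {A A' B B' : Op Ω} (h : IsFormalAdjoint A A') (h' : IsFormalAdjoint B B') :
    IsFormalAdjoint (A - B) (A' - B') := by
  have := h.add (h'.ofReal_smul (-1))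
  simpa [sub_eq_add_neg] using this

theorem zero : IsFormalAdjoint (0 : Op Ω) 0 := fun _ _ => by simp

theorem one : IsFormalAdjoint (1 : Op Ω) 1 := fun _ _ => rfl

theorem sum {κ : Type*} (s : Finset κ) {A A' : κ → Op Ω}
    (h : ∀ k ∈ s, IsFormalAdjoint (A k) (A' k)) :
    IsFormalAdjoint (∑ k ∈ s, A k) (∑ k ∈ s, A' k) := by
  classical
  induction s using Finset.induction_on with
  | empty => simpa using zero
  | insert a s ha ih =>
    rw [Finset.sum_insert ha, Finset.sum_insert ha]
    exact (h a (Finset.mem_insert_self _ _)).add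
      (ih fun k hk => h k (Finset.mem_insert_of_mem hk))

theorem sq {A : Op Ω} (h : IsFormalAdjoint A A) : IsFormalAdjoint (A ^ 2) (A ^ 2) := by
  simpa [pow_two] using h.mul h

theorem mulOp (φ : E N → ℝ) (hφ : ContDiffOn ℝ ∞ φ Ω) :
    IsFormalAdjoint (mulOp Ω φ hφ) (mulOp Ω φ hφ) := by
  intro f g
  congr 1
  ext x
  rw [mulOp_apply, mulOp_apply, map_mul, Complex.conj_ofReal]
  ring

theorem posOp (i : Fin N) : IsFormalAdjoint (posOp Ω i) (posOp Ω i) := mulOp _ _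

theorem momOp (hbar : ℝ) (i : Fin N) : IsFormalAdjoint (momOp Ω hbar i) (momOp Ω hbar i) := by
  intro f g
  have hd : ∀ x, DifferentiableAt ℝ (fun y => starRingEnd ℂ (f y)) x := fun x =>
    Complex.conjCLE.differentiableAt.comp x (testFunction_differentiableAt f x)
  have hf : ∀ x, fderiv ℝ (fun y => starRingEnd ℂ (f y)) x (EuclideanSpace.single i 1) =
      starRingEnd ℂ (fderiv ℝ f x (EuclideanSpace.single i 1)) := by
    intro x
    have := (Complex.conjCLE.toContinuousLinearMap.hasFDerivAt.comp x
      (testFunction_differentiableAt f x).hasFDerivAt).fderiv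
    exact congrArg (fun L => L (EuclideanSpace.single i 1)) this
  -- For nonzero `hbar` a derivative of a test function is a multiple of its image under the
  -- momentum operator, hence again a test function; this yields the integrability needed for the
  -- integration by parts.
  by_cases hb : hbar = 0
  · simp [momOp_apply, hb]
  have hI : (-Complex.I * (hbar : ℂ)) ≠ 0 := by simp [hb]
  have e1 : ∀ x, fderiv ℝ g x (EuclideanSpace.single i 1) =
      (-Complex.I * (hbar : ℂ))⁻¹ * CurvedQuantum.momOp Ω hbar i g x := fun x => by
    rw [momOp_apply, inv_mul_cancel_left₀ hI]
  have e2 : ∀ x, starRingEnd ℂ (fderiv ℝ f x (EuclideanSpace.single i 1)) =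
      starRingEnd ℂ (-Complex.I * (hbar : ℂ))⁻¹ *
        starRingEnd ℂ (CurvedQuantum.momOp Ω hbar i f x) := fun x => by
    rw [momOp_apply, ← map_mul, inv_mul_cancel_left₀ hI]
  have key := integral_mul_fderiv_eq_neg_fderiv_mul_of_integrable
    (μ := MeasureTheory.volume) (f := fun y => starRingEnd ℂ (f y)) (g := g)
    (v := EuclideanSpace.single i 1) ?_ ?_ (integrable_conj_mul f g)
    (fun x _ => hd x) (fun x _ => testFunction_differentiableAt g x)
  · simp only [hf] at key
    simp only [momOp_apply, map_mul, mul_assoc]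
    simp only [← mul_assoc (-Complex.I), ← mul_assoc (starRingEnd ℂ (-Complex.I)),
      mul_left_comm _ (-Complex.I * (hbar : ℂ))]
    rw [MeasureTheory.integral_const_mul, MeasureTheory.integral_const_mul, key]
    simp
  · simp only [hf, e2, mul_assoc]
    exact (integrable_conj_mul _ _).const_mul _
  · simp only [e1, mul_left_comm _ (-Complex.I * (hbar : ℂ))⁻¹]
    exact (integrable_conj_mul _ _).const_mul _

theorem angMom (hbar : ℝ) (i j : Fin N) :
    IsFormalAdjoint (angMom Ω hbar i j) (angMom Ω hbar i j) := by
  have h := ((posOp (Ω := Ω) i).mul (momOp hbar j)).sub ((posOp (Ω := Ω) j).mul (momOp hbar i))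
  have e : CurvedQuantum.momOp Ω hbar j * CurvedQuantum.posOp Ω i -
      CurvedQuantum.momOp Ω hbar i * CurvedQuantum.posOp Ω j =
      CurvedQuantum.angMom Ω hbar i j := ((isCanonical_op hbar).ang_eq_p_mul_q i j).symm
  rwa [e] at h

theorem lrlSeed (hbar : ℝ) (i : Fin N) :
    IsFormalAdjoint (lrlSeed Ω hbar i) (lrlSeed Ω hbar i) := by
  have h := ((IsFormalAdjoint.sum Finset.univ fun k _ =>
    (momOp (Ω := Ω) hbar k).mul (angMom hbar k i)).smul (1 / 2)).add
    ((IsFormalAdjoint.sum Finset.univ fun k _ =>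
      (angMom (Ω := Ω) hbar k i).mul (momOp hbar k)).smul (1 / 2))
  rw [add_comm] at h
  simp only [map_div₀, map_one, map_ofNat] at h
  rw [add_comm] at h
  rw [CurvedQuantum.lrlSeed]
  exact h

theorem momSq (hbar : ℝ) : IsFormalAdjoint (momSq Ω hbar) (momSq Ω hbar) :=
  sum _ fun k _ => (momOp hbar k).sq

/-- The weight is absorbed into the second argument: `⟨A f, w g⟩ = ⟨f, B (w g)⟩ = ⟨f, w A g⟩` for
the unweighted product. -/
theorem isObservable {A B : Op Ω} (h : IsFormalAdjoint A B) (w : E N → ℝ)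
    (hw : ContDiffOn ℝ ∞ w Ω) (hAB : B * CurvedQuantum.mulOp Ω w hw =
      CurvedQuantum.mulOp Ω w hw * A) :
    IsObservable w A := by
  intro f g
  have h1 := h f (CurvedQuantum.mulOp Ω w hw g)
  rw [← op_mul_apply, hAB, op_mul_apply] at h1
  simp only [mulOp_apply, mul_comm ((w _ : ℝ) : ℂ), ← mul_assoc] at h1
  exact h1

end IsFormalAdjoint

end Adjoint


/-! ### Iterated commutators of products -/

section Derivation

variable {R : Type*} [Ring R]

/-- The iterated commutator `[⋯[[a, M], M]⋯, M]`. -/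
def adPow (M : R) (n : ℕ) (a : R) : R := (fun b => ad b M)^[n] a

theorem adPow_zero (M a : R) : adPow M 0 a = a := rfl

theorem adPow_succ (M : R) (n : ℕ) (a : R) : adPow M (n + 1) a = ad (adPow M n a) M :=
  Function.iterate_succ_apply' _ _ _

theorem adPow_add (M : R) (m n : ℕ) (a : R) : adPow M (m + n) a = adPow M m (adPow M n a) :=
  Function.iterate_add_apply _ _ _ _

theorem nsmul_ad (n : ℕ) (a b : R) : ad (n • a) b = n • ad a b := by
  rw [ad, ad, smul_mul_assoc, mul_smul_comm, smul_sub]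

theorem adPow_of_zero (M : R) (n : ℕ) : adPow M n 0 = 0 := by
  induction n with
  | zero => rfl
  | succ n ih => rw [adPow_succ, ih]; simp [ad]

theorem adPow_add_right (M : R) (n : ℕ) (a b : R) :
    adPow M n (a + b) = adPow M n a + adPow M n b := by
  induction n with
  | zero => rfl
  | succ n ih => rw [adPow_succ, adPow_succ, adPow_succ, ih, add_ad]

theorem adPow_smul [Algebra ℂ R] (M : R) (n : ℕ) (z : ℂ) (a : R) :
    adPow M n (z • a) = z • adPow M n a := by
  induction n with
  | zero => rfl
  | succ n ih => rw [adPow_succ, adPow_succ, ih, smul_ad]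

theorem adPow_sum {κ : Type*} (M : R) (n : ℕ) (s : Finset κ) (f : κ → R) :
    adPow M n (∑ k ∈ s, f k) = ∑ k ∈ s, adPow M n (f k) := by
  induction n with
  | zero => rfl
  | succ n ih => simp only [adPow_succ, ih, sum_ad]

theorem adPow_list_sum (M : R) (n : ℕ) (l : List R) :
    adPow M n l.sum = (l.map (adPow M n)).sum := by
  induction l with
  | nil => exact adPow_of_zero M n
  | cons a l ih => rw [List.sum_cons, adPow_add_right, ih, List.map_cons, List.sum_cons]

/-- The Leibniz formula for the derivation `[·, M]`, in which only three terms survive because `a`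
is killed by its third power. -/
theorem adPow_mul {M a : R} (ha : adPow M 3 a = 0) (b : R) (n : ℕ) :
    adPow M (n + 2) (a * b) = a * adPow M (n + 2) b + (n + 2) • (adPow M 1 a * adPow M (n + 1) b) +
      (n + 2).choose 2 • (adPow M 2 a * adPow M n b) := by
  have h1 : adPow M 1 a = ad a M := rfl
  have h2 : adPow M 2 a = ad (ad a M) M := rfl
  have h3 : ad (ad (ad a M) M) M = 0 := ha
  induction n with
  | zero =>
    change ad (ad (a * b) M) M = a * ad (ad b M) M + 2 • (ad a M * ad b M) +
      Nat.choose 2 2 • (ad (ad a M) M * b)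
    rw [mul_ad, add_ad, mul_ad, mul_ad]
    simp [two_smul]
    abel
  | succ n ih =>
    have h4 : (n + 1 + 2).choose 2 = (n + 2) + (n + 2).choose 2 := by
      rw [show n + 1 + 2 = (n + 2) + 1 from rfl, Nat.choose_succ_succ' (n + 2) 1, Nat.choose_one_right]
    rw [h4, show n + 1 + 2 = (n + 2) + 1 from rfl, adPow_succ M (n + 2) (a * b), ih, add_ad, add_ad,
      nsmul_ad, nsmul_ad, mul_ad, mul_ad, mul_ad, ← adPow_succ, ← adPow_succ M (n + 1),
      ← adPow_succ M n, h1, h2, h3]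
    simp only [zero_mul, add_zero]
    module

theorem adPow_mul_of_lt {M a : R} (ha : adPow M 3 a = 0) {b : R} {d : ℕ}
    (hb : ∀ n, d < n → adPow M n b = 0) (n : ℕ) (hn : d + 2 < n) : adPow M n (a * b) = 0 := by
  obtain ⟨k, rfl⟩ : ∃ k, n = k + 2 := ⟨n - 2, by omega⟩
  rw [adPow_mul ha, hb (k + 2) (by omega), hb (k + 1) (by omega), hb k (by omega)]
  simp

/-- The number of ways to distribute `2 d` commutators in pairs among `d` factors. -/
def pairCount : ℕ → ℕ
  | 0 => 1
  | d + 1 => (2 * d + 2).choose 2 * pairCount d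

theorem pairCount_ne_zero (d : ℕ) : pairCount d ≠ 0 := by
  induction d with
  | zero => simp [pairCount]
  | succ d ih =>
    exact mul_ne_zero (Nat.choose_pos (by omega)).ne' ih

/-- Each factor absorbs at most two commutators. -/
theorem adPow_list_prod_of_lt {M : R} (l : List R) (hl : ∀ a ∈ l, adPow M 3 a = 0) (n : ℕ)
    (hn : 2 * l.length < n) : adPow M n l.prod = 0 := by
  induction l generalizing n with
  | nil =>
    obtain ⟨k, rfl⟩ : ∃ k, n = k + 1 := ⟨n - 1, by simp at hn; omega⟩
    rw [adPow_add]
    have : adPow M 1 ([] : List R).prod = 0 := by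
      change ad _ _ = _
      simp [ad]
    rw [this, adPow_of_zero]
  | cons a l ih =>
    rw [List.prod_cons]
    refine adPow_mul_of_lt (hl a (by simp)) (d := 2 * l.length)
      (fun n hn => ih (fun b hb => hl b (by simp [hb])) n hn) n ?_
    rw [List.length_cons] at hn
    omega

/-- With exactly twice as many commutators as factors, every factor must absorb two; `pairCount`
counts the ways. -/
theorem adPow_list_prod {M : R} (l : List R) (hl : ∀ a ∈ l, adPow M 3 a = 0) :
    adPow M (2 * l.length) l.prod = pairCount l.length • (l.map (adPow M 2)).prod := by
  induction l with
  | nil => simp [pairCount, adPow_zero]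
  | cons a l ih =>
    have hl' : ∀ b ∈ l, adPow M 3 b = 0 := fun b hb => hl b (by simp [hb])
    rw [List.prod_cons, List.length_cons, mul_add, mul_one, adPow_mul (hl a (by simp)),
      adPow_list_prod_of_lt l hl' _ (by omega), adPow_list_prod_of_lt l hl' _ (by omega), ih hl',
      List.map_cons, List.prod_cons, pairCount]
    simp only [mul_smul_comm, mul_smul, mul_zero, smul_zero, zero_add]

end Derivation


/-! ### Zariski dense sets -/

section Dense

variable {ι κ : Type*}

/-- No nonzero polynomial vanishes on `T`. -/
def ZariskiDense (T : Set (ι → ℂ)) : Prop :=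
  ∀ P : MvPolynomial ι ℂ, (∀ t ∈ T, MvPolynomial.eval t P = 0) → P = 0

theorem ZariskiDense.mono {S T : Set (ι → ℂ)} (h : ZariskiDense S) (hST : S ⊆ T) :
    ZariskiDense T := fun P hP => h P fun t ht => hP t (hST ht)

theorem ZariskiDense.comp {T : Set (ι → ℂ)} (h : ZariskiDense T) (j : κ → ι)
    (hj : Function.Injective j) : ZariskiDense ((fun t => t ∘ j) '' T) := by
  intro P hP
  refine MvPolynomial.rename_injective j hj ?_
  rw [map_zero]
  refine h _ fun t ht => ?_
  rw [MvPolynomial.eval_rename]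
  exact hP _ ⟨t, ht, rfl⟩

/-- The polynomial `X i - X j` vanishes on `T`. This is how members of a family are shown to be
distinct, so that the cardinalities are exact. -/
theorem ZariskiDense.eq_of_forall_eq {T : Set (ι → ℂ)} (h : ZariskiDense T) {i j : ι}
    (hij : ∀ t ∈ T, t i = t j) : i = j := by
  have : (MvPolynomial.X i - MvPolynomial.X j : MvPolynomial ι ℂ) = 0 :=
    h _ fun t ht => by simp [hij t ht]
  exact MvPolynomial.X_injective (sub_eq_zero.1 this)

theorem exists_support_degree_eq_totalDegree {P : MvPolynomial ι ℂ} (hP : P ≠ 0) :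
    ∃ m ∈ P.support, Multiset.card m.toMultiset = P.totalDegree := by
  obtain ⟨m, hm, h⟩ := Finset.exists_mem_eq_sup P.support (MvPolynomial.support_nonempty.2 hP)
    fun m => Multiset.card m.toMultiset
  exact ⟨m, hm, by rw [MvPolynomial.totalDegree_eq, h]⟩

end Dense

/-! ### Principal symbols and algebraic independence -/

section Symbol

variable {N : ℕ} {Ω : Opens (E N)} {hbar : ℝ}

/-- Multiplication by the linear function `∑ ξ_j q_j`. -/
noncomputable def dirOp (Ω : Opens (E N)) (ξ : E N) : Op Ω := ∑ j, (ξ j : ℂ) • posOp Ω j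

/-- `A` acts on `Ω` as the multiplication by `φ`. -/
def ActsBy (A : Op Ω) (φ : E N → ℂ) : Prop := ∀ f : 𝓓(Ω, ℂ), ∀ x ∈ Ω, A f x = φ x * f x

theorem actsBy_dirOp (ξ : E N) : ActsBy (dirOp Ω ξ) fun x => ∑ j, (ξ j : ℂ) * x j := by
  intro f x _
  rw [dirOp, op_sum_apply, Finset.sum_mul]
  exact Finset.sum_congr rfl fun j _ => by rw [op_smul_apply, posOp_apply, mul_assoc]

theorem ActsBy.ad_eq_zero {A B : Op Ω} {φ ψ : E N → ℂ} (hA : ActsBy A φ) (hB : ActsBy B ψ) :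
    ad A B = 0 := by
  refine op_ext fun f x hx => ?_
  rw [ad, op_sub_apply, op_mul_apply, op_mul_apply, hA (B f) x hx, hB f x hx, hB (A f) x hx,
    hA f x hx]
  change _ = (0 : ℂ)
  ring

theorem ActsBy.mul {A B : Op Ω} {φ ψ : E N → ℂ} (hA : ActsBy A φ) (hB : ActsBy B ψ) :
    ActsBy (A * B) fun x => φ x * ψ x := fun f x hx => by
  rw [op_mul_apply, hA _ x hx, hB _ x hx, mul_assoc]

theorem ActsBy.list_prod {κ : Type*} (A : κ → Op Ω) (φ : κ → E N → ℂ)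
    (h : ∀ k, ActsBy (A k) (φ k)) (l : List κ) :
    ActsBy (l.map A).prod fun x => (l.map fun k => φ k x).prod := by
  induction l with
  | nil => intro f x _; simp
  | cons k l ih => simpa using (h k).mul ih

/-- `A` is a first order operator with principal symbol `b`. -/
def HasSymbolOne (hbar : ℝ) (A : Op Ω) (b : E N → E N → ℝ) : Prop :=
  ∀ ξ, ActsBy (adPow (dirOp Ω ξ) 1 A) fun x => (-(Complex.I * hbar)) * b x ξ

/-- `A` is a second order operator with principal symbol `a`. -/
def HasSymbol (hbar : ℝ) (A : Op Ω) (a : E N → E N → ℝ) : Prop :=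
  ∀ ξ, ActsBy (adPow (dirOp Ω ξ) 2 A) fun x => (-2 * (hbar : ℂ) ^ 2) * a x ξ

theorem HasSymbol.adPow_three {A : Op Ω} {a : E N → E N → ℝ} (h : HasSymbol hbar A a) (ξ : E N) :
    adPow (dirOp Ω ξ) 3 A = 0 := (h ξ).ad_eq_zero (actsBy_dirOp ξ)

theorem adPow_symmMonomial_of_lt {ι : Type*} {A : ι → Op Ω} {a : ι → E N → E N → ℝ}
    (h : ∀ i, HasSymbol hbar (A i) (a i)) (ξ : E N) (m : ι →₀ ℕ) {d : ℕ}
    (hd : Multiset.card m.toMultiset < d) : adPow (dirOp Ω ξ) (2 * d) (symmMonomial A m) = 0 := by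
  rw [symmMonomial, adPow_smul, adPow_list_sum, List.map_map]
  rw [List.sum_eq_zero, smul_zero]
  intro b hb
  obtain ⟨l, hl, rfl⟩ := List.mem_map.1 hb
  have hlen := (List.mem_permutations.1 hl).length_eq
  rw [Multiset.length_toList] at hlen
  refine adPow_list_prod_of_lt _ ?_ _ (by rw [List.length_map]; omega)
  intro c hc
  obtain ⟨i, -, rfl⟩ := List.mem_map.1 hc
  exact (h i).adPow_three ξ

/-- After the commutators only multiplication operators remain, and these commute. Every ordering of
the factors therefore gives the same function, and so does their mean. -/
theorem actsBy_adPow_symmMonomial {ι : Type*} {A : ι → Op Ω} {a : ι → E N → E N → ℝ}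
    (h : ∀ i, HasSymbol hbar (A i) (a i)) (ξ : E N) (m : ι →₀ ℕ) :
    ActsBy (adPow (dirOp Ω ξ) (2 * Multiset.card m.toMultiset) (symmMonomial A m)) fun x =>
      pairCount (Multiset.card m.toMultiset) *
        ((-2 * (hbar : ℂ) ^ 2) ^ Multiset.card m.toMultiset * m.prod fun i n => (a i x ξ : ℂ) ^ n) := by
  intro f x hx
  set d := Multiset.card m.toMultiset with hd
  set L := m.toMultiset.toList with hL
  have hLlen : L.length = d := Multiset.length_toList _
  have key : ∀ l ∈ L.permutations, adPow (dirOp Ω ξ) (2 * d) (l.map A).prod f x =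
      pairCount d * ((-2 * (hbar : ℂ) ^ 2) ^ d * m.prod fun i n => (a i x ξ : ℂ) ^ n) * f x := by
    intro l hl
    have hperm := List.mem_permutations.1 hl
    have hlen : (l.map A).length = d := by rw [List.length_map, hperm.length_eq, hLlen]
    have h1 := adPow_list_prod (M := dirOp Ω ξ) (l.map A) (fun c hc => by
      obtain ⟨i, -, rfl⟩ := List.mem_map.1 hc
      exact (h i).adPow_three ξ)
    rw [hlen, List.map_map] at h1
    have h2 := ActsBy.list_prod (adPow (dirOp Ω ξ) 2 ∘ A) _ (fun i => h i ξ) l f x hx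
    have h3 : (l.map fun i => (-2 * (hbar : ℂ) ^ 2) * (a i x ξ : ℂ)).prod =
        (-2 * (hbar : ℂ) ^ 2) ^ d * m.prod fun i n => (a i x ξ : ℂ) ^ n := by
      rw [(hperm.map _).prod_eq, ← Multiset.prod_coe, ← Multiset.map_coe, hL,
        Multiset.coe_toList, Multiset.prod_map_mul, Multiset.map_const', Multiset.prod_replicate,
        ← hd, Finsupp.toMultiset_map, Finsupp.prod_toMultiset, Finsupp.prod_mapDomain_index
          (fun _ => pow_zero _) (fun _ _ _ => pow_add _ _ _)]
    rw [h1, ← Nat.cast_smul_eq_nsmul ℂ, op_smul_apply, h2]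
    beta_reduce
    rw [h3, ← mul_assoc]
  have hsum : ∀ (ls : List (List ι)) (z : ℂ), (∀ l ∈ ls,
      adPow (dirOp Ω ξ) (2 * d) (l.map A).prod f x = z) →
      (ls.map fun l => adPow (dirOp Ω ξ) (2 * d) (l.map A).prod).sum f x = ls.length * z := by
    intro ls z
    induction ls with
    | nil => intro _; simp
    | cons l ls ih =>
      intro hls
      rw [List.map_cons, List.sum_cons, op_add_apply, hls l (by simp),
        ih fun l hl => hls l (by simp [hl]), List.length_cons]
      push_cast; ring
  rw [symmMonomial, adPow_smul, adPow_list_sum, List.map_map, op_smul_apply]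
  change _ * (L.permutations.map fun l => adPow (dirOp Ω ξ) (2 * d) (l.map A).prod).sum f x = _
  rw [hsum _ _ key, List.length_permutations, ← hL, inv_mul_cancel_left₀]
  exact_mod_cast Nat.factorial_ne_zero _

theorem eq_zero_of_symmEval_eq_zero {ι : Type*} (hh : hbar ≠ 0) {A : ι → Op Ω}
    {a : ι → E N → E N → ℝ} (h : ∀ i, HasSymbol hbar (A i) (a i))
    (hT : ZariskiDense {t : ι → ℂ | ∃ x ∈ Ω, ∃ ξ : E N, t = fun i => (a i x ξ : ℂ)})
    (P : MvPolynomial ι ℂ) (hP : symmEval A P = 0) : P = 0 := by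
  by_contra hne
  set d := P.totalDegree
  -- Commuting `2 d` times kills the monomials of degree below `d`, so a relation forces the top
  -- homogeneous component to vanish at the symbols. By density that component is zero, which
  -- contradicts the choice of `d` as the total degree.
  have hQ : MvPolynomial.homogeneousComponent d P = 0 := by
    refine hT _ ?_
    rintro t ⟨x, hx, ξ, rfl⟩
    obtain ⟨f, hf⟩ := exists_testFunction_ne_zero hx
    have h0 : adPow (dirOp Ω ξ) (2 * d) (symmEval A P) f x = 0 := by
      rw [hP, adPow_of_zero]; rfl
    rw [symmEval, adPow_sum, op_sum_apply] at h0
    have h1 : ∀ m ∈ P.support, adPow (dirOp Ω ξ) (2 * d) (P.coeff m • symmMonomial A m) f x =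
        (pairCount d * (-2 * (hbar : ℂ) ^ 2) ^ d * f x) *
          if m.degree = d then P.coeff m * m.prod fun i n => (a i x ξ : ℂ) ^ n else 0 := by
      intro m hm
      have hdeg : Multiset.card m.toMultiset = m.degree := by
        rw [Finsupp.card_toMultiset]; rfl
      rw [adPow_smul, op_smul_apply]
      split_ifs with hmd
      · rw [← hmd, ← hdeg, actsBy_adPow_symmMonomial h ξ m f x hx]
        ring
      · have hle : m.degree ≤ d := MvPolynomial.le_totalDegree hm
        rw [adPow_symmMonomial_of_lt h ξ m (d := d) (by rw [hdeg]; omega)]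
        change _ * (0 : ℂ) = _
        ring
    rw [Finset.sum_congr rfl h1, ← Finset.mul_sum] at h0
    have h2 : (pairCount d * (-2 * (hbar : ℂ) ^ 2) ^ d * f x) ≠ 0 := by
      refine mul_ne_zero (mul_ne_zero ?_ (pow_ne_zero _ ?_)) hf
      · exact_mod_cast pairCount_ne_zero d
      · simpa using hh
    have h3 := (mul_eq_zero.1 h0).resolve_left h2
    rw [MvPolynomial.homogeneousComponent_apply, map_sum]
    rw [← Finset.sum_filter] at h3
    simpa [MvPolynomial.eval_monomial] using h3
  obtain ⟨m, hm, hmd⟩ := exists_support_degree_eq_totalDegree hne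
  have hc := congrArg (MvPolynomial.coeff m) hQ
  rw [MvPolynomial.coeff_homogeneousComponent, if_pos, MvPolynomial.coeff_zero] at hc
  · exact MvPolynomial.mem_support_iff.1 hm hc
  · rw [Finsupp.card_toMultiset] at hmd; exact hmd

theorem HasSymbol.eq_of_eq {A : Op Ω} (hh : hbar ≠ 0) {a b : E N → E N → ℝ}
    (ha : HasSymbol hbar A a) (hb : HasSymbol hbar A b) {x : E N} (hx : x ∈ Ω) (ξ : E N) :
    a x ξ = b x ξ := by
  obtain ⟨f, hf⟩ := exists_testFunction_ne_zero hx
  have h1 := (ha ξ f x hx).symm.trans (hb ξ f x hx)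
  have h2 : (-2 * (hbar : ℂ) ^ 2) ≠ 0 := by simpa using hh
  exact_mod_cast mul_left_cancel₀ h2 (mul_right_cancel₀ hf h1)

theorem injective_of_zariskiDense {ι : Type*} (hh : hbar ≠ 0) {A : ι → Op Ω}
    {a : ι → E N → E N → ℝ} (h : ∀ i, HasSymbol hbar (A i) (a i))
    (hT : ZariskiDense {t : ι → ℂ | ∃ x ∈ Ω, ∃ ξ : E N, t = fun i => (a i x ξ : ℂ)}) :
    Function.Injective A := by
  intro i j hij
  refine hT.eq_of_forall_eq ?_
  rintro t ⟨x, hx, ξ, rfl⟩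
  exact congrArg _ ((h i).eq_of_eq hh (hij ▸ h j) hx ξ)

/-- Density passes to any subfamily by projection, so one dense family serves all the sets of
operators in the theorem. -/
theorem algIndepOps_of_subset_range {ι : Type*} (hh : hbar ≠ 0) {A : ι → Op Ω}
    {a : ι → E N → E N → ℝ} (h : ∀ i, HasSymbol hbar (A i) (a i))
    (hT : ZariskiDense {t : ι → ℂ | ∃ x ∈ Ω, ∃ ξ : E N, t = fun i => (a i x ξ : ℂ)})
    {s : Set (Op Ω)} (hs : s ⊆ Set.range A) : AlgIndepOps s := by
  choose j hj using fun B : s => hs B.2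
  have hji : Function.Injective j := fun B C hBC => Subtype.ext (by rw [← hj, ← hj, hBC])
  refine eq_zero_of_symmEval_eq_zero hh (a := fun B => a (j B))
    (fun B => by simpa only [hj] using h (j B)) ((hT.comp j hji).mono ?_)
  rintro _ ⟨t, ⟨x, hx, ξ, rfl⟩, rfl⟩
  exact ⟨x, hx, ξ, rfl⟩

end Symbol


/-! ### Tools for proving Zariski density -/

section Fibering

variable {ι κ : Type*}

theorem eval_map_sumAlgEquiv (t₁ : ι → ℂ) (t₂ : κ → ℂ) (P : MvPolynomial (ι ⊕ κ) ℂ) :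
    MvPolynomial.eval t₁ (MvPolynomial.map (MvPolynomial.eval t₂)
      (MvPolynomial.sumAlgEquiv ℂ ι κ P)) = MvPolynomial.eval (Sum.elim t₁ t₂) P := by
  induction P using MvPolynomial.induction_on with
  | C a => rw [MvPolynomial.sumAlgEquiv_C_inl]; simp
  | add p q hp hq => simp only [map_add, hp, hq]
  | mul_X p i hp =>
    rw [map_mul, map_mul, map_mul, map_mul, hp]
    cases i with
    | inl i => rw [MvPolynomial.sumAlgEquiv_X_inl]; simp
    | inr i => rw [MvPolynomial.sumAlgEquiv_X_inr]; simp

/-- A dense base with dense fibres: viewed as a polynomial in the `ι` variables, `P` has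
coefficients that vanish at every point of the base, hence identically. -/
theorem ZariskiDense.sum {T : Set (ι ⊕ κ → ℂ)} {T₂ : Set (κ → ℂ)} (h₂ : ZariskiDense T₂)
    (h : ∀ t₂ ∈ T₂, ZariskiDense {t₁ : ι → ℂ | Sum.elim t₁ t₂ ∈ T}) : ZariskiDense T := by
  intro P hP
  have key : MvPolynomial.sumAlgEquiv ℂ ι κ P = 0 := by
    ext1 m
    refine h₂ _ fun t₂ ht₂ => ?_
    have h0 : MvPolynomial.map (MvPolynomial.eval t₂) (MvPolynomial.sumAlgEquiv ℂ ι κ P) = 0 :=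
      h t₂ ht₂ _ fun t₁ ht₁ => by rw [eval_map_sumAlgEquiv]; exact hP _ ht₁
    simpa [MvPolynomial.coeff_map] using congrArg (MvPolynomial.coeff m) h0
  simpa using key

theorem zariskiDense_unit {S : Set ℝ} (hS : S.Infinite) :
    ZariskiDense {t : Unit → ℂ | ∃ r ∈ S, t = fun _ => (r : ℂ)} := by
  intro P hP
  refine MvPolynomial.funext_set (fun _ => (fun r : ℝ => (r : ℂ)) '' S)
    (fun _ => hS.image Complex.ofReal_injective.injOn) fun t ht => ?_
  obtain ⟨r, hr, hrt⟩ := ht () trivial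
  rw [map_zero]
  exact hP t ⟨r, hr, funext fun _ => hrt.symm⟩

theorem infinite_of_unbounded {S : Set ℝ} (h : ∀ B, ∃ r ∈ S, B < r) : S.Infinite := by
  refine Set.infinite_of_not_bddAbove ?_
  rintro ⟨B, hB⟩
  obtain ⟨r, hr, hBr⟩ := h B
  exact absurd (hB hr) (not_le.2 hBr)

/-- A family whose `k`-th member depends on the first `k + 1` parameters only and is unbounded in
the last of them has a Zariski dense image. -/
theorem zariskiDense_triangular (f : ℕ → (ℕ → ℝ) → ℝ) (n : ℕ)
    (hdep : ∀ k < n, ∀ y y' : ℕ → ℝ, (∀ i ≤ k, y i = y' i) → f k y = f k y')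
    (hunb : ∀ k < n, ∀ y : ℕ → ℝ, (∀ i, 0 < y i) → ∀ B, ∃ z > 0, B < f k (Function.update y k z)) :
    ZariskiDense {t : Fin n → ℂ | ∃ y : ℕ → ℝ, (∀ i, 0 < y i) ∧ t = fun k : Fin n => (f k y : ℂ)} := by
  induction n with
  | zero =>
    intro P hP
    obtain ⟨c, rfl⟩ := MvPolynomial.C_surjective (R := ℂ) (Fin 0) P
    have := hP (fun k => (f k 1 : ℂ)) ⟨1, fun _ => one_pos, rfl⟩
    rw [MvPolynomial.eval_C] at this
    rw [this, map_zero]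
  | succ n ih =>
    have ih' := ih (fun k hk => hdep k (by omega)) (fun k hk => hunb k (by omega))
    -- The last member is split off as the fibre coordinate. The first `n` members form the base and
    -- do not see the parameter `y n`.
    let e : Fin (n + 1) → Unit ⊕ Fin n := fun k =>
      if h : (k : ℕ) < n then Sum.inr ⟨k, h⟩ else Sum.inl ()
    have he : Function.Injective e := by
      intro k l hkl
      simp only [e] at hkl
      ext
      have := k.2
      have := l.2
      split_ifs at hkl with h1 h2 h2
      · simpa using hkl
      · omega
    have key : ZariskiDense {t : Unit ⊕ Fin n → ℂ | ∃ y : ℕ → ℝ, (∀ i, 0 < y i) ∧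
        t = Sum.elim (fun _ => (f n y : ℂ)) fun k : Fin n => (f k y : ℂ)} := by
      refine ih'.sum ?_
      rintro t₂ ⟨y, hy, rfl⟩
      refine (zariskiDense_unit (S := {r | ∃ z > 0, r = f n (Function.update y n z)}) ?_).mono ?_
      · refine infinite_of_unbounded fun B => ?_
        obtain ⟨z, hz, hB⟩ := hunb n (by omega) y hy B
        exact ⟨_, ⟨z, hz, rfl⟩, hB⟩
      · rintro t₁ ⟨r, ⟨z, hz, rfl⟩, rfl⟩
        refine ⟨Function.update y n z, fun i => ?_, ?_⟩
        · by_cases hi : i = n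
          · subst hi; simpa using hz
          · rw [Function.update_of_ne hi]; exact hy i
        · congr 1
          ext k
          rw [hdep k (by omega) y (Function.update y n z) fun i hi => by
            rw [Function.update_of_ne]; omega]
    refine (key.comp e he).mono ?_
    rintro _ ⟨t, ⟨y, hy, rfl⟩, rfl⟩
    refine ⟨y, hy, ?_⟩
    ext k
    simp only [Function.comp, e]
    split_ifs with h
    · rfl
    · have : (k : ℕ) = n := by omega
      simp [this]

/-- If the leading terms of a family (as `u → 0`) are Zariski dense then so is the family. -/
theorem zariskiDense_of_leading {σ : Type*} (w : ι → ℕ) (v : σ → ℝ → ι → ℂ)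
    (hv : ∀ s i, Continuous fun u => v s u i) (h0 : ZariskiDense (Set.range fun s => v s 0)) :
    ZariskiDense {t : ι → ℂ | ∃ s, ∃ u : ℝ, u ≠ 0 ∧ t = fun i => ((u : ℂ)⁻¹) ^ w i * v s u i} := by
  intro P hP
  by_contra hne
  obtain ⟨m₀, hm₀, hmax⟩ := Finset.exists_max_image P.support (fun m => Finsupp.weight w m)
    (MvPolynomial.support_nonempty.2 hne)
  set d := Finsupp.weight w m₀ with hd
  have hQ : MvPolynomial.weightedHomogeneousComponent w d P = 0 := by
    refine h0 _ ?_
    rintro _ ⟨s, rfl⟩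
    -- For `u ≠ 0` this is `u ^ d` times the value of `P`, hence zero. Since `d` is the maximal
    -- weight no negative power of `u` occurs, so `F` is continuous, and `F 0` is the value of the
    -- component of weight `d` at the leading terms.
    let F : ℝ → ℂ := fun u => ∑ m ∈ P.support, P.coeff m * (u : ℂ) ^ (d - Finsupp.weight w m) *
      m.prod fun i k => v s u i ^ k
    have hF : Continuous F := by
      refine continuous_finsetSum _ fun m _ => (continuous_const.mul ?_).mul ?_
      · exact Complex.continuous_ofReal.pow _
      · exact continuous_finsetProd _ fun i _ => (hv s i).pow _
    have hF0 : ∀ u : ℝ, u ≠ 0 → F u = 0 := by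
      intro u hu
      have huc : (u : ℂ) ≠ 0 := by exact_mod_cast hu
      have h1 := hP _ ⟨s, u, hu, rfl⟩
      rw [MvPolynomial.eval_eq] at h1
      rw [← mul_zero ((u : ℂ) ^ d), ← h1, Finset.mul_sum]
      refine Finset.sum_congr rfl fun m hm => ?_
      have hle := hmax m hm
      have h2 : ∏ i ∈ m.support, ((u : ℂ)⁻¹ ^ w i * v s u i) ^ m i =
          (u : ℂ)⁻¹ ^ Finsupp.weight w m * m.prod fun i k => v s u i ^ k := by
        simp only [mul_pow, Finset.prod_mul_distrib, ← pow_mul, Finset.prod_pow_eq_pow_sum]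
        congr 2
        rw [Finsupp.weight_apply]
        exact Finset.sum_congr rfl fun i _ => mul_comm _ _
      rw [h2, ← pow_sub_mul_pow (u : ℂ) hle, inv_pow]
      field_simp
    have hF00 : F 0 = 0 := by
      have hc : IsClosed {u | F u = 0} := isClosed_eq hF continuous_const
      have hdense : Dense {u : ℝ | u ≠ 0} := dense_compl_singleton 0
      exact hc.closure_subset_iff.2 hF0 (hdense 0)
    have hF01 : F 0 = MvPolynomial.eval (v s 0)
        (MvPolynomial.weightedHomogeneousComponent w d P) := by
      classical
      rw [MvPolynomial.weightedHomogeneousComponent_apply, map_sum, Finset.sum_filter]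
      refine Finset.sum_congr rfl fun m hm => ?_
      have hle := hmax m hm
      split_ifs with h
      · rw [h, MvPolynomial.eval_monomial]; simp
      · rw [Complex.ofReal_zero, zero_pow (by omega)]; simp
    rw [← hF01, hF00]
  have hc := congrArg (MvPolynomial.coeff m₀) hQ
  rw [MvPolynomial.coeff_weightedHomogeneousComponent, if_pos hd.symm, MvPolynomial.coeff_zero] at hc
  exact MvPolynomial.mem_support_iff.1 hm₀ hc

end Fibering


/-! ### Density of the symbols of the angular momentum operators -/

section Casimir

/-- The area `x_i ξ_j - x_j ξ_i`. -/
def area {N : ℕ} (x ξ : E N) (i j : Fin N) : ℝ := x i * ξ j - x j * ξ i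

/-- The principal symbol of `leftCasimir`. -/
def leftSymbol {N : ℕ} (m : ℕ) (x ξ : E N) : ℝ :=
  ∑ ij : Fin N × Fin N with ij.1 < ij.2 ∧ (ij.2 : ℕ) + 1 ≤ m, area x ξ ij.1 ij.2 ^ 2

/-- The principal symbol of `rightCasimir`. -/
def rightSymbol {N : ℕ} (m : ℕ) (x ξ : E N) : ℝ :=
  ∑ ij : Fin N × Fin N with ij.1 < ij.2 ∧ N < ((ij.1 : ℕ) + 1) + m, area x ξ ij.1 ij.2 ^ 2

/-- The principal symbols of the `2 N - 3` angular momentum operators, for `N = n + 2`. -/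
def casimirSymbol (n : ℕ) : Fin n ⊕ Fin (n + 1) → E (n + 2) → E (n + 2) → ℝ :=
  Sum.elim (fun a => leftSymbol (a + 2)) fun b => rightSymbol (b + 2)

/-- The areas are the `2 × 2` minors of the pair `(x, ξ)`, on which `SL₂` acts. -/
theorem area_transform {N : ℕ} {a b c d : ℝ} (h : a * d - b * c = 1) (x ξ : E N) (i j : Fin N) :
    area (a • x + b • ξ) (c • x + d • ξ) i j = area x ξ i j := by
  simp only [area, PiLp.add_apply, PiLp.smul_apply, smul_eq_mul]
  linear_combination (x i * ξ j - x j * ξ i) * h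

theorem casimirSymbol_transform {n : ℕ} {a b c d : ℝ} (h : a * d - b * c = 1) (x ξ : E (n + 2))
    (k : Fin n ⊕ Fin (n + 1)) :
    casimirSymbol n k (a • x + b • ξ) (c • x + d • ξ) = casimirSymbol n k x ξ := by
  rcases k with k | k <;>
    simp only [casimirSymbol, Sum.elim_inl, Sum.elim_inr, leftSymbol, rightSymbol,
      area_transform h]

variable {n : ℕ}

/-- The value at the last coordinate is `a`, the others are given by `X`. -/
def withLast (n : ℕ) (X : ℕ → ℝ) (a : ℝ) : E (n + 2) :=
  WithLp.toLp 2 fun i => if (i : ℕ) = n + 1 then a else X i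

theorem withLast_apply (X : ℕ → ℝ) (a : ℝ) (i : Fin (n + 2)) :
    withLast n X a i = if (i : ℕ) = n + 1 then a else X i := rfl

/-- `u² x_i² ξ_last²` and `u² (x_i ξ_j - x_j ξ_i)²` at `ξ_last = 1 / u`. -/
def scaledArea (X Z : ℕ → ℝ) (u : ℝ) (i j : Fin (n + 2)) : ℝ :=
  if (j : ℕ) = n + 1 then X i ^ 2 else u ^ 2 * (X i * Z j - X j * Z i) ^ 2

/-- The last coordinates are taken as `x = 0` and `ξ = 1 / u`. The left symbols do not see them,
since the full sum is listed among the right ones only. As `u → 0`, `u²` times the right symbol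
number `b` tends to the sum of `x_i²` over `n - b ≤ i ≤ n`. With `x` fixed and `ξ_0 = 0`, each new
left symbol brings in one new coordinate of `ξ`. Both families are thus triangular. -/
theorem zariskiDense_casimirSymbol (n : ℕ) :
    ZariskiDense {t : Fin n ⊕ Fin (n + 1) → ℂ | ∃ x ξ : E (n + 2),
      (∀ j, x j ≠ 0 ∨ ξ j ≠ 0) ∧ (∃ i j, area x ξ i j ≠ 0) ∧
        t = fun k => (casimirSymbol n k x ξ : ℂ)} := by
  -- The coordinates of `x` are numbered backwards because the right symbols grow from the last
  -- coordinate. Those of `ξ` are shifted by one because `ξ_0 = 0`.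
  let X : (ℕ → ℝ) → ℕ → ℝ := fun y i => y (n - i)
  let Z : (ℕ → ℝ) → ℕ → ℝ := fun z i => if i = 0 then 0 else z (i - 1)
  let L : (ℕ → ℝ) → ℕ → (ℕ → ℝ) → ℝ := fun y a z =>
    ∑ ij : Fin (n + 2) × Fin (n + 2) with ij.1 < ij.2 ∧ (ij.2 : ℕ) + 1 ≤ a + 2,
      (X y ij.1 * Z z ij.2 - X y ij.2 * Z z ij.1) ^ 2
  let R : ℕ → (ℕ → ℝ) → (ℕ → ℝ) → ℝ → ℝ := fun b y z u =>
    ∑ ij : Fin (n + 2) × Fin (n + 2) with ij.1 < ij.2 ∧ n + 2 < ((ij.1 : ℕ) + 1) + (b + 2),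
      scaledArea (X y) (Z z) u ij.1 ij.2
  have hR0 : ∀ b y z z', R b y z 0 = R b y z' 0 := fun b y z z' =>
    Finset.sum_congr rfl fun ij _ => by simp [scaledArea]
  have hdR := zariskiDense_triangular (fun b y => R b y 0 0) (n + 1) (by
    intro b hb y y' h
    refine Finset.sum_congr rfl fun ij hij => ?_
    have hij' := (Finset.mem_filter.1 hij).2.2
    simp only [scaledArea, X]
    rw [h _ (by omega)]
    simp) (by
    intro b hb y hy B
    -- The new parameter is `x_{n-b}`; its square, from the pair with the last coordinate, already
    -- exceeds `B`.
    refine ⟨|B| + 1, by positivity, ?_⟩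
    have h1 : scaledArea (n := n) (X (Function.update y b (|B| + 1))) (Z 0) 0
        ⟨n - b, by omega⟩ (Fin.last (n + 1)) ≤ R b (Function.update y b (|B| + 1)) 0 0 := by
      refine Finset.single_le_sum (f := fun ij : Fin (n + 2) × Fin (n + 2) =>
        scaledArea (X (Function.update y b (|B| + 1))) (Z 0) 0 ij.1 ij.2)
        (fun ij _ => ?_) (a := (⟨n - b, by omega⟩, Fin.last (n + 1))) ?_
      · simp only [scaledArea]; split_ifs <;> positivity
      · refine Finset.mem_filter.2 ⟨Finset.mem_univ _, ?_, ?_⟩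
        · change n - b < n + 1
          omega
        · change n + 2 < (n - b + 1) + (b + 2)
          omega
    refine lt_of_lt_of_le ?_ h1
    have h2 : n - (n - b) = b := by omega
    simp only [scaledArea, Fin.val_last, if_true, X, h2, Function.update_self]
    nlinarith [le_abs_self B, abs_nonneg B])
  have hdL : ∀ y : ℕ → ℝ, (∀ i, 0 < y i) → _ := fun y hy =>
    zariskiDense_triangular (L y) n (by
    intro a ha z z' h
    refine Finset.sum_congr rfl fun ij hij => ?_
    have hij' := (Finset.mem_filter.1 hij).2
    have hlt : (ij.1 : ℕ) < ij.2 := hij'.1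
    have e1 : Z z ij.1 = Z z' ij.1 := by
      simp only [Z]; rw [h _ (by omega)]
    have e2 : Z z ij.2 = Z z' ij.2 := by
      simp only [Z]; rw [h _ (by omega)]
    rw [e1, e2]) (by
    intro a ha z hz B
    -- Here `y n` is `x_0`, so the area of the pair `(0, a + 1)` becomes `|B| + 1`.
    refine ⟨(|B| + 1) / y n, div_pos (by positivity) (hy n), ?_⟩
    set z' := Function.update z a ((|B| + 1) / y n)
    have h1 : (X y (0 : ℕ) * Z z' (a + 1) - X y (a + 1) * Z z' (0 : ℕ)) ^ 2 ≤ L y a z' := by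
      refine Finset.single_le_sum (f := fun ij : Fin (n + 2) × Fin (n + 2) =>
        (X y ij.1 * Z z' ij.2 - X y ij.2 * Z z' ij.1) ^ 2)
        (fun ij _ => sq_nonneg _) (a := (0, ⟨a + 1, by omega⟩)) ?_
      refine Finset.mem_filter.2 ⟨Finset.mem_univ _, ?_, ?_⟩
      · change 0 < a + 1
        omega
      · change a + 1 + 1 ≤ a + 2
        omega
    refine lt_of_lt_of_le ?_ h1
    have h2 : X y 0 * Z z' (a + 1) = |B| + 1 := by
      simp [X, Z, z', mul_div_cancel₀ _ (hy n).ne']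
    have h3 : Z z' 0 = 0 := by simp [Z]
    rw [h2, h3]
    nlinarith [le_abs_self B, abs_nonneg B])
  let σ := {yz : (ℕ → ℝ) × (ℕ → ℝ) // (∀ i, 0 < yz.1 i) ∧ ∀ i, 0 < yz.2 i}
  have hlead := zariskiDense_of_leading (ι := Fin n ⊕ Fin (n + 1)) (σ := σ)
    (Sum.elim (fun _ => 0) fun _ => 2)
    (fun s u => Sum.elim (fun a : Fin n => (L s.1.1 a s.1.2 : ℂ))
      fun b : Fin (n + 1) => (R b s.1.1 s.1.2 u : ℂ)) (by
    intro s u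
    rcases u with a | b
    · exact continuous_const
    · refine Complex.continuous_ofReal.comp (continuous_finsetSum _ fun ij _ => ?_)
      simp only [scaledArea]
      split_ifs
      · exact continuous_const
      · exact (continuous_pow 2).mul continuous_const) (by
    refine hdR.sum ?_
    rintro t₂ ⟨y, hy, rfl⟩
    refine (hdL y hy).mono ?_
    rintro t₁ ⟨z, hz, rfl⟩
    refine ⟨⟨(y, z), hy, hz⟩, ?_⟩
    simp only
    congr 1
    ext b
    rw [hR0])
  refine hlead.mono ?_
  rintro _ ⟨⟨⟨y, z⟩, hy, hz⟩, u, hu, rfl⟩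
  have hX : ∀ i, 0 < X y i := fun i => hy _
  refine ⟨withLast n (X y) 0, withLast n (Z z) u⁻¹, ?_, ?_, ?_⟩
  · intro j
    by_cases hj : (j : ℕ) = n + 1
    · right; simp [withLast_apply, hj, hu]
    · left; simp [withLast_apply, hj, (hX j).ne']
  · refine ⟨0, Fin.last (n + 1), ?_⟩
    simp [area, withLast_apply, hu, (hX 0).ne']
  · have key : ∀ ij : Fin (n + 2) × Fin (n + 2), ij.1 < ij.2 →
        area (withLast n (X y) 0) (withLast n (Z z) u⁻¹) ij.1 ij.2 ^ 2 =
          (u⁻¹) ^ 2 * scaledArea (X y) (Z z) u ij.1 ij.2 := by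
      rintro ⟨i, j⟩ hij
      have h1 : (i : ℕ) ≠ n + 1 := by have := j.2; have : (i : ℕ) < j := hij; omega
      simp only [area, withLast_apply, scaledArea, h1, if_false]
      split_ifs
      · ring
      · field_simp
    ext k
    rcases k with a | b
    · simp only [Sum.elim_inl, pow_zero, one_mul, casimirSymbol, leftSymbol, L]
      congr 1
      refine Finset.sum_congr rfl fun ij hij => ?_
      have h2 := (Finset.mem_filter.1 hij).2
      have h3 : (ij.1 : ℕ) < ij.2 := h2.1
      simp only [area, withLast_apply]
      rw [if_neg (by omega), if_neg (by omega), if_neg (by omega), if_neg (by omega)]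
    · simp only [Sum.elim_inr, casimirSymbol, rightSymbol, R]
      rw [← Complex.ofReal_inv, ← Complex.ofReal_pow, ← Complex.ofReal_mul, Finset.mul_sum]
      congr 1
      exact Finset.sum_congr rfl fun ij hij => (key ij (Finset.mem_filter.1 hij).2.1).symm

end Casimir


/-! ### Density of the Hamiltonian and the extra observable along `SL₂` orbits -/

section Orbit

variable {n : ℕ}

/-- The symbols of a Hamiltonian, of a further observable, and of the angular momentum operators. -/
def fullSymbol (n : ℕ) (H S : E (n + 2) → E (n + 2) → ℝ) :
    (Unit ⊕ Unit) ⊕ (Fin n ⊕ Fin (n + 1)) → E (n + 2) → E (n + 2) → ℝ :=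
  Sum.elim (Sum.elim (fun _ => H) fun _ => S) (casimirSymbol n)

/-- A matrix of determinant one carries the nonzero pair `(x j, ξ j)` to `(0, 1)`; the Casimir
symbols do not change. -/
theorem exists_normal_form (j : Fin (n + 2)) {x ξ : E (n + 2)} (hj : x j ≠ 0 ∨ ξ j ≠ 0)
    (hD : ∃ i k, area x ξ i k ≠ 0) :
    ∃ x' ξ' : E (n + 2), x' j = 0 ∧ ξ' j = 1 ∧ (∃ i k, area x' ξ' i k ≠ 0) ∧
      ∀ k, casimirSymbol n k x' ξ' = casimirSymbol n k x ξ := by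
  have hρ : x j ^ 2 + ξ j ^ 2 ≠ 0 := by
    rcases hj with h | h
    · have := pow_pos (abs_pos.2 h) 2
      rw [sq_abs] at this
      positivity
    · have := pow_pos (abs_pos.2 h) 2
      rw [sq_abs] at this
      positivity
  set ρ := x j ^ 2 + ξ j ^ 2 with hρdef
  have hdet : ξ j * (ξ j / ρ) - (-x j) * (x j / ρ) = 1 := by
    field_simp
    rw [hρdef]; ring
  refine ⟨ξ j • x + (-x j) • ξ, (x j / ρ) • x + (ξ j / ρ) • ξ, ?_, ?_, ?_, ?_⟩
  · simp only [PiLp.add_apply, PiLp.smul_apply, smul_eq_mul]; ring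
  · simp only [PiLp.add_apply, PiLp.smul_apply, smul_eq_mul]
    field_simp
    rw [hρdef]
  · obtain ⟨i, k, h⟩ := hD
    exact ⟨i, k, by rwa [area_transform hdet]⟩
  · exact fun k => casimirSymbol_transform hdet x ξ k

theorem ne_zero_of_area_ne_zero {N : ℕ} {x ξ : E N} (hD : ∃ i k, area x ξ i k ≠ 0) : x ≠ 0 := by
  rintro rfl
  obtain ⟨i, k, h⟩ := hD
  simp [area] at h

/-- Strict Cauchy-Schwarz: up to the factor `‖x‖²` this is the squared norm of `‖x‖² ξ - ⟨x, ξ⟩ x`,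
which is nonzero because a nonzero area means that `x` and `ξ` are independent. -/
theorem gram_pos {N : ℕ} {x ξ : E N} (hD : ∃ i k, area x ξ i k ≠ 0) :
    0 < ‖x‖ ^ 2 * ‖ξ‖ ^ 2 - inner ℝ x ξ ^ 2 := by
  have hx : x ≠ 0 := ne_zero_of_area_ne_zero hD
  have hx2 : 0 < ‖x‖ ^ 2 := by positivity
  have hne : ‖x‖ ^ 2 • ξ - (inner ℝ x ξ) • x ≠ 0 := by
    intro h0
    obtain ⟨i, k, hik⟩ := hD
    apply hik
    have hc : ∀ l, ‖x‖ ^ 2 * ξ l = inner ℝ x ξ * x l := fun l => by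
      have := congrArg (fun v : E N => v l) h0
      simp only [PiLp.sub_apply, PiLp.smul_apply, smul_eq_mul, PiLp.zero_apply] at this
      linarith
    refine mul_left_cancel₀ hx2.ne' ?_
    rw [area, mul_zero]
    linear_combination x i * hc k - x k * hc i
  have h1 : 0 < ‖‖x‖ ^ 2 • ξ - (inner ℝ x ξ) • x‖ ^ 2 := by positivity
  have h2 : ‖‖x‖ ^ 2 • ξ - (inner ℝ x ξ) • x‖ ^ 2 =
      ‖x‖ ^ 2 * (‖x‖ ^ 2 * ‖ξ‖ ^ 2 - inner ℝ x ξ ^ 2) := by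
    rw [norm_sub_sq_real, norm_smul, norm_smul, real_inner_smul_left, real_inner_smul_right,
      real_inner_comm, mul_pow, mul_pow]
    simp only [Real.norm_eq_abs, sq_abs]
    ring
  rw [h2] at h1
  exact pos_of_mul_pos_right h1 hx2.le

theorem norm_shear_sq {N : ℕ} (x ξ : E N) (s τ : ℝ) :
    ‖(τ / s) • x + s⁻¹ • ξ‖ ^ 2 = (‖ξ‖ ^ 2 + 2 * τ * inner ℝ x ξ + τ ^ 2 * ‖x‖ ^ 2) / s ^ 2 := by
  rw [norm_add_sq_real, norm_smul, norm_smul, real_inner_smul_left, real_inner_smul_right,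
    mul_pow, mul_pow]
  simp only [Real.norm_eq_abs, sq_abs]
  by_cases hs : s = 0
  · simp [hs]
  field_simp
  ring

variable {Ω : Opens (E (n + 2))} (j : Fin (n + 2)) {H S : E (n + 2) → E (n + 2) → ℝ} {W : ℝ → ℝ}

/-- It suffices that the pair `(H, S)` is dense along the scalings and shears of a normal form. -/
theorem zariskiDense_fullSymbol
    (h : ∀ x ξ : E (n + 2), x j = 0 → ξ j = 1 → (∃ i k, area x ξ i k ≠ 0) →
      ZariskiDense {t : Unit ⊕ Unit → ℂ | ∃ s τ : ℝ, s ≠ 0 ∧ s • x ∈ Ω ∧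
        t = Sum.elim (fun _ => (H (s • x) ((τ / s) • x + s⁻¹ • ξ) : ℂ))
          fun _ => (S (s • x) ((τ / s) • x + s⁻¹ • ξ) : ℂ)}) :
    ZariskiDense {t : (Unit ⊕ Unit) ⊕ (Fin n ⊕ Fin (n + 1)) → ℂ | ∃ x ∈ Ω, ∃ ξ,
      t = fun k => (fullSymbol n H S k x ξ : ℂ)} := by
  refine (zariskiDense_casimirSymbol n).sum ?_
  rintro t₂ ⟨x₀, ξ₀, hj, hD, rfl⟩
  obtain ⟨x, ξ, hx, hξ, hD', hcas⟩ := exists_normal_form j (hj j) hD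
  refine (h x ξ hx hξ hD').mono ?_
  rintro t₁ ⟨s, τ, hs, hΩ, rfl⟩
  refine ⟨s • x, hΩ, (τ / s) • x + s⁻¹ • ξ, ?_⟩
  ext k
  rcases k with (k | k) | k
  · rfl
  · rfl
  · have hdet : s * s⁻¹ - 0 * (τ / s) = 1 := by field_simp; ring
    have := casimirSymbol_transform hdet x ξ k
    rw [zero_smul, add_zero] at this
    simp only [Sum.elim_inr, fullSymbol, this, hcas]

/-- On the normal form `S` equals `s⁻²`, so the admissible radii give infinitely many values. For a
fixed scaling `H` is quadratic in the shear `τ` with positive leading coefficient, hence unbounded.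
-/
theorem zariskiDense_fullSymbol_fradkin
    (hinf : {r : ℝ | 0 < r ∧ 0 < W r ∧ ∀ x : E (n + 2), ‖x‖ = r → x ∈ Ω}.Infinite)
    (hH : ∀ x ξ, H x ξ = ‖ξ‖ ^ 2 / (2 * W ‖x‖)) (hS : ∀ x ξ, x j = 0 → S x ξ = ξ j ^ 2) :
    ZariskiDense {t : (Unit ⊕ Unit) ⊕ (Fin n ⊕ Fin (n + 1)) → ℂ | ∃ x ∈ Ω, ∃ ξ,
      t = fun k => (fullSymbol n H S k x ξ : ℂ)} := by
  refine zariskiDense_fullSymbol j fun x ξ hx hξ hD => ?_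
  have hx0 : 0 < ‖x‖ := norm_pos_iff.2 (ne_zero_of_area_ne_zero hD)
  refine (zariskiDense_unit (S := (fun r => (‖x‖ / r) ^ 2) ''
    {r : ℝ | 0 < r ∧ 0 < W r ∧ ∀ x : E (n + 2), ‖x‖ = r → x ∈ Ω}) ?_).sum ?_
  · refine hinf.image fun r hr r' hr' h => ?_
    have h1 : ‖x‖ / r = ‖x‖ / r' :=
      (pow_left_inj₀ (div_pos hx0 hr.1).le (div_pos hx0 hr'.1).le two_ne_zero).1 h
    have := hr.1
    have := hr'.1
    field_simp at h1
    exact h1.symm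
  rintro _ ⟨_, ⟨r, ⟨hr, hW, hΩ⟩, rfl⟩, rfl⟩
  set s := r / ‖x‖ with hs
  have hs0 : 0 < s := div_pos hr hx0
  have hsx : ‖s • x‖ = r := by
    rw [norm_smul, Real.norm_of_nonneg hs0.le, hs, div_mul_cancel₀ _ hx0.ne']
  refine (zariskiDense_unit
    (S := Set.range fun τ : ℝ => H (s • x) ((τ / s) • x + s⁻¹ • ξ)) ?_).mono ?_
  · refine infinite_of_unbounded fun B => ?_
    set Y := inner ℝ x ξ
    set C := |B| * (2 * W r) * s ^ 2 with hC
    have hC0 : 0 ≤ C := by positivity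
    refine ⟨_, ⟨(C + 1 + 2 * |Y|) / ‖x‖ ^ 2 + 1, rfl⟩, ?_⟩
    set τ := (C + 1 + 2 * |Y|) / ‖x‖ ^ 2 + 1
    have hτ1 : 1 ≤ τ := le_add_of_nonneg_left (by positivity)
    have hτ2 : C + 1 + 2 * |Y| ≤ τ * ‖x‖ ^ 2 := by
      simp only [τ]; rw [add_mul, div_mul_cancel₀ _ (by positivity)]; nlinarith [sq_nonneg ‖x‖]
    beta_reduce
    rw [hH, hsx, norm_shear_sq, div_div, lt_div_iff₀ (by positivity)]
    have h3 : -|Y| ≤ Y := neg_abs_le Y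
    have h4 : B * (s ^ 2 * (2 * W r)) ≤ C := by
      rw [hC]; nlinarith [le_abs_self B, mul_pos (pow_pos hs0 2) (mul_pos two_pos hW)]
    have h5 : τ * (C + 1 + 2 * |Y|) ≤ τ ^ 2 * ‖x‖ ^ 2 := by nlinarith
    nlinarith [sq_nonneg ‖ξ‖, mul_nonneg (sub_nonneg.2 hτ1) hC0, abs_nonneg Y]
  · rintro _ ⟨_, ⟨τ, rfl⟩, rfl⟩
    refine ⟨s, τ, hs0.ne', hΩ _ hsx, ?_⟩
    congr 1
    ext
    rw [hS _ _ (by simp [hx])]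
    simp [hx, hξ, hs]

/-- The shear is adjusted to keep `S` at a prescribed value `κ` while the radius `r` varies.
Invariance of the Gram determinant `G` then gives `H = (κ² r² / ‖x‖² + G) / (2 r² W r)`, which takes
infinitely many values. -/
theorem zariskiDense_fullSymbol_lrl {a b : ℝ}
    (hinf : {r : ℝ | 0 < r ∧ 0 < W r ∧ ∀ x : E (n + 2), ‖x‖ = r → x ∈ Ω}.Infinite)
    (hW : ∀ r, 0 < r → r ^ 2 * W r = a * r ^ 2 + b * r)
    (hH : ∀ x ξ, H x ξ = ‖ξ‖ ^ 2 / (2 * W ‖x‖))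
    (hS : ∀ x ξ, x j = 0 → S x ξ = inner ℝ x ξ * ξ j) :
    ZariskiDense {t : (Unit ⊕ Unit) ⊕ (Fin n ⊕ Fin (n + 1)) → ℂ | ∃ x ∈ Ω, ∃ ξ,
      t = fun k => (fullSymbol n H S k x ξ : ℂ)} := by
  refine zariskiDense_fullSymbol j fun x ξ hx hξ hD => ?_
  have hx0 : 0 < ‖x‖ := norm_pos_iff.2 (ne_zero_of_area_ne_zero hD)
  have hG := gram_pos hD
  set G := ‖x‖ ^ 2 * ‖ξ‖ ^ 2 - inner ℝ x ξ ^ 2 with hGdef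
  refine (zariskiDense_unit (S := Set.univ) Set.infinite_univ).sum ?_
  rintro _ ⟨κ, -, rfl⟩
  set A := {r : ℝ | 0 < r ∧ 0 < W r ∧ ∀ x : E (n + 2), ‖x‖ = r → x ∈ Ω}
  refine (zariskiDense_unit
    (S := (fun r => (κ ^ 2 * r ^ 2 / ‖x‖ ^ 2 + G) / (2 * (r ^ 2 * W r))) '' A) ?_).mono ?_
  · intro hfin
    refine hinf ?_
    refine Set.Finite.of_finite_fibers _ hfin fun h _ => ?_
    -- The radii with `H = h` are roots of this polynomial, which is nonzero because its constant
    -- term is `G > 0`. The fibres of `r ↦ H` are therefore finite.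
    let p : Polynomial ℝ := Polynomial.C (κ ^ 2 / ‖x‖ ^ 2 - 2 * h * a) * Polynomial.X ^ 2 -
      Polynomial.C (2 * h * b) * Polynomial.X + Polynomial.C G
    have hp : p ≠ 0 := fun h0 => hG.ne' (by simpa [p] using congrArg (Polynomial.eval 0) h0)
    refine (Polynomial.finite_setOfPred_isRoot hp).subset ?_
    rintro r ⟨⟨hr, hWr, -⟩, hrh⟩
    have hrh' : (κ ^ 2 * r ^ 2 / ‖x‖ ^ 2 + G) / (2 * (r ^ 2 * W r)) = h := hrh
    rw [div_eq_iff (by positivity), hW r hr] at hrh'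
    simp only [p, Set.mem_ofPred_eq, Polynomial.IsRoot, Polynomial.eval_add, Polynomial.eval_sub,
      Polynomial.eval_mul, Polynomial.eval_C, Polynomial.eval_pow, Polynomial.eval_X]
    linear_combination hrh'
  · rintro _ ⟨_, ⟨r, ⟨hr, hWr, hΩ⟩, rfl⟩, rfl⟩
    set s := r / ‖x‖ with hs
    have hs0 : 0 < s := div_pos hr hx0
    have hsx : ‖s • x‖ = r := by
      rw [norm_smul, Real.norm_of_nonneg hs0.le, hs, div_mul_cancel₀ _ hx0.ne']
    refine ⟨s, (κ * s - inner ℝ x ξ) / ‖x‖ ^ 2, hs0.ne', hΩ _ hsx, ?_⟩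
    congr 1
    · ext
      rw [hH, hsx, norm_shear_sq]
      congr 1
      rw [hGdef, hs]
      field_simp
      ring
    · ext
      rw [hS _ _ (by simp [hx]), inner_add_right, real_inner_smul_left, real_inner_smul_right,
        real_inner_smul_left, real_inner_smul_right, real_inner_self_eq_norm_sq]
      simp only [PiLp.add_apply, PiLp.smul_apply, hx, hξ, smul_eq_mul]
      congr 1
      field_simp
      ring

end Orbit


/-! ### Symbol calculus for the operators at hand -/

section SymbolCalculus

variable {N : ℕ} {Ω : Opens (E N)} {hbar : ℝ}

theorem ad_mulOp_dirOp (φ : E N → ℝ) (hφ : ContDiffOn ℝ ∞ φ Ω) (ξ : E N) :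
    ad (mulOp Ω φ hφ) (dirOp Ω ξ) = 0 :=
  ActsBy.ad_eq_zero (φ := fun x => (φ x : ℂ)) (fun _ _ _ => rfl) (actsBy_dirOp ξ)

theorem adPow_mulOp_mul (φ : E N → ℝ) (hφ : ContDiffOn ℝ ∞ φ Ω) (ξ : E N) (n : ℕ) (A : Op Ω) :
    adPow (dirOp Ω ξ) n (mulOp Ω φ hφ * A) = mulOp Ω φ hφ * adPow (dirOp Ω ξ) n A := by
  induction n with
  | zero => rfl
  | succ n ih => rw [adPow_succ, ih, mul_ad, ad_mulOp_dirOp, zero_mul, add_zero, adPow_succ]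

theorem hasSymbolOne_momOp (i : Fin N) :
    HasSymbolOne hbar (momOp Ω hbar i) fun _ ξ => ξ i := by
  intro ξ f x _
  change ad (momOp Ω hbar i) (dirOp Ω ξ) f x = _
  rw [dirOp, ad_sum]
  simp only [ad_smul, (isCanonical_op hbar).ad_p_q]
  rw [Finset.sum_eq_single i (fun j _ hj => by rw [if_neg hj.symm, smul_zero]) (by simp),
    if_pos rfl, ← neg_smul, op_smul_apply, op_smul_apply]
  simp
  ring

namespace HasSymbolOne

theorem sub {A B : Op Ω} {a b : E N → E N → ℝ} (hA : HasSymbolOne hbar A a)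
    (hB : HasSymbolOne hbar B b) : HasSymbolOne hbar (A - B) fun x ξ => a x ξ - b x ξ := by
  intro ξ f x hx
  have e : adPow (dirOp Ω ξ) 1 (A - B) = adPow (dirOp Ω ξ) 1 A - adPow (dirOp Ω ξ) 1 B :=
    sub_ad _ _ _
  rw [e, op_sub_apply, hA ξ f x hx, hB ξ f x hx]
  push_cast; ring

theorem mulOp_mul {A : Op Ω} {a : E N → E N → ℝ} (φ : E N → ℝ) (hφ : ContDiffOn ℝ ∞ φ Ω)
    (hA : HasSymbolOne hbar A a) : HasSymbolOne hbar (mulOp Ω φ hφ * A) fun x ξ => φ x * a x ξ := by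
  intro ξ f x hx
  rw [adPow_mulOp_mul, op_mul_apply, mulOp_apply, hA ξ f x hx]
  push_cast; ring

/-- Of the second commutator only the mixed term survives, twice: `2 (-iħ)² = -2ħ²`, the constant in
`HasSymbol`. -/
theorem mul {A B : Op Ω} {a b : E N → E N → ℝ} (hA : HasSymbolOne hbar A a)
    (hB : HasSymbolOne hbar B b) : HasSymbol hbar (A * B) fun x ξ => a x ξ * b x ξ := by
  intro ξ f x hx
  have hA2 : ad (ad A (dirOp Ω ξ)) (dirOp Ω ξ) = 0 := (hA ξ).ad_eq_zero (actsBy_dirOp ξ)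
  have hB2 : ad (ad B (dirOp Ω ξ)) (dirOp Ω ξ) = 0 := (hB ξ).ad_eq_zero (actsBy_dirOp ξ)
  have hA1 : ∀ f : 𝓓(Ω, ℂ), ad A (dirOp Ω ξ) f x = _ := fun f => hA ξ f x hx
  have hB1 : ∀ f : 𝓓(Ω, ℂ), ad B (dirOp Ω ξ) f x = _ := fun f => hB ξ f x hx
  change ad (ad (A * B) (dirOp Ω ξ)) (dirOp Ω ξ) f x = _
  rw [mul_ad, add_ad, mul_ad, mul_ad, hA2, hB2, mul_zero, zero_mul, zero_add, add_zero,
    op_add_apply, op_mul_apply, hA1, hB1]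
  push_cast
  linear_combination (2 * (hbar : ℂ) ^ 2 * a x ξ * b x ξ * f x) * Complex.I_sq

end HasSymbolOne

theorem hasSymbolOne_angMom (i j : Fin N) :
    HasSymbolOne hbar (angMom Ω hbar i j) fun x ξ => area x ξ i j :=
  ((hasSymbolOne_momOp j).mulOp_mul _ _).sub ((hasSymbolOne_momOp i).mulOp_mul _ _)

namespace HasSymbol

theorem congr {A : Op Ω} {a b : E N → E N → ℝ} (hA : HasSymbol hbar A a)
    (hab : ∀ x ∈ Ω, ∀ ξ, a x ξ = b x ξ) : HasSymbol hbar A b := by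
  intro ξ f x hx
  rw [hA ξ f x hx]
  beta_reduce
  rw [hab x hx]

theorem add {A B : Op Ω} {a b : E N → E N → ℝ} (hA : HasSymbol hbar A a)
    (hB : HasSymbol hbar B b) : HasSymbol hbar (A + B) fun x ξ => a x ξ + b x ξ := by
  intro ξ f x hx
  rw [adPow_add_right, op_add_apply, hA ξ f x hx, hB ξ f x hx]
  push_cast; ring

theorem smul {A : Op Ω} {a : E N → E N → ℝ} (r : ℝ) (hA : HasSymbol hbar A a) :
    HasSymbol hbar ((r : ℂ) • A) fun x ξ => r * a x ξ := by
  intro ξ f x hx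
  rw [adPow_smul, op_smul_apply, hA ξ f x hx]
  push_cast; ring

theorem sum {κ : Type*} (s : Finset κ) {A : κ → Op Ω} {a : κ → E N → E N → ℝ}
    (hA : ∀ k, HasSymbol hbar (A k) (a k)) :
    HasSymbol hbar (∑ k ∈ s, A k) fun x ξ => ∑ k ∈ s, a k x ξ := by
  intro ξ f x hx
  rw [adPow_sum, op_sum_apply, Finset.sum_congr rfl fun k _ => hA k ξ f x hx, ← Finset.sum_mul,
    ← Finset.mul_sum]
  push_cast; ring

theorem mulOp_mul {A : Op Ω} {a : E N → E N → ℝ} (φ : E N → ℝ) (hφ : ContDiffOn ℝ ∞ φ Ω)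
    (hA : HasSymbol hbar A a) : HasSymbol hbar (mulOp Ω φ hφ * A) fun x ξ => φ x * a x ξ := by
  intro ξ f x hx
  rw [adPow_mulOp_mul, op_mul_apply, mulOp_apply, hA ξ f x hx]
  push_cast; ring

/-- Terms of lower order are invisible to the symbol. -/
theorem smul_one (z : ℂ) : HasSymbol hbar (z • (1 : Op Ω)) fun _ _ => 0 := by
  intro ξ f x _
  have : adPow (dirOp Ω ξ) 2 (z • (1 : Op Ω)) = 0 := by
    change ad (ad _ _) _ = _
    simp [ad]
  rw [this]
  simp

end HasSymbol

theorem hasSymbol_momSq : HasSymbol hbar (momSq Ω hbar) fun _ ξ => ‖ξ‖ ^ 2 := by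
  refine (HasSymbol.sum Finset.univ (A := fun k => momOp Ω hbar k ^ 2) fun k => ?_).congr
    (a := fun _ ξ => ∑ k, ξ k * ξ k) fun x _ ξ => ?_
  · simpa only [pow_two] using (hasSymbolOne_momOp (Ω := Ω) k).mul (hasSymbolOne_momOp k)
  · rw [EuclideanSpace.real_norm_sq_eq]
    exact Finset.sum_congr rfl fun k _ => (pow_two _).symm

theorem hasSymbol_lrlSeed (i : Fin N) :
    HasSymbol hbar (lrlSeed Ω hbar i) fun x ξ => ∑ k, ξ k * area x ξ k i := by
  have h := ((HasSymbol.sum Finset.univ fun k =>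
    (hasSymbolOne_momOp (Ω := Ω) (hbar := hbar) k).mul (hasSymbolOne_angMom k i)).smul (1 / 2)).add
    ((HasSymbol.sum Finset.univ fun k =>
    (hasSymbolOne_angMom (Ω := Ω) (hbar := hbar) k i).mul (hasSymbolOne_momOp k)).smul (1 / 2))
  have h2 := h.congr (b := fun x ξ => ∑ k, ξ k * area x ξ k i) fun x _ ξ => by
    simp only [mul_comm (area _ _ _ _)]
    ring
  push_cast at h2
  exact h2

theorem hasSymbol_angMom_sq (i j : Fin N) :
    HasSymbol hbar (angMom Ω hbar i j ^ 2) fun x ξ => area x ξ i j ^ 2 := by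
  simpa only [pow_two] using (hasSymbolOne_angMom (Ω := Ω) (hbar := hbar) i j).mul
    (hasSymbolOne_angMom i j)

theorem hasSymbol_leftCasimir (m : ℕ) :
    HasSymbol hbar (leftCasimir Ω hbar m) (leftSymbol m) :=
  HasSymbol.sum _ fun ij => hasSymbol_angMom_sq ij.1 ij.2

theorem hasSymbol_rightCasimir (m : ℕ) :
    HasSymbol hbar (rightCasimir Ω hbar m) (rightSymbol m) :=
  HasSymbol.sum _ fun ij => hasSymbol_angMom_sq ij.1 ij.2

end SymbolCalculus

/-! ### Angular momentum Casimir operators -/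

section CasimirOperators

variable {N : ℕ} {Ω : Opens (E N)} {hbar : ℝ}

/-- The Casimir operator of the rotations of the coordinates in `s`. -/
noncomputable def casimirOp (Ω : Opens (E N)) (hbar : ℝ) (s : Finset (Fin N)) : Op Ω :=
  (1 / 2 : ℂ) • ∑ i ∈ s, ∑ j ∈ s, angMom Ω hbar i j ^ 2

/-- The squares are symmetric in the two indices and vanish on the diagonal, so the pairs `i < j`
make up half of all ordered pairs. -/
theorem sum_lt_eq_casimirOp (s : Finset (Fin N)) (P : Fin N → Fin N → Prop)
    [∀ i j, Decidable (P i j)] (hP : ∀ i j, i < j → (P i j ↔ i ∈ s ∧ j ∈ s)) :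
    ∑ ij : Fin N × Fin N with ij.1 < ij.2 ∧ P ij.1 ij.2, angMom Ω hbar ij.1 ij.2 ^ 2 =
      casimirOp Ω hbar s := by
  set F : Fin N → Fin N → Op Ω := fun i j => angMom Ω hbar i j ^ 2
  have hsymm : ∀ i j, F i j = F j i := fun i j => by
    simp only [F, angMom_eq_ang]; rw [ang_antisymm, neg_sq]
  have hdiag : ∀ i, F i i = 0 := fun i => by
    simp only [F, angMom_eq_ang, ang_self]; simp
  have e1 : ∑ ij : Fin N × Fin N with ij.1 < ij.2 ∧ P ij.1 ij.2, F ij.1 ij.2 =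
      ∑ i ∈ s, ∑ j ∈ s, if i < j then F i j else 0 := by
    rw [← Finset.sum_product', ← Finset.sum_filter]
    refine Finset.sum_congr ?_ fun _ _ => rfl
    ext ⟨i, j⟩
    simp only [Finset.mem_filter, Finset.mem_univ, true_and, Finset.mem_product]
    constructor
    · rintro ⟨h1, h2⟩; exact ⟨(hP i j h1).1 h2, h1⟩
    · rintro ⟨h1, h2⟩; exact ⟨h2, (hP i j h2).2 h1⟩
  have e2 : ∑ i ∈ s, ∑ j ∈ s, (if i < j then F i j else 0) =
      ∑ i ∈ s, ∑ j ∈ s, if j < i then F i j else 0 := by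
    rw [Finset.sum_comm]
    simp only [fun i j => hsymm i j]
  have e3 : ∑ i ∈ s, ∑ j ∈ s, F i j = (∑ i ∈ s, ∑ j ∈ s, if i < j then F i j else 0) +
      ∑ i ∈ s, ∑ j ∈ s, if j < i then F i j else 0 := by
    simp only [← Finset.sum_add_distrib]
    refine Finset.sum_congr rfl fun i _ => Finset.sum_congr rfl fun j _ => ?_
    rcases lt_trichotomy i j with h | h | h
    · simp [h, h.not_gt]
    · subst h; simp [hdiag]
    · simp [h, h.not_gt]
  change _ = (1 / 2 : ℂ) • ∑ i ∈ s, ∑ j ∈ s, F i j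
  rw [e3, ← e2, e1]
  module

theorem leftCasimir_eq (m : ℕ) :
    leftCasimir Ω hbar m = casimirOp Ω hbar {i : Fin N | (i : ℕ) + 1 ≤ m} := by
  refine sum_lt_eq_casimirOp _ (fun _ j => (j : ℕ) + 1 ≤ m) fun i j hij => ?_
  have : (i : ℕ) < j := hij
  simp only [Finset.mem_filter, Finset.mem_univ, true_and]
  omega

theorem rightCasimir_eq (m : ℕ) :
    rightCasimir Ω hbar m = casimirOp Ω hbar {i : Fin N | N < (i : ℕ) + 1 + m} := by
  refine sum_lt_eq_casimirOp _ (fun i _ => N < (i : ℕ) + 1 + m) fun i j hij => ?_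
  have : (i : ℕ) < j := hij
  simp only [Finset.mem_filter, Finset.mem_univ, true_and]
  omega

theorem totalAngMomSq_eq : totalAngMomSq Ω hbar = casimirOp Ω hbar Finset.univ := by
  rw [← sum_lt_eq_casimirOp (s := Finset.univ) (P := fun _ _ => True) (by simp)]
  simp [totalAngMomSq]

/-- Each rotation of coordinates in `s` is one in `t` and so preserves the larger Casimir. The left
index sets are nested, and so are the right ones. -/
theorem casimirOp_commute {s t : Finset (Fin N)} (h : s ⊆ t) :
    Commute (casimirOp Ω hbar s) (casimirOp Ω hbar t) := by
  refine (Commute.sum_left _ _ _ fun i hi => Commute.sum_left _ _ _ fun j hj => ?_).smul_left _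
  exact (((isCanonical_op hbar).ang_comm_casimir t (h hi) (h hj)).smul_right _).pow_left 2

theorem commute_casimirOp {A : Op Ω} (hA : ∀ i j, Commute A (angMom Ω hbar i j))
    (s : Finset (Fin N)) : Commute A (casimirOp Ω hbar s) :=
  (Commute.sum_right _ _ _ fun i _ => Commute.sum_right _ _ _ fun j _ =>
    (hA i j).pow_right 2).smul_right _

theorem isObservable_casimirOp (w : E N → ℝ) (hw : ContDiffOn ℝ ∞ w Ω)
    (hrad : ∀ i j, Commute (mulOp Ω w hw) (angMom Ω hbar i j)) (s : Finset (Fin N)) :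
    IsObservable w (casimirOp Ω hbar s) := by
  have h : IsFormalAdjoint (casimirOp Ω hbar s) (casimirOp Ω hbar s) := by
    have := (IsFormalAdjoint.sum s fun i _ => IsFormalAdjoint.sum s fun j _ =>
      (IsFormalAdjoint.angMom (Ω := Ω) hbar i j).sq).ofReal_smul (1 / 2)
    push_cast at this
    exact this
  exact h.isObservable w hw (commute_casimirOp hrad s).symm.eq

theorem leftCasimir_top : leftCasimir Ω hbar N = totalAngMomSq Ω hbar := by
  rw [leftCasimir_eq, totalAngMomSq_eq]
  congr 1
  ext i
  simp only [Finset.mem_filter, Finset.mem_univ, true_and, iff_true]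
  omega

theorem rightCasimir_top : rightCasimir Ω hbar N = totalAngMomSq Ω hbar := by
  rw [rightCasimir_eq, totalAngMomSq_eq]
  congr 1
  ext i
  simp only [Finset.mem_filter, Finset.mem_univ, true_and, iff_true]
  omega

end CasimirOperators

/-! ### From symbols to integrability and superintegrability -/

section Structure

variable {n : ℕ} {Ω : Opens (E (n + 2))} {hbar : ℝ}

/-- The `2 N - 3` angular momentum operators, for `N = n + 2`. -/
noncomputable def casimirFamily (Ω : Opens (E (n + 2))) (hbar : ℝ) : Fin n ⊕ Fin (n + 1) → Op Ω :=
  Sum.elim (fun a => leftCasimir Ω hbar (a + 2)) fun b => rightCasimir Ω hbar (b + 2)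

/-- A Hamiltonian, a further operator, and the angular momentum operators. -/
noncomputable def fullFamily (hbar : ℝ) (H S : Op Ω) :
    (Unit ⊕ Unit) ⊕ (Fin n ⊕ Fin (n + 1)) → Op Ω :=
  Sum.elim (Sum.elim (fun _ => H) fun _ => S) (casimirFamily Ω hbar)

theorem leftCasimirs_eq_range :
    leftCasimirs Ω hbar = Set.range fun a : Fin (n + 1) => leftCasimir Ω hbar (a + 2) := by
  ext A
  constructor
  · rintro ⟨m, ⟨h2, hm⟩, rfl⟩
    exact ⟨⟨m - 2, by omega⟩, by simp [Nat.sub_add_cancel h2]⟩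
  · rintro ⟨a, rfl⟩
    exact ⟨a + 2, ⟨by omega, by omega⟩, rfl⟩

theorem rightCasimirs_eq_range :
    rightCasimirs Ω hbar = Set.range fun a : Fin (n + 1) => rightCasimir Ω hbar (a + 2) := by
  ext A
  constructor
  · rintro ⟨m, ⟨h2, hm⟩, rfl⟩
    exact ⟨⟨m - 2, by omega⟩, by simp [Nat.sub_add_cancel h2]⟩
  · rintro ⟨a, rfl⟩
    exact ⟨a + 2, ⟨by omega, by omega⟩, rfl⟩

/-- The position in `casimirFamily` of the left Casimir operators. -/
def leftIndex (n : ℕ) (a : Fin (n + 1)) : Fin n ⊕ Fin (n + 1) :=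
  -- The top left Casimir is `L̂²`, which the family contains only once, as its last right member.
  if h : (a : ℕ) < n then Sum.inl ⟨a, h⟩ else Sum.inr (Fin.last n)

theorem leftIndex_injective : Function.Injective (leftIndex n) := by
  intro a b hab
  simp only [leftIndex] at hab
  ext
  have := a.2
  have := b.2
  split_ifs at hab with h1 h2 h2
  · simpa using hab
  · omega

theorem casimirFamily_leftIndex (a : Fin (n + 1)) :
    casimirFamily Ω hbar (leftIndex n a) = leftCasimir Ω hbar (a + 2) := by
  rw [leftIndex]
  split_ifs with h
  · rfl
  · have ha : (a : ℕ) = n := by omega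
    rw [ha]
    exact rightCasimir_top.trans leftCasimir_top.symm

theorem union_casimirs_eq_range :
    leftCasimirs Ω hbar ∪ rightCasimirs Ω hbar = Set.range (casimirFamily Ω hbar) := by
  rw [leftCasimirs_eq_range, rightCasimirs_eq_range]
  ext A
  constructor
  · rintro (⟨a, rfl⟩ | ⟨b, rfl⟩)
    · exact ⟨leftIndex n a, casimirFamily_leftIndex a⟩
    · exact ⟨Sum.inr b, rfl⟩
  · rintro ⟨a | b, rfl⟩
    · exact Or.inl ⟨⟨a, by omega⟩, rfl⟩
    · exact Or.inr ⟨b, rfl⟩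

theorem range_unit_elim {κ R : Type*} (A : R) (B : κ → R) :
    Set.range (Sum.elim (fun _ : Unit => A) B) = insert A (Set.range B) := by
  rw [Set.Sum.elim_range, Set.range_const, Set.singleton_union]

theorem isIndepObservables_range {ι κ : Type*} [Fintype κ] (hh : hbar ≠ 0) {A : ι → Op Ω}
    {a : ι → E (n + 2) → E (n + 2) → ℝ} (h : ∀ i, HasSymbol hbar (A i) (a i))
    (hT : ZariskiDense {t : ι → ℂ | ∃ x ∈ Ω, ∃ ξ, t = fun i => (a i x ξ : ℂ)})
    {w : E (n + 2) → ℝ} (hobs : ∀ i, IsObservable w (A i)) (j : κ → ι)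
    (hj : Function.Injective j) {s : Set (Op Ω)} (hs : s = Set.range (A ∘ j)) {d : ℕ}
    (hd : Fintype.card κ = d) : IsIndepObservables w s d where
  finite := hs ▸ Set.finite_range _
  card := by
    rw [hs, ← Set.image_univ, Set.ncard_image_of_injective _
      ((injective_of_zariskiDense hh h hT).comp hj), Set.ncard_univ, Nat.card_eq_fintype_card, hd]
  observable := by
    rw [hs]
    rintro _ ⟨k, rfl⟩
    exact hobs _
  algIndep := algIndepOps_of_subset_range hh h hT
    (hs ▸ Set.range_comp_subset_range _ _)

/-- The data from which the integrability properties of a system are deduced. -/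
structure IsSystem (hbar : ℝ) (w : E (n + 2) → ℝ) (H S : Op Ω)
    (a b : E (n + 2) → E (n + 2) → ℝ) : Prop where
  hbar_ne : hbar ≠ 0
  symbol_H : HasSymbol hbar H a
  symbol_S : HasSymbol hbar S b
  dense : ZariskiDense {t : (Unit ⊕ Unit) ⊕ (Fin n ⊕ Fin (n + 1)) → ℂ | ∃ x ∈ Ω, ∃ ξ,
    t = fun k => (fullSymbol n a b k x ξ : ℂ)}
  commute_ang : ∀ i j, Commute H (angMom Ω hbar i j)
  observable_H : IsObservable w H
  observable_S : IsObservable w S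
  observable_casimir : ∀ s, IsObservable w (casimirOp Ω hbar s)
  commute_S : Commute H S

namespace IsSystem

variable {w : E (n + 2) → ℝ} {H S : Op Ω} {a b : E (n + 2) → E (n + 2) → ℝ}
  (h : IsSystem hbar w H S a b)
include h

theorem hasSymbol (k : (Unit ⊕ Unit) ⊕ (Fin n ⊕ Fin (n + 1))) :
    HasSymbol hbar (fullFamily hbar H S k) (fullSymbol n a b k) := by
  rcases k with (k | k) | k | k
  · exact h.symbol_H
  · exact h.symbol_S
  · exact hasSymbol_leftCasimir _
  · exact hasSymbol_rightCasimir _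

theorem observable (k : (Unit ⊕ Unit) ⊕ (Fin n ⊕ Fin (n + 1))) :
    IsObservable w (fullFamily hbar H S k) := by
  rcases k with (k | k) | k | k
  · exact h.observable_H
  · exact h.observable_S
  · change IsObservable w (leftCasimir Ω hbar (k + 2))
    rw [leftCasimir_eq]
    exact h.observable_casimir _
  · change IsObservable w (rightCasimir Ω hbar (k + 2))
    rw [rightCasimir_eq]
    exact h.observable_casimir _

theorem commute_left (m : ℕ) : Commute H (leftCasimir Ω hbar m) := by
  rw [leftCasimir_eq]; exact commute_casimirOp h.commute_ang _

theorem commute_right (m : ℕ) : Commute H (rightCasimir Ω hbar m) := by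
  rw [rightCasimir_eq]; exact commute_casimirOp h.commute_ang _

theorem commute_casimirs : ∀ A ∈ leftCasimirs Ω hbar ∪ rightCasimirs Ω hbar, Commute H A := by
  rintro _ (⟨m, -, rfl⟩ | ⟨m, -, rfl⟩)
  · exact h.commute_left m
  · exact h.commute_right m

theorem hasAngularMomentumSymmetries : HasAngularMomentumSymmetries hbar w H where
  left_top := leftCasimir_top
  right_top := rightCasimir_top
  card := by
    have hinj : Function.Injective (casimirFamily Ω hbar) :=
      (injective_of_zariskiDense h.hbar_ne h.hasSymbol h.dense).comp Sum.inr_injective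
    rw [union_casimirs_eq_range, ← Set.image_univ, Set.ncard_image_of_injective _ hinj,
      Set.ncard_univ, Nat.card_eq_fintype_card]
    simp
    omega
  commute := h.commute_casimirs
  left_indep := by
    refine isIndepObservables_range h.hbar_ne h.hasSymbol h.dense h.observable
      (κ := Unit ⊕ Fin (n + 1)) (Sum.map Sum.inl (leftIndex n))
      (Sum.map_injective.2 ⟨Sum.inl_injective, leftIndex_injective⟩) ?_ (by simp; omega)
    rw [leftCasimirs_eq_range, ← range_unit_elim]
    congr 1
    ext1 (k | k)
    · rfl
    · exact (casimirFamily_leftIndex k).symm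
  left_commute := by
    have key : ∀ m m', Commute (leftCasimir Ω hbar m) (leftCasimir Ω hbar m') := by
      have hle : ∀ m m', m ≤ m' → Commute (leftCasimir Ω hbar m) (leftCasimir Ω hbar m') := by
        intro m m' hm
        rw [leftCasimir_eq, leftCasimir_eq]
        refine casimirOp_commute fun i hi => ?_
        simp only [Finset.mem_filter, Finset.mem_univ, true_and] at hi ⊢
        omega
      intro m m'
      rcases le_total m m' with hm | hm
      · exact hle m m' hm
      · exact (hle m' m hm).symm
    rintro _ (rfl | ⟨m, -, rfl⟩) _ (rfl | ⟨m', -, rfl⟩)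
    · exact Commute.refl _
    · exact h.commute_left m'
    · exact (h.commute_left m).symm
    · exact key m m'
  right_indep := by
    refine isIndepObservables_range h.hbar_ne h.hasSymbol h.dense h.observable
      (κ := Unit ⊕ Fin (n + 1)) (Sum.map Sum.inl Sum.inr)
      (Sum.map_injective.2 ⟨Sum.inl_injective, Sum.inr_injective⟩) ?_ (by simp; omega)
    rw [rightCasimirs_eq_range, ← range_unit_elim]
    congr 1
    ext1 (k | k) <;> rfl
  right_commute := by
    have key : ∀ m m', Commute (rightCasimir Ω hbar m) (rightCasimir Ω hbar m') := by
      have hle : ∀ m m', m ≤ m' → Commute (rightCasimir Ω hbar m) (rightCasimir Ω hbar m') := by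
        intro m m' hm
        rw [rightCasimir_eq, rightCasimir_eq]
        refine casimirOp_commute fun i hi => ?_
        simp only [Finset.mem_filter, Finset.mem_univ, true_and] at hi ⊢
        omega
      intro m m'
      rcases le_total m m' with hm | hm
      · exact hle m m' hm
      · exact (hle m' m hm).symm
    rintro _ (rfl | ⟨m, -, rfl⟩) _ (rfl | ⟨m', -, rfl⟩)
    · exact Commute.refl _
    · exact h.commute_right m'
    · exact (h.commute_right m).symm
    · exact key m m'

theorem isMaximallySuperintegrableWith : IsMaximallySuperintegrableWith hbar w H S := by
  constructor
  · refine isIndepObservables_range h.hbar_ne h.hasSymbol h.dense h.observable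
      id Function.injective_id ?_ ?_
    · rw [union_casimirs_eq_range, ← range_unit_elim, ← range_unit_elim]
      ext A
      simp [fullFamily, or_assoc]
    · simp
      omega
  · rintro A (rfl | rfl | hA)
    · exact Commute.refl _
    · exact h.commute_S
    · exact h.commute_casimirs A hA

end IsSystem

end Structure


/-! ### The sum of squares of the conserved vector -/

section LRLSum

variable {R : Type*} [Ring R] [Algebra ℂ R] {ι : Type*} [Fintype ι] [DecidableEq ι]

/-- Since `H` commutes with each component, the inner `H` in a square can be moved to the far right.
The sum becomes `p² Λ - 2k s Λ H + k² H²`, and `½ p² - k s H = a H - α` by the defining relation of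
`H`. -/
theorem IsCanonical.sum_sq_lrl_add {c : ℂ} {q p : ι → R} (h : IsCanonical c q p) {s H : R}
    (hs : ∀ k, Commute s (q k)) (hsp : ∀ k, ad s (p k) = -(c • (q k * s ^ 3)))
    (hsq : ∑ k, q k ^ 2 * s ^ 2 = 1) {a k α : ℂ}
    (hH : (a • 1 + k • s) * H = (1 / 2 : ℂ) • ∑ k, p k ^ 2 + α • (1 : R))
    (hcomm : ∀ i, Commute H (lrl q p i + k • (q i * s * H))) :
    ∑ i, (lrl q p i + k • (q i * s * H)) ^ 2 =
      (2 : ℂ) • (((1 / 2 : ℂ) • ∑ i, ∑ k, ang q p k i ^ 2 -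
        ((c * (Fintype.card ι - 1) / 2) ^ 2) • (1 : R)) * (a • H - α • 1)) + k ^ 2 • H ^ 2 := by
  have hA := h.sum_lrl_sq
  have hU := h.sum_lrl_unit hs hsp hsq
  set Λ := (1 / 2 : ℂ) • ∑ i, ∑ k, ang q p k i ^ 2 -
    ((c * (Fintype.card ι - 1) / 2) ^ 2) • (1 : R) with hΛ
  have hcΛ : ∀ B : R, (∀ i j, Commute B (ang q p i j)) → B * Λ = Λ * B := by
    intro B hB
    exact (((Commute.sum_right _ _ _ fun i _ => Commute.sum_right _ _ _ fun k _ =>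
      (hB k i).pow_right 2).smul_right _).sub_right ((Commute.one_right B).smul_right _)).eq
  have e1 : ∀ i, (lrl q p i + k • (q i * s * H)) ^ 2 = lrl q p i ^ 2 +
      k • ((lrl q p i * (q i * s) + q i * s * lrl q p i) * H) +
        k ^ 2 • (q i ^ 2 * s ^ 2 * H ^ 2) := by
    intro i
    have hq2 : q i ^ 2 * s ^ 2 = q i * s * (q i * s) := by
      rw [mul_assoc (q i) s, ← mul_assoc s, (hs i).eq]
      noncomm_ring
    calc (lrl q p i + k • (q i * s * H)) ^ 2
        = lrl q p i * (lrl q p i + k • (q i * s * H)) +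
          k • (q i * s * (H * (lrl q p i + k • (q i * s * H)))) := by
            rw [pow_two, add_mul, smul_mul_assoc]; simp only [mul_assoc]
      _ = _ := by
            rw [(hcomm i).eq, hq2]
            simp only [mul_add, add_mul, mul_smul_comm, smul_mul_assoc, smul_add, smul_smul,
              mul_assoc, pow_two]
            abel
  have e3 : ∑ i, q i ^ 2 * s ^ 2 * H ^ 2 = H ^ 2 := by rw [← Finset.sum_mul, hsq, one_mul]
  have e4 : ∑ i, (lrl q p i * (q i * s) + q i * s * lrl q p i) * H = -(2 : ℂ) • (s * Λ) * H := by
    rw [← Finset.sum_mul, hU]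
  simp only [e1]
  rw [Finset.sum_add_distrib, Finset.sum_add_distrib, ← Finset.smul_sum, ← Finset.smul_sum, e3, e4,
    hA, hcΛ s (h.inv_comm_ang hs hsp),
    hcΛ (∑ k, p k ^ 2) fun i j => (h.ang_comm_sum_p_sq i j).symm]
  have e2 : a • H - α • (1 : R) = (1 / 2 : ℂ) • ∑ k, p k ^ 2 - k • (s * H) := by
    rw [add_mul, smul_mul_assoc, smul_mul_assoc, one_mul] at hH
    rw [sub_eq_sub_iff_add_eq_add, hH]
  rw [e2]
  simp only [mul_sub, mul_smul_comm, smul_mul_assoc, mul_assoc, smul_sub, smul_smul, neg_mul,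
    neg_smul]
  norm_num
  module

end LRLSum

/-! ### Hamiltonians `W⁻¹ (½ p̂² + α) - β` -/

section Conformal

variable {N : ℕ} {Ω : Opens (E N)} {hbar α : ℝ}

/-- `½ p̂² + α`. -/
noncomputable def freeHam (Ω : Opens (E N)) (hbar α : ℝ) : Op Ω :=
  (1 / 2 : ℂ) • momSq Ω hbar + (α : ℂ) • 1

theorem isFormalAdjoint_freeHam :
    IsFormalAdjoint (freeHam Ω hbar α) (freeHam Ω hbar α) := by
  have := ((IsFormalAdjoint.momSq (Ω := Ω) hbar).ofReal_smul (1 / 2)).add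
    (IsFormalAdjoint.one.ofReal_smul α)
  push_cast at this
  exact this

theorem commute_freeHam {A : Op Ω} (h : Commute (momSq Ω hbar) A) :
    Commute (freeHam Ω hbar α) A :=
  (h.smul_left _).add_left ((Commute.one_left A).smul_left _)

theorem commute_momSq_angMom (i j : Fin N) : Commute (momSq Ω hbar) (angMom Ω hbar i j) :=
  ((isCanonical_op hbar).ang_comm_sum_p_sq i j).symm

theorem ad_freeHam (A : Op Ω) : ad (freeHam Ω hbar α) A = (1 / 2 : ℂ) • ad (momSq Ω hbar) A := by
  rw [freeHam, add_ad, smul_ad, smul_ad, ad_eq_zero_iff.2 (Commute.one_left A), smul_zero, add_zero]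

variable {w wi : E N → ℝ} {hw : ContDiffOn ℝ ∞ w Ω} {hwi : ContDiffOn ℝ ∞ wi Ω}

theorem commute_conformal_angMom (hinv : ∀ x ∈ Ω, wi x * w x = 1)
    (hrad : ∀ i j, Commute (mulOp Ω w hw) (angMom Ω hbar i j)) (i j : Fin N) :
    Commute (mulOp Ω wi hwi * freeHam Ω hbar α) (angMom Ω hbar i j) := by
  have h1 : mulOp Ω wi hwi * mulOp Ω w hw = 1 := mulOp_mul_eq_one _ _ _ _ hinv
  have h2 : mulOp Ω w hw * mulOp Ω wi hwi = 1 := by rw [(mulOp_comm _ _ _ _).eq, h1]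
  have h3 : Commute (mulOp Ω wi hwi) (angMom Ω hbar i j) := by
    have e := (hrad i j).eq
    calc mulOp Ω wi hwi * angMom Ω hbar i j
        = mulOp Ω wi hwi * (angMom Ω hbar i j * mulOp Ω w hw) * mulOp Ω wi hwi := by
          rw [mul_assoc, mul_assoc, h2, mul_one]
      _ = angMom Ω hbar i j * mulOp Ω wi hwi := by rw [← e, ← mul_assoc, h1, one_mul]
  exact h3.mul_left (commute_freeHam (commute_momSq_angMom i j))

theorem mulOp_mul_conformal (hinv : ∀ x ∈ Ω, wi x * w x = 1) :
    mulOp Ω w hw * (mulOp Ω wi hwi * freeHam Ω hbar α) = freeHam Ω hbar α := by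
  rw [← mul_assoc, (mulOp_comm _ _ _ _).eq, mulOp_mul_eq_one _ _ _ _ hinv, one_mul]

theorem conformal_adjoint_mul (hinv : ∀ x ∈ Ω, wi x * w x = 1) :
    freeHam Ω hbar α * mulOp Ω wi hwi * mulOp Ω w hw = freeHam Ω hbar α := by
  rw [mul_assoc, mulOp_mul_eq_one _ _ _ _ hinv, mul_one]

theorem isObservable_conformal (hw : ContDiffOn ℝ ∞ w Ω) (hinv : ∀ x ∈ Ω, wi x * w x = 1) (β : ℝ) :
    IsObservable w (mulOp Ω wi hwi * freeHam Ω hbar α - (β : ℂ) • 1) := by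
  refine (((IsFormalAdjoint.mulOp wi hwi).mul isFormalAdjoint_freeHam).sub
    (IsFormalAdjoint.one.ofReal_smul β)).isObservable w hw ?_
  rw [sub_mul, mul_sub, conformal_adjoint_mul hinv, mulOp_mul_conformal hinv]
  simp

theorem isObservable_add_conformal (hinv : ∀ x ∈ Ω, wi x * w x = 1) {B u : Op Ω} {k : ℝ}
    (hB : IsFormalAdjoint B B) (hu : IsFormalAdjoint u u) (huw : Commute u (mulOp Ω w hw))
    (hk : (k : ℂ) • ad (freeHam Ω hbar α) u = ad (mulOp Ω w hw) B) :
    IsObservable w (B + (k : ℂ) • (u * (mulOp Ω wi hwi * freeHam Ω hbar α))) :=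
  (hB.add ((hu.mul ((IsFormalAdjoint.mulOp wi hwi).mul isFormalAdjoint_freeHam)).ofReal_smul
    k)).isObservable w hw (intertwine_of_conformal (mulOp_mul_conformal hinv)
      (conformal_adjoint_mul hinv) huw hk)

theorem commute_add_conformal (hinv : ∀ x ∈ Ω, wi x * w x = 1) {B u : Op Ω} {k : ℝ}
    (hB : Commute (freeHam Ω hbar α) B) (huw : Commute u (mulOp Ω w hw))
    (hk : (k : ℂ) • ad (freeHam Ω hbar α) u = ad (mulOp Ω w hw) B) (β : ℝ) :
    Commute (mulOp Ω wi hwi * freeHam Ω hbar α - (β : ℂ) • 1)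
      (B + (k : ℂ) • (u * (mulOp Ω wi hwi * freeHam Ω hbar α))) :=
  (commute_of_conformal (mulOp_mul_eq_one _ _ hwi hw hinv) (mulOp_mul_conformal hinv) hB huw
    hk).sub_left ((Commute.one_left _).smul_left _)

theorem hasSymbol_conformal (β : ℝ) :
    HasSymbol hbar (mulOp Ω wi hwi * freeHam Ω hbar α - (β : ℂ) • 1)
      fun x ξ => wi x * (1 / 2 * ‖ξ‖ ^ 2) := by
  have h := (((hasSymbol_momSq (Ω := Ω) (hbar := hbar)).smul (1 / 2)).add
    (HasSymbol.smul_one (α : ℂ))).mulOp_mul wi hwi |>.add (HasSymbol.smul_one (-(β : ℂ)))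
  have h2 := h.congr (b := fun x ξ => wi x * (1 / 2 * ‖ξ‖ ^ 2)) fun x _ ξ => by ring
  push_cast at h2
  rw [sub_eq_add_neg, ← neg_smul]
  exact h2

end Conformal

/-! ### Weights `c + k q²` and the Fradkin tensor -/

section Quadratic

variable {N : ℕ} {Ω : Opens (E N)} {hbar α : ℝ} {w wi : E N → ℝ} {hw : ContDiffOn ℝ ∞ w Ω}
  {hwi : ContDiffOn ℝ ∞ wi Ω} {c k : ℝ}

theorem mulOp_eq_quadratic (h : ∀ x ∈ Ω, w x = c + k * ‖x‖ ^ 2) :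
    mulOp Ω w hw = (c : ℂ) • 1 + (k : ℂ) • ∑ i, posOp Ω i ^ 2 := by
  refine op_ext fun f x hx => ?_
  rw [mulOp_apply, h x hx, op_add_apply, op_smul_apply, op_smul_apply, op_sum_apply]
  have e : ∀ i, (posOp Ω i ^ 2) f x = ((x i ^ 2 : ℝ) : ℂ) * f x := fun i => by
    rw [pow_two, op_mul_apply, posOp_apply, posOp_apply]; push_cast; ring
  simp only [e]
  rw [← Finset.sum_mul, ← Complex.ofReal_sum, ← EuclideanSpace.real_norm_sq_eq]
  push_cast
  change _ = (c : ℂ) * f x + _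
  ring

variable (hW : mulOp Ω w hw = (c : ℂ) • 1 + (k : ℂ) • ∑ i, posOp Ω i ^ 2)
include hW

theorem quadratic_radial (i j : Fin N) : Commute (mulOp Ω w hw) (angMom Ω hbar i j) := by
  rw [hW]
  exact ((Commute.one_left _).smul_left _).add_left
    (((isCanonical_op hbar).ang_comm_sum_q_sq i j).symm.smul_left _)

/-- The factor `-2k` meets the `½` of `½ p²`, and the sign is that of exchanging `q²` and `p_i p_j`
in the commutator. -/
theorem quadratic_ad (i j : Fin N) :
    ((-2 * k : ℝ) : ℂ) • ad (freeHam Ω hbar α) (posOp Ω i * posOp Ω j) =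
      ad (mulOp Ω w hw) (momOp Ω hbar i * momOp Ω hbar j) := by
  rw [hW, add_ad, smul_ad, smul_ad, ad_eq_zero_iff.2 (Commute.one_left (momOp Ω hbar i * _)), smul_zero,
    zero_add, ← ad_skew (∑ i, posOp Ω i ^ 2), (isCanonical_op hbar).ad_p_mul_p_sum_q_sq, ad_freeHam, momSq]
  push_cast
  module

/-- The trace is `p² - 2k q² H`, where `p² = 2 (W H - α)` and `k q² = W - c`. -/
theorem sum_fradkin (hinv : ∀ x ∈ Ω, wi x * w x = 1) :
    ∑ i, (momOp Ω hbar i * momOp Ω hbar i + ((-2 * k : ℝ) : ℂ) • (posOp Ω i * posOp Ω i *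
      (mulOp Ω wi hwi * freeHam Ω hbar α))) =
      (2 * c : ℂ) • (mulOp Ω wi hwi * freeHam Ω hbar α) - (2 * α : ℂ) • 1 := by
  have h := mulOp_mul_conformal (hw := hw) (hwi := hwi) (hbar := hbar) (α := α) hinv
  rw [hW, add_mul, smul_mul_assoc, smul_mul_assoc, one_mul] at h
  generalize mulOp Ω wi hwi * freeHam Ω hbar α = H at h ⊢
  rw [Finset.sum_add_distrib, ← Finset.smul_sum, ← Finset.sum_mul]
  simp only [← pow_two]
  have h2 : ∑ i, momOp Ω hbar i ^ 2 = (2 : ℂ) • freeHam Ω hbar α - (2 * α : ℂ) • 1 := by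
    rw [freeHam, momSq]; module
  rw [h2, ← h]
  push_cast
  module

end Quadratic

section QuadraticSystem

variable {n : ℕ} {Ω : Opens (E (n + 2))} {hbar α c k β : ℝ} {W : ℝ → ℝ}
  {hw : ContDiffOn ℝ ∞ (fun x : E (n + 2) => W ‖x‖) Ω}
  {hwi : ContDiffOn ℝ ∞ (fun x : E (n + 2) => (W ‖x‖)⁻¹) Ω}

theorem isFormalAdjoint_pos_mul_pos {N : ℕ} {Ω : Opens (E N)} (i j : Fin N) :
    IsFormalAdjoint (posOp Ω i * posOp Ω j) (posOp Ω i * posOp Ω j) := by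
  have := (IsFormalAdjoint.posOp (Ω := Ω) i).mul (IsFormalAdjoint.posOp j)
  rwa [((isCanonical_op (Ω := Ω) 1).q_comm j i).eq] at this

theorem isFormalAdjoint_mom_mul_mom {N : ℕ} {Ω : Opens (E N)} (hbar : ℝ) (i j : Fin N) :
    IsFormalAdjoint (momOp Ω hbar i * momOp Ω hbar j) (momOp Ω hbar i * momOp Ω hbar j) := by
  have := (IsFormalAdjoint.momOp (Ω := Ω) hbar i).mul (IsFormalAdjoint.momOp hbar j)
  rwa [(momOp_comm hbar j i).eq] at this

theorem posOp_mul_comm {N : ℕ} {Ω : Opens (E N)} {w : E N → ℝ} {hw : ContDiffOn ℝ ∞ w Ω}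
    (i j : Fin N) : Commute (posOp Ω i * posOp Ω j) (mulOp Ω w hw) :=
  (mulOp_comm _ _ _ _).mul_left (mulOp_comm _ _ _ _)

theorem commute_freeHam_mom_mul_mom {N : ℕ} {Ω : Opens (E N)} (i j : Fin N) :
    Commute (freeHam Ω hbar α) (momOp Ω hbar i * momOp Ω hbar j) :=
  commute_freeHam <| Commute.sum_left _ _ _ fun _ _ =>
    ((momOp_comm hbar _ i).mul_right (momOp_comm hbar _ j)).pow_left 2

theorem quadratic_isSystem (hw : ContDiffOn ℝ ∞ (fun x : E (n + 2) => W ‖x‖) Ω)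
    (hh : hbar ≠ 0) (hne : ∀ x ∈ Ω, W ‖x‖ ≠ 0)
    (hW : ∀ x ∈ Ω, W ‖x‖ = c + k * ‖x‖ ^ 2)
    (hinf : {r : ℝ | 0 < r ∧ 0 < W r ∧ ∀ x : E (n + 2), ‖x‖ = r → x ∈ Ω}.Infinite)
    (i : Fin (n + 2)) :
    IsSystem hbar (fun x : E (n + 2) => W ‖x‖) (mulOp Ω _ hwi * freeHam Ω hbar α - (β : ℂ) • 1)
      (momOp Ω hbar i * momOp Ω hbar i + ((-2 * k : ℝ) : ℂ) •
        (posOp Ω i * posOp Ω i * (mulOp Ω _ hwi * freeHam Ω hbar α)))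
      (fun x ξ => (W ‖x‖)⁻¹ * (1 / 2 * ‖ξ‖ ^ 2))
      (fun x ξ => ξ i * ξ i + (-2 * k) * (x i * (x i * ((W ‖x‖)⁻¹ * (1 / 2 * ‖ξ‖ ^ 2))))) := by
  have hWop := mulOp_eq_quadratic (hw := hw) hW
  have hinv : ∀ x ∈ Ω, (W ‖x‖)⁻¹ * W ‖x‖ = 1 := fun x hx => inv_mul_cancel₀ (hne x hx)
  have hrad := quadratic_radial (hbar := hbar) hWop
  refine ⟨hh, hasSymbol_conformal β, ?_, ?_, ?_, ?_, ?_, ?_, ?_⟩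
  · refine ((hasSymbolOne_momOp i).mul (hasSymbolOne_momOp i)).add (HasSymbol.smul _ ?_)
    rw [mul_assoc]
    have h0 := hasSymbol_conformal (Ω := Ω) (hbar := hbar) (α := α) (hwi := hwi) 0
    rw [Complex.ofReal_zero, zero_smul, sub_zero] at h0
    exact (h0.mulOp_mul _ _).mulOp_mul _ _
  -- On `x_i = 0` the symbol of the Fradkin component reduces to `ξ_i²`.
  · refine zariskiDense_fullSymbol_fradkin i hinf (fun x ξ => ?_) (fun x ξ hx => ?_)
    · rw [← div_div, div_eq_inv_mul]; ring
    · rw [hx]; ring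
  · intro a b
    exact (commute_conformal_angMom hinv hrad a b).sub_left ((Commute.one_left _).smul_left _)
  · exact isObservable_conformal (hw := hw) hinv β
  · exact isObservable_add_conformal (hw := hw) hinv (isFormalAdjoint_mom_mul_mom hbar i i)
      (isFormalAdjoint_pos_mul_pos i i) (posOp_mul_comm i i) (quadratic_ad hWop i i)
  · exact fun s => isObservable_casimirOp _ hw hrad s
  · exact commute_add_conformal (hw := hw) hinv (commute_freeHam_mom_mul_mom i i)
      (posOp_mul_comm i i) (quadratic_ad hWop i i) β

end QuadraticSystem

/-! ### Weights `c + k / |q|` and the Laplace-Runge-Lenz vector -/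

section Inverse

variable {N : ℕ} {Ω : Opens (E N)} {hbar α : ℝ}

theorem contDiffOn_inv_norm (h : ∀ x ∈ Ω, x ≠ 0) : ContDiffOn ℝ ∞ (fun x : E N => ‖x‖⁻¹) Ω :=
  (contDiffOn_norm_of_ne h).inv fun x hx => norm_ne_zero_iff.2 (h x hx)

/-- Multiplication by `1 / |q|`. -/
noncomputable def invNormOp (Ω : Opens (E N)) (h : ∀ x ∈ Ω, x ≠ 0) : Op Ω :=
  mulOp Ω (fun x => ‖x‖⁻¹) (contDiffOn_inv_norm h)

theorem invNormOp_apply (h : ∀ x ∈ Ω, x ≠ 0) (f : 𝓓(Ω, ℂ)) (x : E N) :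
    invNormOp Ω h f x = ((‖x‖⁻¹ : ℝ) : ℂ) * f x := rfl

/-- The derivative of the norm is extracted from that of its square. -/
theorem fderiv_inv_norm {x : E N} (hx : x ≠ 0) (k : Fin N) :
    fderiv ℝ (fun x : E N => ‖x‖⁻¹) x (EuclideanSpace.single k 1) = -(x k * ‖x‖⁻¹ ^ 3) := by
  have hn : ‖x‖ ≠ 0 := norm_ne_zero_iff.2 hx
  have hd : HasFDerivAt (fun x : E N => ‖x‖) (fderiv ℝ (fun x : E N => ‖x‖) x) x :=
    ((contDiffAt_norm ℝ hx (n := ∞)).differentiableAt (by simp)).hasFDerivAt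
  have h1 : fderiv ℝ (fun x : E N => ‖x‖ ^ 2) x (EuclideanSpace.single k 1) = 2 * x k := by
    rw [fderiv_norm_sq_apply]
    simp [EuclideanSpace.inner_single_right]
  rw [(hd.pow 2).fderiv] at h1
  have h2 : HasFDerivAt (fun x : E N => ‖x‖⁻¹) (-(‖x‖ ^ 2)⁻¹ • fderiv ℝ (fun x : E N => ‖x‖) x) x :=
    (hasDerivAt_inv hn).comp_hasFDerivAt x hd
  rw [h2.fderiv]
  simp at h1 ⊢
  field_simp
  linarith

variable (h : ∀ x ∈ Ω, x ≠ 0)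

theorem invNormOp_commute (k : Fin N) : Commute (invNormOp Ω h) (posOp Ω k) :=
  mulOp_comm _ _ _ _

theorem ad_invNormOp_momOp (k : Fin N) :
    ad (invNormOp Ω h) (momOp Ω hbar k) =
      -((Complex.I * hbar) • (posOp Ω k * invNormOp Ω h ^ 3)) := by
  have hψ : ContDiffOn ℝ ∞ (fun x : E N => -(x k * ‖x‖⁻¹ ^ 3)) Ω :=
    ((EuclideanSpace.proj (𝕜 := ℝ) k).contDiff.contDiffOn.mul
      ((contDiffOn_inv_norm h).pow 3)).neg
  rw [invNormOp, ad_mulOp_momOp hbar k _ _ _ hψ fun x hx => fderiv_inv_norm (h x hx) k, ← smul_neg]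
  congr 1
  refine op_ext fun f x _ => ?_
  change _ = -((x k : ℂ) * (((‖x‖⁻¹ : ℝ) : ℂ) * (((‖x‖⁻¹ : ℝ) : ℂ) * (((‖x‖⁻¹ : ℝ) : ℂ) * f x))))
  rw [mulOp_apply]
  push_cast
  ring

theorem sum_posOp_sq_mul_invNormOp_sq : ∑ k, posOp Ω k ^ 2 * invNormOp Ω h ^ 2 = 1 := by
  refine op_ext fun f x hx => ?_
  have hn : ‖x‖ ≠ 0 := norm_ne_zero_iff.2 (h x hx)
  rw [op_sum_apply]
  simp only [pow_two, op_mul_apply, posOp_apply, invNormOp_apply]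
  have : ∀ k, ((x k : ℂ) * (x k * (((‖x‖⁻¹ : ℝ) : ℂ) * (((‖x‖⁻¹ : ℝ) : ℂ) * f x)))) =
      ((x k ^ 2 : ℝ) : ℂ) * (((‖x‖⁻¹ ^ 2 : ℝ) : ℂ) * f x) := fun k => by push_cast; ring
  simp only [this]
  rw [← Finset.sum_mul, ← Complex.ofReal_sum, ← EuclideanSpace.real_norm_sq_eq, ← mul_assoc,
    ← Complex.ofReal_mul, ← mul_pow, mul_inv_cancel₀ hn]
  simp

theorem unitOp_eq (i : Fin N) : unitOp Ω h i = posOp Ω i * invNormOp Ω h := by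
  refine op_ext fun f x _ => ?_
  change ((x i / ‖x‖ : ℝ) : ℂ) * f x = (x i : ℂ) * (((‖x‖⁻¹ : ℝ) : ℂ) * f x)
  rw [div_eq_mul_inv]
  push_cast
  ring

theorem isFormalAdjoint_unitOp (i : Fin N) : IsFormalAdjoint (unitOp Ω h i) (unitOp Ω h i) :=
  IsFormalAdjoint.mulOp _ _

variable {w wi : E N → ℝ} {hw : ContDiffOn ℝ ∞ w Ω} {hwi : ContDiffOn ℝ ∞ wi Ω} {c k : ℝ}

theorem mulOp_eq_inverse (hW : ∀ x ∈ Ω, w x = c + k * ‖x‖⁻¹) :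
    mulOp Ω w hw = (c : ℂ) • 1 + (k : ℂ) • invNormOp Ω h := by
  refine op_ext fun f x hx => ?_
  rw [mulOp_apply, hW x hx, op_add_apply, op_smul_apply, op_smul_apply, invNormOp_apply]
  push_cast
  change _ = (c : ℂ) * f x + _
  ring

theorem commute_freeHam_lrlSeed (i : Fin N) :
    Commute (freeHam Ω hbar α) (lrlSeed Ω hbar i) :=
  commute_freeHam ((isCanonical_op hbar).sum_p_sq_comm_lrl i)

variable {h} (hW : mulOp Ω w hw = (c : ℂ) • 1 + (k : ℂ) • invNormOp Ω h)
include hW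

theorem inverse_radial (i j : Fin N) : Commute (mulOp Ω w hw) (angMom Ω hbar i j) := by
  rw [hW]
  exact ((Commute.one_left _).smul_left _).add_left
    (((isCanonical_op hbar).inv_comm_ang (invNormOp_commute h) (ad_invNormOp_momOp h)
      i j).smul_left _)

theorem inverse_ad (i : Fin N) :
    (k : ℂ) • ad (freeHam Ω hbar α) (unitOp Ω h i) = ad (mulOp Ω w hw) (lrlSeed Ω hbar i) := by
  rw [hW, add_ad, smul_ad, smul_ad, ad_eq_zero_iff.2 (Commute.one_left (lrlSeed Ω hbar i)), smul_zero,
    zero_add, lrlSeed_eq_lrl, (isCanonical_op hbar).ad_inv_lrl (invNormOp_commute h) (ad_invNormOp_momOp h)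
      (sum_posOp_sq_mul_invNormOp_sq h), ad_freeHam, unitOp_eq]
  rfl

theorem sum_sq_lrl_conformal (hinv : ∀ x ∈ Ω, wi x * w x = 1) :
    ∑ i, (lrlSeed Ω hbar i + (k : ℂ) • (unitOp Ω h i * (mulOp Ω wi hwi * freeHam Ω hbar α))) ^ 2 =
      (2 : ℂ) • (totalAngMomSq Ω hbar *
        ((c : ℂ) • (mulOp Ω wi hwi * freeHam Ω hbar α) - (α : ℂ) • 1)) +
      ((k : ℂ) ^ 2) • (mulOp Ω wi hwi * freeHam Ω hbar α) ^ 2 +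
      (1 / 2 * ((N : ℂ) - 1) ^ 2 * (hbar : ℂ) ^ 2) •
        ((c : ℂ) • (mulOp Ω wi hwi * freeHam Ω hbar α) - (α : ℂ) • 1) := by
  have hH := mulOp_mul_conformal (hw := hw) (hwi := hwi) (hbar := hbar) (α := α) hinv
  have hcomm := fun i => commute_add_conformal (hw := hw) (hwi := hwi) hinv
    (commute_freeHam_lrlSeed (hbar := hbar) (α := α) i)
    (u := unitOp Ω h i) (mulOp_comm _ _ _ _) (inverse_ad hW i) 0
  simp only [Complex.ofReal_zero, zero_smul, sub_zero, unitOp_eq, lrlSeed_eq_lrl] at hcomm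
  generalize mulOp Ω wi hwi * freeHam Ω hbar α = H at hH hcomm ⊢
  simp only [unitOp_eq, lrlSeed_eq_lrl]
  rw [hW] at hH
  rw [(isCanonical_op hbar).sum_sq_lrl_add (invNormOp_commute h) (ad_invNormOp_momOp h)
    (sum_posOp_sq_mul_invNormOp_sq h) hH hcomm, totalAngMomSq_eq, casimirOp]
  have e : ∑ i, ∑ k, ang (posOp Ω) (momOp Ω hbar) k i ^ 2 = ∑ i, ∑ j, angMom Ω hbar i j ^ 2 :=
    Finset.sum_comm
  -- With `c = iħ` the constant subtracted in `Λ` is negative; this is the source of the quantum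
  -- correction `½ (N - 1)² ħ²`.
  have hI : (Complex.I * hbar * (Fintype.card (Fin N) - 1) / 2) ^ 2 =
      -(1 / 2 * (1 / 2 * ((N : ℂ) - 1) ^ 2 * (hbar : ℂ) ^ 2)) := by
    rw [Fintype.card_fin]
    linear_combination (((N : ℂ) - 1) ^ 2 * (hbar : ℂ) ^ 2 / 4) * Complex.I_sq
  rw [e, hI, sub_mul, smul_mul_assoc _ (1 : Op Ω), one_mul]
  module

end Inverse

section InverseSystem

variable {n : ℕ} {Ω : Opens (E (n + 2))} {hbar α c k : ℝ} {W : ℝ → ℝ} {h : ∀ x ∈ Ω, x ≠ 0}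
  {hw : ContDiffOn ℝ ∞ (fun x : E (n + 2) => W ‖x‖) Ω}
  {hwi : ContDiffOn ℝ ∞ (fun x : E (n + 2) => (W ‖x‖)⁻¹) Ω}

theorem inverse_isSystem (hw : ContDiffOn ℝ ∞ (fun x : E (n + 2) => W ‖x‖) Ω)
    (hh : hbar ≠ 0) (hne : ∀ x ∈ Ω, W ‖x‖ ≠ 0)
    (hW : ∀ r, 0 < r → W r = c + k * r⁻¹)
    (hinf : {r : ℝ | 0 < r ∧ 0 < W r ∧ ∀ x : E (n + 2), ‖x‖ = r → x ∈ Ω}.Infinite)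
    (i : Fin (n + 2)) :
    IsSystem hbar (fun x : E (n + 2) => W ‖x‖) (mulOp Ω _ hwi * freeHam Ω hbar α)
      (lrlSeed Ω hbar i + (k : ℂ) • (unitOp Ω h i * (mulOp Ω _ hwi * freeHam Ω hbar α)))
      (fun x ξ => (W ‖x‖)⁻¹ * (1 / 2 * ‖ξ‖ ^ 2))
      (fun x ξ => ∑ l, ξ l * area x ξ l i +
        k * (x i / ‖x‖ * ((W ‖x‖)⁻¹ * (1 / 2 * ‖ξ‖ ^ 2)))) := by
  have hWop := mulOp_eq_inverse (hw := hw) h fun x hx => hW _ (norm_pos_iff.2 (h x hx))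
  have hinv : ∀ x ∈ Ω, (W ‖x‖)⁻¹ * W ‖x‖ = 1 := fun x hx => inv_mul_cancel₀ (hne x hx)
  have hrad := inverse_radial (hbar := hbar) hWop
  have h0 := hasSymbol_conformal (Ω := Ω) (hbar := hbar) (α := α) (hwi := hwi) 0
  have h1 := isObservable_conformal (hw := hw) (hwi := hwi) (hbar := hbar) (α := α) hinv 0
  have h2 := commute_add_conformal (hw := hw) (hwi := hwi) hinv
    (commute_freeHam_lrlSeed (hbar := hbar) (α := α) i) (u := unitOp Ω h i)
    (mulOp_comm _ _ _ _) (inverse_ad hWop i) 0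
  rw [Complex.ofReal_zero, zero_smul, sub_zero] at h0 h1 h2
  refine ⟨hh, h0, ?_, ?_, commute_conformal_angMom hinv hrad, h1, ?_, ?_, h2⟩
  · exact (hasSymbol_lrlSeed i).add ((h0.mulOp_mul _ _).smul k)
  -- On `x_i = 0` the term with `x_i / ‖x‖` drops out and the seed has symbol `⟨x, ξ⟩ ξ_i`.
  · refine zariskiDense_fullSymbol_lrl i (a := c) (b := k) hinf (fun r hr => ?_) (fun x ξ => ?_)
      (fun x ξ hx => ?_)
    · rw [hW r hr]; field_simp
    · rw [← div_div, div_eq_inv_mul]; ring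
    · simp only [area, hx, zero_mul, sub_zero, zero_div, mul_zero, add_zero]
      rw [PiLp.inner_apply, Finset.sum_mul]
      refine Finset.sum_congr rfl fun l _ => ?_
      simp
      ring
  · exact isObservable_add_conformal (hw := hw) hinv (IsFormalAdjoint.lrlSeed hbar i)
      (isFormalAdjoint_unitOp h i) (mulOp_comm _ _ _ _) (inverse_ad hWop i)
  · exact fun s => isObservable_casimirOp _ hw hrad s

end InverseSystem


/-! ### The four systems -/

section Systems

variable {n : ℕ}

theorem add_mulOp_eq_conformal {N : ℕ} {Ω : Opens (E N)} {hbar α β : ℝ} {K V wi : E N → ℝ}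
    {hK : ContDiffOn ℝ ∞ K Ω} {hV : ContDiffOn ℝ ∞ V Ω} (hwi : ContDiffOn ℝ ∞ wi Ω)
    (h1 : ∀ x ∈ Ω, K x = wi x * (1 / 2)) (h2 : ∀ x ∈ Ω, V x = wi x * α - β) :
    mulOp Ω K hK * momSq Ω hbar + mulOp Ω V hV =
      mulOp Ω wi hwi * freeHam Ω hbar α - (β : ℂ) • 1 := by
  refine op_ext fun f x hx => ?_
  change (K x : ℂ) * momSq Ω hbar f x + (V x : ℂ) * f x =
    (wi x : ℂ) * ((1 / 2 : ℂ) * momSq Ω hbar f x + (α : ℂ) * f x) - (β : ℂ) * f x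
  rw [h1 x hx, h2 x hx]
  push_cast
  ring

theorem sub_mulOp {N : ℕ} {Ω : Opens (E N)} (A : Op Ω) (φ : E N → ℝ)
    (hφ : ContDiffOn ℝ ∞ φ Ω) : A - mulOp Ω φ hφ = A + mulOp Ω (fun x => -φ x) hφ.neg := by
  refine op_ext fun f x _ => ?_
  change A f x - (φ x : ℂ) * f x = A f x + ((-φ x : ℝ) : ℂ) * f x
  push_cast
  ring

theorem infinite_of_Ioi_subset {a : ℝ} {S : Set ℝ} (h : Set.Ioi a ⊆ S) : S.Infinite :=
  (Set.Ioi_infinite a).mono h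

/-! The curved Kepler-Coulomb system. -/

theorem contDiffOn_normSq_inv :
    ContDiffOn ℝ ∞ (fun x : E n => (‖x‖ ^ 2)⁻¹) (punctured n) :=
  (contDiffOn_normSq _).inv fun _ hx => pow_ne_zero 2 (norm_ne_zero_iff.2 hx)

theorem quantumKC_eq (hbar α : ℝ) : quantumKC (N := n) hbar α =
    mulOp _ _ contDiffOn_normSq_inv * freeHam _ hbar α := by
  have h := add_mulOp_eq_conformal (hbar := hbar) (α := α) (β := 0) (Ω := punctured n)
    (K := fun x => 1 / (2 * ‖x‖ ^ 2)) (V := fun x => α / ‖x‖ ^ 2)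
    (hK := contDiffOn_const.div (contDiffOn_const.mul (contDiffOn_normSq _))
        fun _ hx => mul_ne_zero two_ne_zero (pow_ne_zero 2 (norm_ne_zero_iff.2 hx)))
    (hV := contDiffOn_const.div (contDiffOn_normSq _)
        fun _ hx => pow_ne_zero 2 (norm_ne_zero_iff.2 hx))
    contDiffOn_normSq_inv
    (fun x _ => by rw [one_div, mul_inv]; ring) (fun x _ => by ring)
  rwa [Complex.ofReal_zero, zero_smul, sub_zero] at h

theorem fradkinKC_eq (hbar α : ℝ) (i j : Fin n) : fradkinKC hbar α i j =
    momOp _ hbar i * momOp _ hbar j + ((-2 * 1 : ℝ) : ℂ) •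
      (posOp _ i * posOp _ j * (mulOp _ _ contDiffOn_normSq_inv * freeHam _ hbar α)) := by
  rw [fradkinKC, quantumKC_eq]
  push_cast
  module

theorem isSystem_KC {hbar : ℝ} (hh : hbar ≠ 0) (α : ℝ) (i : Fin (n + 2)) :
    ∃ a b, IsSystem hbar weightKC (quantumKC (N := n + 2) hbar α) (fradkinKC hbar α i i) a b := by
  have h := quadratic_isSystem (Ω := punctured (n + 2)) (W := fun r => r ^ 2) (hbar := hbar)
    (α := α) (c := 0) (k := 1) (β := 0) (hwi := contDiffOn_normSq_inv) (contDiffOn_normSq _) hh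
    (fun x hx => pow_ne_zero 2 (norm_ne_zero_iff.2 hx)) (fun x _ => by ring)
    (infinite_of_Ioi_subset (a := 0) fun r (hr : 0 < r) => ⟨hr, by positivity,
      fun x hx => norm_pos_iff.1 (hx ▸ hr)⟩) i
  rw [← fradkinKC_eq, ← quantumKC_eq, Complex.ofReal_zero, zero_smul, sub_zero] at h
  exact ⟨_, _, h⟩

theorem fradkinKC_symmetry (hbar α : ℝ) (i j : Fin n) :
    IsObservable weightKC (fradkinKC hbar α i j) ∧
      Commute (quantumKC (N := n) hbar α) (fradkinKC hbar α i j) := by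
  have hinv : ∀ x ∈ punctured n, (‖x‖ ^ 2)⁻¹ * ‖x‖ ^ 2 = 1 := fun x hx =>
    inv_mul_cancel₀ (pow_ne_zero 2 (norm_ne_zero_iff.2 hx))
  have hW := mulOp_eq_quadratic (c := 0) (k := 1) (hw := contDiffOn_normSq (punctured n))
    fun x _ => by ring
  have h := commute_add_conformal (hw := contDiffOn_normSq (punctured n))
    (hwi := contDiffOn_normSq_inv) hinv (commute_freeHam_mom_mul_mom (hbar := hbar) (α := α) i j)
    (posOp_mul_comm i j) (quadratic_ad hW i j) 0
  rw [← fradkinKC_eq, ← quantumKC_eq, Complex.ofReal_zero, zero_smul, sub_zero] at h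
  refine ⟨?_, h⟩
  rw [fradkinKC_eq]
  exact isObservable_add_conformal (hw := contDiffOn_normSq (punctured n)) hinv
    (isFormalAdjoint_mom_mul_mom hbar i j) (isFormalAdjoint_pos_mul_pos i j) (posOp_mul_comm i j)
    (quadratic_ad hW i j)

theorem sum_fradkinKC (hbar α : ℝ) :
    ∑ i : Fin n, fradkinKC hbar α i i = (-2 * α : ℂ) • 1 := by
  have hinv : ∀ x ∈ punctured n, (‖x‖ ^ 2)⁻¹ * ‖x‖ ^ 2 = 1 := fun x hx =>
    inv_mul_cancel₀ (pow_ne_zero 2 (norm_ne_zero_iff.2 hx))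
  have hW := mulOp_eq_quadratic (c := 0) (k := 1) (hw := contDiffOn_normSq (punctured n))
    fun x _ => by ring
  simp only [fradkinKC_eq]
  rw [sum_fradkin hW hinv]
  push_cast
  module

theorem isSchrodingerQuantization_KC (hbar α : ℝ) :
    IsSchrodingerQuantization hbar (classicalKC α) (quantumKC (N := n) hbar α) :=
  ⟨_, _, _, _, fun q _ p => by rw [classicalKC]; ring, rfl⟩

/-! The Darboux III oscillator. -/

theorem contDiffOn_weightDarboux (lam : ℝ) :
    ContDiffOn ℝ ∞ (fun x : E n => 1 + lam * ‖x‖ ^ 2) (darbouxDomain n lam) :=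
  contDiffOn_const.add (contDiffOn_const.mul (contDiffOn_normSq _))

theorem contDiffOn_weightDarboux_inv (lam : ℝ) :
    ContDiffOn ℝ ∞ (fun x : E n => (1 + lam * ‖x‖ ^ 2)⁻¹) (darbouxDomain n lam) :=
  (contDiffOn_weightDarboux lam).inv fun _ hx => ne_of_gt hx

/-- The potential is `-λα q² / (1 + λ q²) = α / (1 + λ q²) - α`, so here the shift `β` is `α`. -/
theorem quantumDarboux_eq (hbar lam α : ℝ) : quantumDarboux (N := n) hbar lam α =
    mulOp _ _ (contDiffOn_weightDarboux_inv lam) * freeHam _ hbar α - (α : ℂ) • 1 := by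
  rw [quantumDarboux, sub_mulOp]
  refine add_mulOp_eq_conformal (contDiffOn_weightDarboux_inv lam) (fun x _ => ?_) fun x hx => ?_
  · rw [one_div, mul_inv]; ring
  · have hx' : 1 + lam * ‖x‖ ^ 2 ≠ 0 := ne_of_gt hx
    field_simp
    ring

theorem fradkinDarboux_eq (hbar lam α : ℝ) (i j : Fin n) : fradkinDarboux hbar lam α i j =
    momOp _ hbar i * momOp _ hbar j + ((-2 * lam : ℝ) : ℂ) • (posOp _ i * posOp _ j *
      (mulOp _ _ (contDiffOn_weightDarboux_inv lam) * freeHam _ hbar α)) := by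
  rw [fradkinDarboux, quantumDarboux_eq, sub_add_cancel]
  push_cast
  module

theorem isSystem_Darboux {hbar : ℝ} (hh : hbar ≠ 0) (lam α : ℝ) (i : Fin (n + 2)) :
    ∃ a b, IsSystem hbar (weightDarboux lam) (quantumDarboux (N := n + 2) hbar lam α)
      (fradkinDarboux hbar lam α i i) a b := by
  have h := quadratic_isSystem (Ω := darbouxDomain (n + 2) lam) (W := fun r => 1 + lam * r ^ 2)
    (hbar := hbar) (α := α) (c := 1) (k := lam) (β := α)
    (hwi := contDiffOn_weightDarboux_inv lam) (contDiffOn_weightDarboux lam) hh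
    (fun x hx => ne_of_gt hx) (fun x _ => rfl)
    -- Small radii are admissible for either sign of `λ`: below this bound `|λ| r² ≤ |λ| r < 1`.
    ((Set.Ioo_infinite (a := 0) (b := (1 + |lam|)⁻¹) (by positivity)).mono ?_) i
  · rw [← fradkinDarboux_eq, ← quantumDarboux_eq] at h
    exact ⟨_, _, h⟩
  · rintro r ⟨hr, hr1⟩
    have hpos : 0 < 1 + lam * r ^ 2 := by
      have hL : 0 < 1 + |lam| := by positivity
      have h1 : r * (1 + |lam|) < 1 := by
        have := mul_lt_mul_of_pos_right hr1 hL
        rwa [inv_mul_cancel₀ hL.ne'] at this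
      have h2 := neg_abs_le lam
      have h3 : r < 1 := by nlinarith [mul_nonneg hr.le (abs_nonneg lam)]
      have h4 : |lam| * r ^ 2 ≤ |lam| * r := by
        have : r ^ 2 ≤ r := by nlinarith
        exact mul_le_mul_of_nonneg_left this (abs_nonneg lam)
      nlinarith [mul_le_mul_of_nonneg_right h2 (sq_nonneg r)]
    refine ⟨hr, hpos, fun x hx => ?_⟩
    change 0 < 1 + lam * ‖x‖ ^ 2
    rwa [hx]

theorem fradkinDarboux_symmetry (hbar lam α : ℝ) (i j : Fin n) :
    IsObservable (weightDarboux lam) (fradkinDarboux hbar lam α i j) ∧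
      Commute (quantumDarboux (N := n) hbar lam α) (fradkinDarboux hbar lam α i j) := by
  have hinv : ∀ x ∈ darbouxDomain n lam, (1 + lam * ‖x‖ ^ 2)⁻¹ * (1 + lam * ‖x‖ ^ 2) = 1 :=
    fun x hx => inv_mul_cancel₀ (ne_of_gt hx)
  have hW := mulOp_eq_quadratic (c := 1) (k := lam) (hw := contDiffOn_weightDarboux (n := n) lam)
    fun x _ => rfl
  have h := commute_add_conformal (hw := contDiffOn_weightDarboux lam)
    (hwi := contDiffOn_weightDarboux_inv lam) hinv
    (commute_freeHam_mom_mul_mom (hbar := hbar) (α := α) i j)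
    (posOp_mul_comm i j) (quadratic_ad hW i j) α
  rw [← fradkinDarboux_eq, ← quantumDarboux_eq] at h
  refine ⟨?_, h⟩
  rw [fradkinDarboux_eq]
  exact isObservable_add_conformal (hw := contDiffOn_weightDarboux lam) hinv
    (isFormalAdjoint_mom_mul_mom hbar i j) (isFormalAdjoint_pos_mul_pos i j) (posOp_mul_comm i j)
    (quadratic_ad hW i j)

theorem sum_fradkinDarboux (hbar lam α : ℝ) :
    ∑ i : Fin n, fradkinDarboux hbar lam α i i = (2 : ℂ) • quantumDarboux hbar lam α := by
  have hinv : ∀ x ∈ darbouxDomain n lam, (1 + lam * ‖x‖ ^ 2)⁻¹ * (1 + lam * ‖x‖ ^ 2) = 1 :=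
    fun x hx => inv_mul_cancel₀ (ne_of_gt hx)
  have hW := mulOp_eq_quadratic (c := 1) (k := lam) (hw := contDiffOn_weightDarboux (n := n) lam)
    fun x _ => rfl
  simp only [fradkinDarboux_eq]
  rw [sum_fradkin hW hinv, quantumDarboux_eq]
  push_cast
  module

theorem isSchrodingerQuantization_Darboux (hbar lam α : ℝ) :
    IsSchrodingerQuantization hbar (classicalDarboux lam α)
      (quantumDarboux (N := n) hbar lam α) :=
  ⟨_, _, _, _, fun q _ p => by rw [classicalDarboux]; ring, sub_mulOp _ _ _⟩

/-! The curved spherical oscillator. -/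

theorem contDiffOn_weightO : ContDiffOn ℝ ∞ (fun x : E n => 1 / ‖x‖) (punctured n) :=
  contDiffOn_const.div (contDiffOn_norm_of_ne punctured_ne) fun _ hx => norm_ne_zero_iff.2 hx

theorem weightO_ne {x : E n} (hx : x ∈ punctured n) : 1 / ‖x‖ ≠ 0 :=
  one_div_ne_zero (norm_ne_zero_iff.2 hx)

theorem contDiffOn_weightO_inv : ContDiffOn ℝ ∞ (fun x : E n => (1 / ‖x‖)⁻¹) (punctured n) :=
  contDiffOn_weightO.inv fun _ hx => weightO_ne hx

theorem quantumO_eq (hbar α : ℝ) : quantumO (N := n) hbar α =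
    mulOp _ _ contDiffOn_weightO_inv * freeHam _ hbar α := by
  have h := add_mulOp_eq_conformal (hbar := hbar) (α := α) (β := 0) (Ω := punctured n)
    (K := fun x => 1 / 2 * ‖x‖) (V := fun x => α * ‖x‖)
    (hK := contDiffOn_const.mul (contDiffOn_norm_of_ne punctured_ne))
    (hV := contDiffOn_const.mul (contDiffOn_norm_of_ne punctured_ne))
    contDiffOn_weightO_inv (fun x _ => by rw [one_div ‖x‖, inv_inv]; ring)
    (fun x _ => by rw [one_div, inv_inv]; ring)
  rwa [Complex.ofReal_zero, zero_smul, sub_zero] at h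

theorem lrlO_eq (hbar α : ℝ) (i : Fin n) : lrlO hbar α i = lrlSeed _ hbar i +
    ((1 : ℝ) : ℂ) • (unitOp _ punctured_ne i *
      (mulOp _ _ contDiffOn_weightO_inv * freeHam _ hbar α)) := by
  rw [lrlO, quantumO_eq, Complex.ofReal_one, one_smul]

theorem isSystem_O {hbar : ℝ} (hh : hbar ≠ 0) (α : ℝ) (i : Fin (n + 2)) :
    ∃ a b, IsSystem hbar weightO (quantumO (N := n + 2) hbar α) (lrlO hbar α i) a b := by
  have h := inverse_isSystem (Ω := punctured (n + 2)) (W := fun r => 1 / r) (hbar := hbar)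
    (α := α) (c := 0) (k := 1) (h := punctured_ne) (hwi := contDiffOn_weightO_inv)
    contDiffOn_weightO hh (fun x hx => weightO_ne hx) (fun r _ => by ring)
    (infinite_of_Ioi_subset (a := 0) fun r (hr : 0 < r) => ⟨hr, one_div_pos.2 hr,
      fun x hx => norm_pos_iff.1 (hx ▸ hr)⟩) i
  rw [← lrlO_eq, ← quantumO_eq] at h
  exact ⟨_, _, h⟩

theorem sum_lrlO_sq (hbar α : ℝ) : ∑ i : Fin n, lrlO hbar α i ^ 2 =
    quantumO hbar α ^ 2 - (2 * α : ℂ) • totalAngMomSq _ hbar -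
      (1 / 2 * ((n : ℂ) - 1) ^ 2 * (hbar : ℂ) ^ 2 * (α : ℂ)) • 1 := by
  have hW := mulOp_eq_inverse (c := 0) (k := 1) (hw := contDiffOn_weightO (n := n)) punctured_ne
    fun x _ => by ring
  simp only [lrlO_eq]
  rw [sum_sq_lrl_conformal hW fun x hx => inv_mul_cancel₀ (weightO_ne hx), ← quantumO_eq]
  simp only [Complex.ofReal_zero, zero_smul, zero_sub, mul_neg, mul_smul_comm, mul_one,
    Complex.ofReal_one]
  module

theorem isSchrodingerQuantization_O (hbar α : ℝ) :
    IsSchrodingerQuantization hbar (classicalO α) (quantumO (N := n) hbar α) :=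
  ⟨_, _, _, _, fun q _ p => by rw [classicalO], rfl⟩

/-! The Taub-NUT oscillator. -/

theorem contDiffOn_weightTaubNUT (eta : ℝ) :
    ContDiffOn ℝ ∞ (fun x : E n => (eta + ‖x‖) / ‖x‖) (taubNUTDomain n eta) :=
  (contDiffOn_const.add (contDiffOn_norm_of_ne (taubNUT_ne eta))).div
    (contDiffOn_norm_of_ne (taubNUT_ne eta)) fun x hx => norm_ne_zero_iff.2 (taubNUT_ne eta x hx)

theorem weightTaubNUT_ne (eta : ℝ) {x : E n} (hx : x ∈ taubNUTDomain n eta) :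
    (eta + ‖x‖) / ‖x‖ ≠ 0 :=
  div_ne_zero (taubNUT_pos eta x hx).ne' (norm_ne_zero_iff.2 (taubNUT_ne eta x hx))

theorem contDiffOn_weightTaubNUT_inv (eta : ℝ) :
    ContDiffOn ℝ ∞ (fun x : E n => ((eta + ‖x‖) / ‖x‖)⁻¹) (taubNUTDomain n eta) :=
  (contDiffOn_weightTaubNUT eta).inv fun _ hx => weightTaubNUT_ne eta hx

theorem quantumTaubNUT_eq (hbar eta α : ℝ) : quantumTaubNUT (N := n) hbar eta α =
    mulOp _ _ (contDiffOn_weightTaubNUT_inv eta) * freeHam _ hbar α := by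
  have h := add_mulOp_eq_conformal (hbar := hbar) (α := α) (β := 0) (Ω := taubNUTDomain n eta)
    (K := fun x => ‖x‖ / (2 * (eta + ‖x‖))) (V := fun x => α * ‖x‖ / (eta + ‖x‖))
    (hK := (contDiffOn_norm_of_ne (taubNUT_ne eta)).div
        (contDiffOn_const.mul (contDiffOn_const.add (contDiffOn_norm_of_ne (taubNUT_ne eta))))
        fun x hx => mul_ne_zero two_ne_zero (taubNUT_pos eta x hx).ne')
    (hV := (contDiffOn_const.mul (contDiffOn_norm_of_ne (taubNUT_ne eta))).div
        (contDiffOn_const.add (contDiffOn_norm_of_ne (taubNUT_ne eta)))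
        fun x hx => (taubNUT_pos eta x hx).ne')
    (contDiffOn_weightTaubNUT_inv eta) (fun x _ => by rw [inv_div, mul_comm 2, ← div_div]; ring)
    (fun x _ => by rw [inv_div]; ring)
  rwa [Complex.ofReal_zero, zero_smul, sub_zero] at h

theorem lrlTaubNUT_eq (hbar eta α : ℝ) (i : Fin n) : lrlTaubNUT hbar eta α i =
    lrlSeed _ hbar i + (eta : ℂ) • (unitOp _ (taubNUT_ne eta) i *
      (mulOp _ _ (contDiffOn_weightTaubNUT_inv eta) * freeHam _ hbar α)) := by
  rw [lrlTaubNUT, quantumTaubNUT_eq]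

theorem weightTaubNUT_eq (eta : ℝ) {r : ℝ} (hr : 0 < r) :
    (eta + r) / r = 1 + eta * r⁻¹ := by
  field_simp
  ring

theorem isSystem_TaubNUT {hbar : ℝ} (hh : hbar ≠ 0) (eta α : ℝ) (i : Fin (n + 2)) :
    ∃ a b, IsSystem hbar (weightTaubNUT eta) (quantumTaubNUT (N := n + 2) hbar eta α)
      (lrlTaubNUT hbar eta α i) a b := by
  have h := inverse_isSystem (Ω := taubNUTDomain (n + 2) eta) (W := fun r => (eta + r) / r)
    (hbar := hbar) (α := α) (c := 1) (k := eta) (h := taubNUT_ne eta)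
    (hwi := contDiffOn_weightTaubNUT_inv eta) (contDiffOn_weightTaubNUT eta) hh
    (fun x hx => weightTaubNUT_ne eta hx) (fun r hr => weightTaubNUT_eq eta hr)
    -- Large radii are admissible for either sign of `η`.
    (infinite_of_Ioi_subset (a := |eta|) fun r (hr : |eta| < r) => ?_) i
  · rw [← lrlTaubNUT_eq, ← quantumTaubNUT_eq] at h
    exact ⟨_, _, h⟩
  · have hr0 : 0 < r := (abs_nonneg eta).trans_lt hr
    have hr1 : 0 < eta + r := by linarith [neg_abs_le eta]
    exact ⟨hr0, div_pos hr1 hr0, fun x hx => ⟨norm_pos_iff.1 (hx ▸ hr0), hx ▸ hr1⟩⟩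

theorem sum_lrlTaubNUT_sq (hbar eta α : ℝ) : ∑ i : Fin n, lrlTaubNUT hbar eta α i ^ 2 =
    (2 : ℂ) • (totalAngMomSq _ hbar * (quantumTaubNUT hbar eta α - (α : ℂ) • 1)) +
      ((eta : ℂ) ^ 2) • quantumTaubNUT hbar eta α ^ 2 +
      (1 / 2 * ((n : ℂ) - 1) ^ 2 * (hbar : ℂ) ^ 2) •
        (quantumTaubNUT hbar eta α - (α : ℂ) • 1) := by
  have hW := mulOp_eq_inverse (c := 1) (k := eta) (hw := contDiffOn_weightTaubNUT (n := n) eta)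
    (taubNUT_ne eta) fun x hx => weightTaubNUT_eq eta (norm_pos_iff.2 (taubNUT_ne eta x hx))
  simp only [lrlTaubNUT_eq]
  rw [sum_sq_lrl_conformal hW fun x hx => inv_mul_cancel₀ (weightTaubNUT_ne eta hx),
    ← quantumTaubNUT_eq]
  simp only [Complex.ofReal_one, one_smul]

theorem isSchrodingerQuantization_TaubNUT (hbar eta α : ℝ) :
    IsSchrodingerQuantization hbar (classicalTaubNUT eta α)
      (quantumTaubNUT (N := n) hbar eta α) :=
  ⟨_, _, _, _, fun q _ p => by rw [classicalTaubNUT]; ring, rfl⟩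

end Systems

end CurvedQuantum

theorem proposition8 (N : ℕ) (hN : 2 ≤ N) (hbar α lam eta : ℝ) (hhbar : 0 < hbar)
    (hlam : lam ≠ 0) (heta : eta ≠ 0) :
    -- the curved Kepler-Coulomb system
    (IsSchrodingerQuantization hbar (classicalKC α)
        (quantumKC (N := N) hbar α) ∧
      HasAngularMomentumSymmetries hbar weightKC
        (quantumKC (N := N) hbar α) ∧
      (∀ i j : Fin N,
        IsObservable weightKC (fradkinKC hbar α i j) ∧
        Commute (quantumKC (N := N) hbar α) (fradkinKC hbar α i j)) ∧
      (∑ i : Fin N, fradkinKC hbar α i i = (-2 * α : ℂ) • 1) ∧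
      (∀ i : Fin N, IsMaximallySuperintegrableWith hbar weightKC
        (quantumKC (N := N) hbar α) (fradkinKC hbar α i i))) ∧
    -- the Darboux III oscillator
    (IsSchrodingerQuantization hbar (classicalDarboux lam α)
        (quantumDarboux (N := N) hbar lam α) ∧
      HasAngularMomentumSymmetries hbar (weightDarboux lam)
        (quantumDarboux (N := N) hbar lam α) ∧
      (∀ i j : Fin N,
        IsObservable (weightDarboux lam)
          (fradkinDarboux hbar lam α i j) ∧
        Commute (quantumDarboux (N := N) hbar lam α)
          (fradkinDarboux hbar lam α i j)) ∧
      (∑ i : Fin N, fradkinDarboux hbar lam α i i =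
        (2 : ℂ) • quantumDarboux hbar lam α) ∧
      (∀ i : Fin N, IsMaximallySuperintegrableWith hbar
        (weightDarboux lam) (quantumDarboux (N := N) hbar lam α)
        (fradkinDarboux hbar lam α i i))) ∧
    -- the curved spherical oscillator
    (IsSchrodingerQuantization hbar (classicalO α)
        (quantumO (N := N) hbar α) ∧
      HasAngularMomentumSymmetries hbar weightO
        (quantumO (N := N) hbar α) ∧
      (∀ i : Fin N,
        IsObservable weightO (lrlO hbar α i) ∧
        Commute (quantumO (N := N) hbar α) (lrlO hbar α i)) ∧
      (∑ i : Fin N, lrlO hbar α i ^ 2 =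
        quantumO hbar α ^ 2 - (2 * α : ℂ) • totalAngMomSq _ hbar -
          (1 / 2 * ((N : ℂ) - 1) ^ 2 * (hbar : ℂ) ^ 2 * (α : ℂ)) • 1) ∧
      (∀ i : Fin N, IsMaximallySuperintegrableWith hbar weightO
        (quantumO (N := N) hbar α) (lrlO hbar α i))) ∧
    -- the Taub-NUT oscillator
    (IsSchrodingerQuantization hbar (classicalTaubNUT eta α)
        (quantumTaubNUT (N := N) hbar eta α) ∧
      HasAngularMomentumSymmetries hbar (weightTaubNUT eta)
        (quantumTaubNUT (N := N) hbar eta α) ∧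
      (∀ i : Fin N,
        IsObservable (weightTaubNUT eta)
          (lrlTaubNUT hbar eta α i) ∧
        Commute (quantumTaubNUT (N := N) hbar eta α)
          (lrlTaubNUT hbar eta α i)) ∧
      (∑ i : Fin N, lrlTaubNUT hbar eta α i ^ 2 =
        (2 : ℂ) • (totalAngMomSq _ hbar *
            (quantumTaubNUT hbar eta α - (α : ℂ) • 1)) +
          ((eta : ℂ) ^ 2) • quantumTaubNUT hbar eta α ^ 2 +
          (1 / 2 * ((N : ℂ) - 1) ^ 2 * (hbar : ℂ) ^ 2) •
            (quantumTaubNUT hbar eta α - (α : ℂ) • 1)) ∧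
      (∀ i : Fin N, IsMaximallySuperintegrableWith hbar
        (weightTaubNUT eta) (quantumTaubNUT (N := N) hbar eta α)
        (lrlTaubNUT hbar eta α i))) := by 
  obtain ⟨n, rfl⟩ : ∃ n, N = n + 2 := ⟨N - 2, by omega⟩
  have hh : hbar ≠ 0 := hhbar.ne'
  refine ⟨⟨isSchrodingerQuantization_KC hbar α, ?_, fradkinKC_symmetry hbar α,
      sum_fradkinKC hbar α, fun i => ?_⟩,
    ⟨isSchrodingerQuantization_Darboux hbar lam α, ?_, fradkinDarboux_symmetry hbar lam α,
      sum_fradkinDarboux hbar lam α, fun i => ?_⟩,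
    ⟨isSchrodingerQuantization_O hbar α, ?_, fun i => ?_, sum_lrlO_sq hbar α, fun i => ?_⟩,
    ⟨isSchrodingerQuantization_TaubNUT hbar eta α, ?_, fun i => ?_, sum_lrlTaubNUT_sq hbar eta α,
      fun i => ?_⟩⟩
  -- The angular momentum symmetries do not involve the extra observable, so any index will do; `0`
  -- is used for each system.
  · obtain ⟨a, b, h⟩ := isSystem_KC (n := n) hh α 0
    exact h.hasAngularMomentumSymmetries
  · obtain ⟨a, b, h⟩ := isSystem_KC hh α i
    exact h.isMaximallySuperintegrableWith
  · obtain ⟨a, b, h⟩ := isSystem_Darboux (n := n) hh lam α 0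
    exact h.hasAngularMomentumSymmetries
  · obtain ⟨a, b, h⟩ := isSystem_Darboux hh lam α i
    exact h.isMaximallySuperintegrableWith
  · obtain ⟨a, b, h⟩ := isSystem_O (n := n) hh α 0
    exact h.hasAngularMomentumSymmetries
  · obtain ⟨a, b, h⟩ := isSystem_O hh α i
    exact ⟨h.observable_S, h.commute_S⟩
  · obtain ⟨a, b, h⟩ := isSystem_O hh α i
    exact h.isMaximallySuperintegrableWith
  · obtain ⟨a, b, h⟩ := isSystem_TaubNUT (n := n) hh eta α 0
    exact h.hasAngularMomentumSymmetries
  · obtain ⟨a, b, h⟩ := isSystem_TaubNUT hh eta α i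
    exact ⟨h.observable_S, h.commute_S⟩
  · obtain ⟨a, b, h⟩ := isSystem_TaubNUT hh eta α i
    exact h.isMaximallySuperintegrableWith
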